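/- Let $L>0$, $\alpha\in[0,2\pi)$, $0<\beta<1/2$, and identify $\mathbb{R}^2$ with $\mathbb{C}$. For $\varepsilon>0$ and $w=(w_1,w_2)\in L^2((0,1);\mathbb{R}^2)$ set $$F_\varepsilon(w)=\int_0^1 \frac{\varepsilon}{2}\left|\left(w\,e^{2\pi i\lfloor\varepsilon^{-\beta}\rfloor x}\right)'\right|^2+\frac{1}{4\varepsilon}\left(|w|^2-1\right)^2+\frac{L}{2}\left(w_1w_2'-w_2w_1'+2\pi\lfloor\varepsilon^{-\beta}\rfloor|w|^2-2\pi\varepsilon^{-\beta}\right)^2dx$$ if $w\in H^1((0,1);\mathbb{R}^2)$, $w(0)=1$ and $w(1)=e^{i\alpha}$, and $F_\varepsilon(w)=+\infty$ otherwise. (With $u=w\,e^{2\pi i\lfloor\varepsilon^{-\beta}\rfloor x}$ this is $\int_0^1\frac{\varepsilon}{2}|u'|^2+\frac{1}{4\varepsilon}(|u|^2-1)^2+\frac{L}{2}(u_1u_2'-u_2u_1'-2\pi\varepsilon^{-\beta})^2dx$, with $u(0)=1$, $u(1)=e^{i\alpha}$.) For $A\in[0,1]$ define $E_{0,A}$ on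 $L^2((0,1);\mathbb{R}^2)$ by $$E_{0,A}(w)=\frac{L}{2}\int_0^1\left(w_1w_2'-w_2w_1'-2\pi A\right)^2dx+\frac{2\sqrt2}{3}\,\mathcal{H}^0(J)$$ if $w\in H^1((0,1)\setminus J;S^1)$ for some finite set $J\subset[0,1]$, and $E_{0,A}(w)=+\infty$ otherwise. Here $\mathcal{H}^0$ is counting measure and $J$ is the jump set of $w$: no point of $J\cap(0,1)$ can be removed from $J$ without losing $w\in H^1((0,1)\setminus J;S^1)$, one has $0\in J$ if and only if the trace $w(0^+)$ differs from $1$, and $1\in J$ if and only if the trace $w(1^-)$ differs from $e^{i\alpha}$. Theorem. Let $(\varepsilon_\ell)_{\ell\in\mathbb{N}}$ be a sequence of positive numbers with $\varepsilon_\ell\to0$ such that $\varepsilon_\ell^{-\beta}-\lfloor\varepsilon_\ell^{-\beta}\rfloor\to A$ for some $A\in[0,1]$. Then $F_{\varepsilon_\ell}$ $\Gamma$-converges to $E_{0,A}$ in $L^2((0,1);\mathbb{R}^2)$: for every $w$ and every sequence $w_\ell\to w$ in $L^2$ one has $E_{0,A}(w)\le\liminf_{\ell\to\infty}F_{\varepsilon_\ell}(w_\ell)$,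 and for every $w$ there is a sequence $w_\ell\to w$ in $L^2$ with $\lim_{\ell\to\infty}F_{\varepsilon_\ell}(w_\ell)=E_{0,A}(w)$. -/

import Mathlib

open MeasureTheory Filter Topology Set
open scoped ENNReal ContDiff

noncomputable section

/-- The unit interval `(0,1)`. -/
def unitInt : Set ℝ := Ioo (0 : ℝ) 1

/-- `v` is a distributional derivative of `u` on the open set `U ⊆ ℝ`:
`∫_U φ' u = - ∫_U φ v` for all smooth `φ` with compact support in `U`.
(Used only together with square integrability of `u` and `v` on a bounded set `U`.) -/
def IsWeakDeriv (U : Set ℝ) (u v : ℝ → ℂ) : Prop :=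
  ∀ φ : ℝ → ℝ, ContDiff ℝ ∞ φ → HasCompactSupport φ → tsupport φ ⊆ U →
    ∫ x in U, deriv φ x • u x = - ∫ x in U, φ x • v x

/-- `v ∈ L²(U)` is the weak derivative of `u` on `U`. -/
def IsL2WeakDeriv (U : Set ℝ) (u v : ℝ → ℂ) : Prop :=
  MemLp v 2 (volume.restrict U) ∧ IsWeakDeriv U u v

/-- The Sobolev space `H¹(U; ℝ²)`, with `ℝ²` identified with `ℂ`. -/
def MemH1 (U : Set ℝ) (u : ℝ → ℂ) : Prop :=
  MemLp u 2 (volume.restrict U) ∧ ∃ v, IsL2WeakDeriv U u v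

/-- The Sobolev class `H¹(U; S¹)`. -/
def MemH1Circle (U : Set ℝ) (u : ℝ → ℂ) : Prop :=
  MemH1 U u ∧ ∀ᵐ x ∂(volume.restrict U), ‖u x‖ = 1

open Classical in
/-- The weak derivative of `u ∈ H¹(U)` (unique up to null sets). -/
def weakDeriv (U : Set ℝ) (u : ℝ → ℂ) : ℝ → ℂ :=
  if h : ∃ v, IsL2WeakDeriv U u v then h.choose else 0

/-- The trace `u(0⁺)` exists and equals `z`: some representative of `u` on `(0,1)` tends to `z`
as `x ↓ 0`. -/
def HasTraceZero (u : ℝ → ℂ) (z : ℂ) : Prop :=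
  ∃ g : ℝ → ℂ, g =ᵐ[volume.restrict unitInt] u ∧ Tendsto g (𝓝[>] (0 : ℝ)) (𝓝 z)

/-- The trace `u(1⁻)` exists and equals `z`: some representative of `u` on `(0,1)` tends to `z`
as `x ↑ 1`. -/
def HasTraceOne (u : ℝ → ℂ) (z : ℂ) : Prop :=
  ∃ g : ℝ → ℂ, g =ᵐ[volume.restrict unitInt] u ∧ Tendsto g (𝓝[<] (1 : ℝ)) (𝓝 z)

/-- The admissible class: `u ∈ H¹((0,1); ℝ²)` with `u(0) = 1`, `u(1) = e^{iα}`. -/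
def Admissible (α : ℝ) (u : ℝ → ℂ) : Prop :=
  MemH1 unitInt u ∧ HasTraceZero u 1 ∧ HasTraceOne u (Complex.exp (Complex.I * α))

/-- The twist `u₁ u₂' - u₂ u₁'` of a vector `u = z` with derivative `u' = z'`. -/
def twist (z z' : ℂ) : ℝ := z.re * z'.im - z.im * z'.re

/-- The Hilbert space `L²((0,1); ℝ²)`, with `ℝ²` identified with `ℂ`. -/
abbrev L2Space : Type := Lp ℂ 2 (volume.restrict unitInt)

/-- The integer part `⌊ε^{-β}⌋`. -/
def pitchFloor (β ε : ℝ) : ℤ := ⌊ε ^ (-β)⌋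

/-- The modulated function `x ↦ w(x) e^{2πi⌊ε^{-β}⌋x}`, i.e. `u` in terms of `w`. -/
def modulate (β ε : ℝ) (w : ℝ → ℂ) : ℝ → ℂ := fun x =>
  w x * Complex.exp (2 * Real.pi * Complex.I * (pitchFloor β ε : ℂ) * (x : ℂ))

/-- The energy density of `F_ε(w)`. -/
def demodDensity (L β ε : ℝ) (w : ℝ → ℂ) (x : ℝ) : ℝ :=
  ε / 2 * ‖weakDeriv unitInt (modulate β ε w) x‖ ^ 2
    + 1 / (4 * ε) * (‖w x‖ ^ 2 - 1) ^ 2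
    + L / 2 * (twist (w x) (weakDeriv unitInt w x)
        + ‖w x‖ ^ 2 * (2 * Real.pi * (pitchFloor β ε : ℝ)) - 2 * Real.pi * ε ^ (-β)) ^ 2

open Classical in
/-- The demodulated energy `F_ε`, equal to `+∞` off the admissible class. -/
def demodEnergy (L α β ε : ℝ) (w : L2Space) : ℝ≥0∞ :=
  if Admissible α w then ∫⁻ x in unitInt, ENNReal.ofReal (demodDensity L β ε w x) else ⊤

/-- `J ⊆ [0,1]` is the jump set of `w`: `w ∈ H¹((0,1) ∖ J; S¹)`, no point of `J ∩ (0,1)` can be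
removed from `J`, and the endpoints `0`, `1` belong to `J` exactly when the corresponding trace of
`w` violates the boundary condition `w(0⁺) = 1`, resp. `w(1⁻) = e^{iα}`. -/
structure IsJumpSet (α : ℝ) (w : ℝ → ℂ) (J : Finset ℝ) : Prop where
  subset : (J : Set ℝ) ⊆ Icc 0 1
  memH1 : MemH1Circle (unitInt \ (J : Set ℝ)) w
  minimal : ∀ x ∈ J, x ∈ unitInt → ¬ MemH1Circle (unitInt \ ((J : Set ℝ) \ {x})) w
  zero_mem_iff : (0 : ℝ) ∈ J ↔ ¬ HasTraceZero w 1
  one_mem_iff : (1 : ℝ) ∈ J ↔ ¬ HasTraceOne w (Complex.exp (Complex.I * α))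

/-- The value of the limit functional at `w` with jump set `J`:
`(L/2) ∫₀¹ (w₁ w₂' - w₂ w₁' - 2πA)² dx + (2√2/3) 𝓗⁰(J)`. -/
def jumpTwistValue (L A : ℝ) (w : ℝ → ℂ) (J : Finset ℝ) : ℝ≥0∞ :=
  (∫⁻ x in unitInt, ENNReal.ofReal
    (L / 2 * (twist (w x) (weakDeriv (unitInt \ (J : Set ℝ)) w x) - 2 * Real.pi * A) ^ 2))
  + ENNReal.ofReal (2 * Real.sqrt 2 / 3) * (J.card : ℝ≥0∞)

open Classical in
/-- The limit functional `E_{0,A}`: finite iff `w ∈ H¹((0,1) ∖ J; S¹)` for some finite `J`, in which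
case it is evaluated with the (unique) jump set of `w`. -/
def limitEnergy (L α A : ℝ) (w : L2Space) : ℝ≥0∞ :=
  if h : ∃ J : Finset ℝ, IsJumpSet α w J then jumpTwistValue L A w h.choose else ⊤

/-- (Sequential) `Γ`-convergence of `F_n` to `G`: the liminf inequality along every convergent
sequence, and existence of a recovery sequence at every point. -/
def GammaConverges {X : Type*} [TopologicalSpace X] (F : ℕ → X → ℝ≥0∞) (G : X → ℝ≥0∞) : Prop :=
  (∀ (x : X) (u : ℕ → X), Tendsto u atTop (𝓝 x) →
      G x ≤ liminf (fun n => F n (u n)) atTop) ∧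
  (∀ x : X, ∃ u : ℕ → X, Tendsto u atTop (𝓝 x) ∧
      Tendsto (fun n => F n (u n)) atTop (𝓝 (G x)))

end

/-! Write `N = ⌊ε^{-β}⌋` and `h` for the quantity squared in the twist term. Multiplication by the
carrier `e^{2πiNx}` does not change the modulus, so `F_ε` is the Modica–Mortola energy of the
modulated function plus `L/2 ∫ h²`.

Lower bound. By the Modica–Mortola inequality `ofReal_abs_sub_le_lintegral_wellDensity`, a descent
of the modulus from one to zero and back costs `2√2/3`, also at an endpoint, where the boundary
value has modulus one. Hence with bounded energy the points `V` near which the moduli approach zero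
are finite in number (`eventually_wells_cost`, `finite_vanishing`). Away from `V` the modulus is
bounded below, and `f/|f|` has derivative `i (twist/|f|²) f/|f|`. Inserting the definition of `h`,
the factor `twist/|f|²` equals `h + 2πA` up to errors, the worst being of order `ε^{-β}(1 - |f|²)`.
The potential term bounds `1 - |f|²` in `L²` by a multiple of `√ε`, so this error vanishes because
`β < 1/2`. If `H` is a weak `L²` limit of `h`, then `w' = i(H + 2πA)w` off `V` (`phase_limit`). The
test functions need not vanish at 0 and 1, so the equation also carries the boundary values.
Therefore `|w| = 1`, the jump set lies in `V`, and the limit twist minus `2πA` is `H`. Lower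
semicontinuity of the norm and the cost of the wells give the inequality
(`limitEnergy_le_of_eventually`). Working along an ultrafilter replaces repeated extraction of
subsequences.

Upper bound. Multiply `w` by a cutoff `D` carrying a nearly optimal well of width of order `ε` at
each jump (`exists_profile`, `exists_wellCutoff`). At a violated boundary condition the well is
moved slightly inside, and `w` is replaced by the prescribed constant between it and the endpoint.
Since `D'W` is parallel to `DW`, the cutoff creates no twist of its own. Off the wells the twist
term sees only the fractional part of `ε^{-β}`, which tends to `A`. Inside them the set has measure
of order `ε` and the modulation contributes of order `ε^{1-2β}`, which tends to zero, again because
`β < 1/2` (`WellCutoff.exists_competitor`). A diagonal choice then yields one recovery sequence. -/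

/-! ### Absolutely continuous functions and their primitives -/

/-- Absolute continuity is inherited along a Lipschitz bound on increments. -/
theorem AbsolutelyContinuousOnInterval.of_dist_le {X Y : Type*} [PseudoMetricSpace X]
    [PseudoMetricSpace Y] {f : ℝ → X} {G : ℝ → Y} {a b : ℝ} (K : ℝ)
    (hG : AbsolutelyContinuousOnInterval G a b)
    (h : ∀ x ∈ uIcc a b, ∀ y ∈ uIcc a b, dist (f x) (f y) ≤ K * dist (G x) (G y)) :
    AbsolutelyContinuousOnInterval f a b := by
  have h2 : Tendsto (fun E : ℕ × (ℕ → ℝ × ℝ) =>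
      K * ∑ i ∈ Finset.range E.1, dist (G (E.2 i).1) (G (E.2 i).2))
      (AbsolutelyContinuousOnInterval.totalLengthFilter ⊓
        𝓟 (AbsolutelyContinuousOnInterval.disjWithin a b)) (𝓝 0) := by
    simpa using Tendsto.const_mul K hG
  refine squeeze_zero' (Eventually.of_forall fun E => Finset.sum_nonneg fun i _ => dist_nonneg) ?_ h2
  have : ∀ᶠ E in (AbsolutelyContinuousOnInterval.totalLengthFilter ⊓
        𝓟 (AbsolutelyContinuousOnInterval.disjWithin a b)),
        E ∈ AbsolutelyContinuousOnInterval.disjWithin a b :=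
    mem_inf_of_right (mem_principal_self _)
  filter_upwards [this] with E hE
  rw [Finset.mul_sum]
  refine Finset.sum_le_sum fun i hi => h _ ?_ _ ?_
  · exact (hE.1 i hi).1
  · exact (hE.1 i hi).2

/-- Increments are dominated by those of the real primitive of `‖g‖`. -/
theorem absolutelyContinuousOnInterval_integral {g : ℝ → ℂ} {a b : ℝ}
    (hg : IntervalIntegrable g volume a b) :
    AbsolutelyContinuousOnInterval (fun x => ∫ t in a..x, g t) a b := by
  have h1 := hg.norm.absolutelyContinuousOnInterval_intervalIntegral (c := a) (by simp)
  refine .of_dist_le 1 h1 fun x hx y hy => ?_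
  have i1 : IntervalIntegrable g volume a x := hg.mono_set (uIcc_subset_uIcc_left hx)
  have i2 : IntervalIntegrable g volume a y := hg.mono_set (uIcc_subset_uIcc_left hy)
  rw [dist_eq_norm, Real.dist_eq, intervalIntegral.integral_interval_sub_left i1 i2,
    intervalIntegral.integral_interval_sub_left i1.norm i2.norm, one_mul]
  exact intervalIntegral.norm_integral_le_abs_integral_norm

/-- `f` is absolutely continuous on `[a, b]` with integrable derivative `g`. -/
structure IsACPrim {E : Type*} [NormedAddCommGroup E] [NormedSpace ℝ E]
    (a b : ℝ) (f g : ℝ → E) : Prop where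
  ac : AbsolutelyContinuousOnInterval f a b
  int : IntervalIntegrable g volume a b
  hasDeriv : ∀ᵐ x, x ∈ Ioo a b → HasDerivAt f (g x) x

namespace IsACPrim

theorem mono {E : Type*} [NormedAddCommGroup E] [NormedSpace ℝ E]
    {a b c d : ℝ} {f g : ℝ → E} (h : IsACPrim a b f g) (hac : a ≤ c) (hcd : c ≤ d) (hdb : d ≤ b) :
    IsACPrim c d f g := by
  have hs : uIcc c d ⊆ uIcc a b := by
    rw [uIcc_of_le hcd, uIcc_of_le (hac.trans (hcd.trans hdb))]
    exact Icc_subset_Icc hac hdb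
  refine ⟨h.ac.mono hs, h.int.mono_set hs, ?_⟩
  filter_upwards [h.hasDeriv] with x hx hx2
  exact hx (Ioo_subset_Ioo hac hdb hx2)

theorem continuousOn {E : Type*} [NormedAddCommGroup E] [NormedSpace ℝ E]
    {a b : ℝ} {f g : ℝ → E} (h : IsACPrim a b f g) (hab : a ≤ b) : ContinuousOn f (Icc a b) := by
  rw [← uIcc_of_le hab]
  exact h.ac.continuousOn

theorem of_integral {g : ℝ → ℂ} {a b : ℝ} (hg : IntervalIntegrable g volume a b) (c : ℂ) :
    IsACPrim a b (fun x => c + ∫ t in a..x, g t) g := by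
  refine ⟨?_, hg, ?_⟩
  · refine .of_dist_le 1 (absolutelyContinuousOnInterval_integral hg) fun x _ y _ => ?_
    simp
  · filter_upwards [hg.ae_hasDerivAt_integral] with x hx hx2
    have := hx (Icc_subset_uIcc (Ioo_subset_Icc_self hx2)) a (by simp)
    exact this.const_add c

/-- The fundamental theorem of calculus. -/
theorem integral_eq {f g : ℝ → ℂ} {a b : ℝ} (h : IsACPrim a b f g) (hab : a ≤ b) :
    ∫ t in a..b, g t = f b - f a := by
  -- The difference with the primitive of `g` is absolutely continuous with zero derivative almost
  -- everywhere, hence constant.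
  have h2 : AbsolutelyContinuousOnInterval (f - fun x => ∫ t in a..x, g t) a b :=
    h.ac.sub (absolutelyContinuousOnInterval_integral h.int)
  obtain ⟨C, hC⟩ := h2.const_of_ae_hasDerivAt_zero (by
    have n1 : ∀ᵐ x : ℝ, x ≠ a := by simp [ae_iff, measure_singleton]
    have n2 : ∀ᵐ x : ℝ, x ≠ b := by simp [ae_iff, measure_singleton]
    filter_upwards [h.hasDeriv, h.int.ae_hasDerivAt_integral, n1, n2] with x hx hx2 h1 h2 hx3
    have := hx2 hx3 a (by simp)
    rw [uIcc_of_le hab] at hx3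
    have h5 := (hx ⟨lt_of_le_of_ne hx3.1 (Ne.symm h1), lt_of_le_of_ne hx3.2 h2⟩).sub this
    simpa using h5)
  have ea := hC a (by simp)
  have eb := hC b (by simp)
  simp at ea eb
  rw [ea, ← eb]; ring

theorem smul {E : Type*} [NormedAddCommGroup E] [NormedSpace ℝ E] {a b : ℝ} {φ φ' : ℝ → ℝ}
    {f g : ℝ → E} (hφ : IsACPrim a b φ φ') (h : IsACPrim a b f g) :
    IsACPrim a b (fun x => φ x • f x) (fun x => φ' x • f x + φ x • g x) := by
  refine ⟨hφ.ac.smul h.ac, ?_, ?_⟩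
  · exact (hφ.int.smul_continuousOn h.ac.continuousOn).add (h.int.continuousOn_smul hφ.ac.continuousOn)
  · filter_upwards [hφ.hasDeriv, h.hasDeriv] with x h1 h2 hx
    rw [add_comm]
    exact (h1 hx).smul (h2 hx)

theorem mul {a b : ℝ} {φ φ' : ℝ → ℂ}
    {f g : ℝ → ℂ} (hφ : IsACPrim a b φ φ') (h : IsACPrim a b f g) :
    IsACPrim a b (fun x => φ x * f x) (fun x => φ' x * f x + φ x * g x) := by
  refine ⟨hφ.ac.smul h.ac, ?_, ?_⟩
  · exact (hφ.int.mul_continuousOn h.ac.continuousOn).add (h.int.continuousOn_mul hφ.ac.continuousOn)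
  · filter_upwards [hφ.hasDeriv, h.hasDeriv] with x h1 h2 hx
    exact (h1 hx).mul (h2 hx)

theorem of_contDiff {E : Type*} [NormedAddCommGroup E] [NormedSpace ℝ E] {a b : ℝ} {φ : ℝ → E}
    (h : ContDiff ℝ 1 φ) : IsACPrim a b φ (deriv φ) := by
  refine ⟨h.contDiffOn.absolutelyContinuousOnInterval,
    (h.continuous_deriv le_rfl).intervalIntegrable _ _, .of_forall fun x _ => ?_⟩
  exact (h.differentiable one_ne_zero x).hasDerivAt

end IsACPrim

theorem setIntegral_Ioo_eq_intervalIntegral {E : Type*} [NormedAddCommGroup E] [NormedSpace ℝ E]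
    {a b : ℝ} (hab : a ≤ b) (f : ℝ → E) : ∫ x in Ioo a b, f x = ∫ x in a..b, f x := by
  rw [intervalIntegral.integral_of_le hab, integral_Ioc_eq_integral_Ioo]

/-- Integration by parts against a smooth function, with boundary terms. -/
theorem IsACPrim.integral_deriv_smul {a b : ℝ} (hab : a ≤ b) {f g : ℝ → ℂ} (h : IsACPrim a b f g)
    {φ : ℝ → ℝ} (hφ : ContDiff ℝ 1 φ) :
    ∫ x in Ioo a b, deriv φ x • f x = φ b • f b - φ a • f a - ∫ x in Ioo a b, φ x • g x := by
  have h1 := IsACPrim.of_contDiff (a := a) (b := b) hφ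
  have h2 := (h1.smul h).integral_eq hab
  rw [intervalIntegral.integral_add (h1.int.smul_continuousOn h.ac.continuousOn)
    (h.int.continuousOn_smul h1.ac.continuousOn)] at h2
  rw [setIntegral_Ioo_eq_intervalIntegral hab, setIntegral_Ioo_eq_intervalIntegral hab, ← h2]
  ring

theorem IsACPrim.isWeakDeriv {a b : ℝ} (hab : a ≤ b) {f g : ℝ → ℂ} (h : IsACPrim a b f g) :
    IsWeakDeriv (Ioo a b) f g := by
  intro φ hφ _ hs
  rw [h.integral_deriv_smul hab (hφ.of_le (by exact_mod_cast le_top))]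
  have ha : φ a = 0 := image_eq_zero_of_notMem_tsupport fun h => by simpa using hs h
  have hb : φ b = 0 := image_eq_zero_of_notMem_tsupport fun h => by simpa using hs h
  simp [ha, hb]

/-! ### Weak derivatives: uniqueness, representatives, gluing -/

theorem IsWeakDeriv.congr {U : Set ℝ} {u u' v v' : ℝ → ℂ} (h : IsWeakDeriv U u v)
    (hu : u =ᵐ[volume.restrict U] u') (hv : v =ᵐ[volume.restrict U] v') : IsWeakDeriv U u' v' := by
  intro φ h1 h2 h3
  have := h φ h1 h2 h3
  have e1 : ∫ x in U, deriv φ x • u x = ∫ x in U, deriv φ x • u' x :=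
    integral_congr_ae (hu.mono fun x hx => by simp only [hx])
  have e2 : ∫ x in U, φ x • v x = ∫ x in U, φ x • v' x :=
    integral_congr_ae (hv.mono fun x hx => by simp only [hx])
  rw [← e1, ← e2, this]

theorem integrable_smul_of_compactSupport {μ : Measure ℝ} {φ : ℝ → ℝ} (hφ : Continuous φ)
    (hc : HasCompactSupport φ) {u : ℝ → ℂ} (hu : Integrable u μ) :
    Integrable (fun x => φ x • u x) μ := by
  obtain ⟨C, hC⟩ := hφ.bounded_above_of_compact_support hc
  exact hu.bdd_smul C hφ.aestronglyMeasurable (.of_forall hC)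

/-- Uniqueness of weak derivatives. -/
theorem IsWeakDeriv.unique {U : Set ℝ} (hU : IsOpen U) {u v w : ℝ → ℂ}
    (hv : IntegrableOn v U) (hw : IntegrableOn w U)
    (h1 : IsWeakDeriv U u v) (h2 : IsWeakDeriv U u w) : v =ᵐ[volume.restrict U] w := by
  have key := hU.ae_eq_zero_of_integral_contDiff_smul_eq_zero (f := v - w) (μ := volume)
    (hv.sub hw).locallyIntegrableOn (by
      intro g hg hc hs
      have e : ∫ x, g x • (v - w) x = ∫ x in U, g x • (v - w) x := by
        rw [setIntegral_eq_integral_of_forall_compl_eq_zero]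
        intro x hx
        rw [image_eq_zero_of_notMem_tsupport fun h => hx (hs h), zero_smul]
      rw [e]
      have := h1 g hg hc hs
      rw [h2 g hg hc hs] at this
      simp only [Pi.sub_apply, smul_sub]
      rw [integral_sub (integrable_smul_of_compactSupport hg.continuous hc hv)
        (integrable_smul_of_compactSupport hg.continuous hc hw), neg_injective this.symm.symm]
      exact sub_self _)
  rw [EventuallyEq, ae_restrict_iff' hU.measurableSet]
  filter_upwards [key] with x hx hxU
  simpa [sub_eq_zero] using hx hxU

theorem integrableOn_of_memLp_two {U : Set ℝ} (hU : volume U ≠ ⊤) {v : ℝ → ℂ}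
    (hv : MemLp v 2 (volume.restrict U)) : IntegrableOn v U := by
  have : IsFiniteMeasure (volume.restrict U) := ⟨by simpa using hU.lt_top⟩
  exact hv.integrable (by norm_num)

theorem weakDeriv_spec {U : Set ℝ} {u v : ℝ → ℂ} (h : IsL2WeakDeriv U u v) :
    IsL2WeakDeriv U u (weakDeriv U u) := by
  have : ∃ v, IsL2WeakDeriv U u v := ⟨v, h⟩
  rw [weakDeriv, dif_pos this]
  exact this.choose_spec

theorem weakDeriv_ae_eq {U : Set ℝ} (hU : IsOpen U) (hf : volume U ≠ ⊤) {u v : ℝ → ℂ}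
    (h : IsL2WeakDeriv U u v) : weakDeriv U u =ᵐ[volume.restrict U] v := by
  have h2 := weakDeriv_spec h
  exact IsWeakDeriv.unique hU (integrableOn_of_memLp_two hf h2.1) (integrableOn_of_memLp_two hf h.1)
    h2.2 h.2

/-- The du Bois-Reymond lemma: a function with integrable weak derivative on an interval agrees
almost everywhere with a primitive of it. -/
theorem IsWeakDeriv.ae_eq_primitive {a b : ℝ} (hab : a < b) {u v : ℝ → ℂ}
    (hu : IntegrableOn u (Ioo a b)) (hv : IntegrableOn v (Ioo a b))
    (h : IsWeakDeriv (Ioo a b) u v) :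
    ∃ c : ℂ, u =ᵐ[volume.restrict (Ioo a b)] fun x => c + ∫ t in a..x, v t := by
  have hvi : IntervalIntegrable v volume a b := by
    rwa [intervalIntegrable_iff_integrableOn_Ioo_of_le hab.le]
  have hG := IsACPrim.of_integral hvi 0
  set G : ℝ → ℂ := fun x => 0 + ∫ t in a..x, v t with hGdef
  have hGi : IntegrableOn G (Ioo a b) :=
    ((hG.continuousOn hab.le).integrableOn_Icc).mono_set Ioo_subset_Icc_self
  have hGw := hG.isWeakDeriv hab.le
  have hd : IntegrableOn (u - G) (Ioo a b) := hu.sub hGi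
  have horth : ∀ φ : ℝ → ℝ, ContDiff ℝ ∞ φ → HasCompactSupport φ → tsupport φ ⊆ Ioo a b →
      ∫ x in Ioo a b, deriv φ x • (u - G) x = 0 := by
    intro φ h1 h2 h3
    have e1 := h φ h1 h2 h3
    rw [← hGw φ h1 h2 h3] at e1
    have hc : Continuous (deriv φ) := h1.continuous_deriv (by exact_mod_cast le_top)
    simp only [Pi.sub_apply, smul_sub]
    rw [integral_sub (integrable_smul_of_compactSupport hc h2.deriv hu)
        (integrable_smul_of_compactSupport hc h2.deriv hGi), e1, sub_self]
  -- A fixed bump of positive integral: subtracting a multiple of it gives any test function mean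
  -- zero, and the constant `c` is the `ψ`-average of `u - G`.
  obtain ⟨ψ, ψs, ψc, ψd, ψr, ψm⟩ := exists_contDiff_tsupport_subset (n := ⊤)
    (x := (a + b) / 2) (isOpen_Ioo.mem_nhds (⟨by linarith, by linarith⟩ : (a + b) / 2 ∈ Ioo a b))
  have ψd : ContDiff ℝ ∞ ψ := ψd
  have hψint : 0 < ∫ x, ψ x := by
    refine ψd.continuous.integral_pos_of_hasCompactSupport_nonneg_nonzero ψc
      (fun x => (ψr ⟨x, rfl⟩).1) (x := (a + b) / 2) (by rw [ψm]; exact one_ne_zero)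
  set I := ∫ x, ψ x with hI
  set c : ℂ := (I⁻¹ : ℝ) • ∫ x in Ioo a b, ψ x • (u - G) x with hcdef
  refine ⟨c, ?_⟩
  have key := isOpen_Ioo.ae_eq_zero_of_integral_contDiff_smul_eq_zero (U := Ioo a b)
    (f := (u - G) - (fun _ => c : ℝ → ℂ)) (μ := volume)
    (hd.sub (integrableOn_const (by simp) (by simp))).locallyIntegrableOn (by
      intro g hg hgc hs
      have e : ∫ x, g x • ((u - G) - (fun _ => c : ℝ → ℂ)) x
          = ∫ x in Ioo a b, g x • ((u - G) - (fun _ => c : ℝ → ℂ)) x := by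
        rw [setIntegral_eq_integral_of_forall_compl_eq_zero]
        intro x hx
        rw [image_eq_zero_of_notMem_tsupport fun h => hx (hs h), zero_smul]
      set m : ℝ := (∫ x, g x) * I⁻¹ with hm
      -- Mean zero makes the primitive of `η` compactly supported in the interval, so it is an
      -- admissible test function with derivative `η`.
      set η : ℝ → ℝ := fun x => g x - m * ψ x with hη
      have ηd : ContDiff ℝ ∞ η := hg.sub (contDiff_const.mul ψd)
      have ηint : ∫ x, η x = 0 := by
        rw [hη, integral_sub (hg.continuous.integrable_of_hasCompactSupport hgc)
          ((ψd.continuous.integrable_of_hasCompactSupport ψc).const_mul m), integral_const_mul, hm]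
        field_simp
        ring
      have ηK : ∀ x, x ∉ tsupport g ∪ tsupport ψ → η x = 0 := by
        intro x hx
        simp only [mem_union, not_or] at hx
        simp [hη, image_eq_zero_of_notMem_tsupport hx.1, image_eq_zero_of_notMem_tsupport hx.2]
      have hKc : IsCompact (tsupport g ∪ tsupport ψ) := hgc.isCompact.union ψc.isCompact
      have hKs : tsupport g ∪ tsupport ψ ⊆ Ioo a b := union_subset hs ψs
      have hKne : (tsupport g ∪ tsupport ψ).Nonempty :=
        ⟨(a + b) / 2, Or.inr (subset_tsupport _ (by rw [Function.mem_support, ψm]; exact one_ne_zero))⟩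
      obtain ⟨a', ha'm, ha'⟩ := hKc.exists_isLeast hKne
      obtain ⟨b', hb'm, hb'⟩ := hKc.exists_isGreatest hKne
      have ηz : ∀ x, x ∉ Icc a' b' → η x = 0 := fun x hx =>
        ηK x fun h => hx ⟨ha' h, hb' h⟩
      set φ : ℝ → ℝ := fun x => ∫ t in a..x, η t with hφ
      have φder : ∀ x, HasDerivAt φ (η x) x := fun x =>
        intervalIntegral.integral_hasDerivAt_right (ηd.continuous.intervalIntegrable _ _)
          (ηd.continuous.stronglyMeasurableAtFilter _ _) ηd.continuous.continuousAt
      have φd' : deriv φ = η := funext fun x => (φder x).deriv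
      have φd : ContDiff ℝ ∞ φ := by
        rw [contDiff_infty_iff_deriv, φd']
        exact ⟨fun x => (φder x).differentiableAt, ηd⟩
      have haa := (hKs ha'm).1
      have hbb := (hKs hb'm).2
      have φs : Function.support φ ⊆ Icc a' b' := by
        intro x hx
        by_contra hx2
        apply hx
        rw [mem_Icc, not_and_or, not_le, not_le] at hx2
        rcases hx2 with hx2 | hx2
        · simp only [hφ]
          rw [intervalIntegral.integral_congr (g := fun _ => (0 : ℝ))]
          · simp
          · intro t ht
            apply ηz
            intro ht2
            have : t ≤ max a x := ht.2
            have : max a x < a' := max_lt haa hx2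
            linarith [ht2.1]
        · have ηint' : ∫ t in Ioc a x, η t = ∫ t, η t := by
            rw [setIntegral_eq_integral_of_forall_compl_eq_zero]
            intro t ht
            apply ηz
            intro ht2
            exact ht ⟨by linarith [ht2.1], by linarith [ht2.2]⟩
          simp only [hφ]
          rw [intervalIntegral.integral_of_le (by linarith [ha' hb'm]), ηint', ηint]
      have φts : tsupport φ ⊆ Icc a' b' := closure_minimal φs isClosed_Icc
      have φc : HasCompactSupport φ := HasCompactSupport.of_support_subset_isCompact isCompact_Icc φs
      have o := horth φ φd φc (φts.trans (Icc_subset_Ioo haa hbb))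
      rw [φd'] at o
      have i1 := integrable_smul_of_compactSupport hg.continuous hgc hd
      have i2 := integrable_smul_of_compactSupport ψd.continuous ψc hd
      have i2' : Integrable (fun x => m • ψ x • (u - G) x) (volume.restrict (Ioo a b)) :=
        i2.smul m
      have o2 : ∫ x in Ioo a b, g x • (u - G) x = m • ∫ x in Ioo a b, ψ x • (u - G) x := by
        rw [← sub_eq_zero, ← integral_smul, ← integral_sub i1 i2', ← o]
        congr 1 with x
        simp only [hη, Pi.sub_apply, sub_smul, mul_smul]
      rw [e]
      simp only [Pi.sub_apply, smul_sub] at *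
      have i3 : IntegrableOn (fun x => g x • c) (Ioo a b) :=
        integrable_smul_of_compactSupport hg.continuous hgc (integrableOn_const (by simp) (by simp))
      have i1' : IntegrableOn (fun x => g x • u x - g x • G x) (Ioo a b) := by
        refine Integrable.congr i1 (.of_forall fun x => ?_)
        simp
      rw [integral_sub i1' i3, o2, integral_smul_const]
      have e3 : ∫ x in Ioo a b, g x = ∫ x, g x := by
        rw [setIntegral_eq_integral_of_forall_compl_eq_zero]
        intro x hx
        exact image_eq_zero_of_notMem_tsupport fun h => hx (hs h)
      rw [e3, hm, hcdef, mul_smul, sub_self])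
  rw [EventuallyEq, ae_restrict_iff' measurableSet_Ioo]
  filter_upwards [key] with x hx hxU
  have := hx hxU
  simp only [Pi.sub_apply, sub_eq_zero, hGdef, zero_add] at this
  rw [← this]; ring

/-- Weak derivatives glue over a union of two open sets. -/
theorem IsWeakDeriv.union {U V : Set ℝ} (hU : IsOpen U) (hV : IsOpen V) {u v : ℝ → ℂ}
    (hu : IntegrableOn u (U ∪ V)) (hv : IntegrableOn v (U ∪ V))
    (h1 : IsWeakDeriv U u v) (h2 : IsWeakDeriv V u v) : IsWeakDeriv (U ∪ V) u v := by
  intro φ hφ hc hs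
  set K := tsupport φ
  have hK : IsCompact K := hc.isCompact
  have hKV : IsClosed (K \ V) := hK.isClosed.sdiff hV
  have hKU : IsClosed (K \ U) := hK.isClosed.sdiff hU
  have hd : K \ V ⊆ (K \ U)ᶜ := fun x hx hx2 => (hs hx.1).elim hx2.2 hx.2
  -- A partition of unity by hand: `χ` is one near the part of the support outside `V` and zero near
  -- the part outside `U`, so `χφ` is supported in `U` and `(1 - χ)φ` in `V`.
  obtain ⟨O, hO, hO1, hO2⟩ := normal_exists_closure_subset hKV hKU.isOpen_compl hd
  obtain ⟨O', hO', hO1', hO2'⟩ := normal_exists_closure_subset hKU isClosed_closure.isOpen_compl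
    (fun x hx hx2 => hO2 hx2 hx : K \ U ⊆ (closure O)ᶜ)
  obtain ⟨χ, χd, -, χ0, χ1⟩ := exists_contMDiff_zero_iff_one_iff_of_isClosed (n := ⊤)
    (modelWithCornersSelf ℝ ℝ) (isClosed_closure (s := O')) (isClosed_closure (s := O))
    (disjoint_left.2 fun x hx hx2 => hO2' hx hx2)
  have χd : ContDiff ℝ ∞ χ := χd.contDiff
  have t1 : tsupport (fun x => χ x * φ x) ⊆ U := by
    intro x hx
    by_contra hxU
    have hxK : x ∈ K := closure_mono (Function.support_mul_subset_right _ _) hx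
    have : x ∈ O' := hO1' ⟨hxK, hxU⟩
    have := mem_closure_iff.1 hx O' hO' this
    obtain ⟨y, hy, hy2⟩ := this
    exact hy2 (by simp [(χ0 y).1 (subset_closure hy)])
  have t2 : tsupport (fun x => (1 - χ x) * φ x) ⊆ V := by
    intro x hx
    by_contra hxU
    have hxK : x ∈ K := closure_mono (Function.support_mul_subset_right _ _) hx
    have : x ∈ O := hO1 ⟨hxK, hxU⟩
    have := mem_closure_iff.1 hx O hO this
    obtain ⟨y, hy, hy2⟩ := this
    exact hy2 (by simp [(χ1 y).1 (subset_closure hy)])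
  have main : ∀ (W : Set ℝ) (hW : IsOpen W) (hWs : W ⊆ U ∪ V) (hw : IsWeakDeriv W u v) (ψ : ℝ → ℝ),
      ContDiff ℝ ∞ ψ → HasCompactSupport ψ → tsupport ψ ⊆ W →
      ∫ x in U ∪ V, deriv ψ x • u x = - ∫ x in U ∪ V, ψ x • v x := by
    intro W hW hWs hw ψ h1 h2 h3
    have := hw ψ h1 h2 h3
    rw [setIntegral_eq_of_subset_of_forall_sdiff_eq_zero (hU.union hV).measurableSet hWs,
      setIntegral_eq_of_subset_of_forall_sdiff_eq_zero (hU.union hV).measurableSet hWs, this]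
    · intro x hx
      rw [image_eq_zero_of_notMem_tsupport fun h => hx.2 (h3 h), zero_smul]
    · intro x hx
      rw [image_eq_zero_of_notMem_tsupport fun h => hx.2 (h3 (tsupport_deriv_subset h)), zero_smul]
  have d1 : ContDiff ℝ ∞ (fun x => χ x * φ x) := χd.mul hφ
  have d2 : ContDiff ℝ ∞ (fun x => (1 - χ x) * φ x) := (contDiff_const.sub χd).mul hφ
  have c1 : HasCompactSupport (fun x => χ x * φ x) := hc.mul_left
  have c2 : HasCompactSupport (fun x => (1 - χ x) * φ x) := hc.mul_left
  have e1 := main U hU subset_union_left h1 _ d1 c1 t1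
  have e2 := main V hV subset_union_right h2 _ d2 c2 t2
  have hsum : φ = (fun x => χ x * φ x) + (fun x => (1 - χ x) * φ x) := by
    ext x; simp; ring
  have dsum : ∀ x, deriv φ x = deriv (fun x => χ x * φ x) x + deriv (fun x => (1 - χ x) * φ x) x := by
    intro x
    conv_lhs => rw [hsum]
    exact deriv_add (d1.differentiable (by simp) x) (d2.differentiable (by simp) x)
  have one : (1 : WithTop ℕ∞) ≤ ((⊤ : ℕ∞) : WithTop ℕ∞) := by exact_mod_cast le_top
  have l : ∫ x in U ∪ V, deriv φ x • u x = (∫ x in U ∪ V, deriv (fun x => χ x * φ x) x • u x)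
      + ∫ x in U ∪ V, deriv (fun x => (1 - χ x) * φ x) x • u x := by
    rw [← integral_add (integrable_smul_of_compactSupport (d1.continuous_deriv one) c1.deriv hu)
      (integrable_smul_of_compactSupport (d2.continuous_deriv one) c2.deriv hu)]
    simp only [dsum, add_smul]
  have r : ∫ x in U ∪ V, φ x • v x = (∫ x in U ∪ V, (χ x * φ x) • v x)
      + ∫ x in U ∪ V, ((1 - χ x) * φ x) • v x := by
    rw [← integral_add (integrable_smul_of_compactSupport d1.continuous c1 hv)
      (integrable_smul_of_compactSupport d2.continuous c2 hv)]
    simp only [← add_smul]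
    congr 1 with x
    congr 1; ring
  rw [l, r, e1, e2]; ring

/-! ### Traces and the carrier wave -/

theorem measurableSet_unitInt : MeasurableSet unitInt := measurableSet_Ioo

theorem isOpen_unitInt : IsOpen unitInt := isOpen_Ioo

theorem volume_unitInt : volume unitInt = 1 := by simp [unitInt]

instance : IsProbabilityMeasure (volume.restrict unitInt) := ⟨by simp [volume_unitInt]⟩

/-- Two functions agreeing almost everywhere to the right of a point have the same right limit. -/
theorem eq_of_tendsto_nhdsGT {a b : ℝ} (hab : a < b) {f g : ℝ → ℂ}
    (h : f =ᵐ[volume.restrict (Ioo a b)] g) {z z' : ℂ}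
    (hf : Tendsto f (𝓝[>] a) (𝓝 z)) (hg : Tendsto g (𝓝[>] a) (𝓝 z')) : z = z' := by
  refine tendsto_nhds_unique_of_frequently_eq hf hg fun hne => ?_
  obtain ⟨c, hc, hc2⟩ := mem_nhdsGT_iff_exists_Ioo_subset.1 hne
  have h2 : ∀ᵐ x ∂(volume.restrict (Ioo a (min b c))), False := by
    filter_upwards [ae_restrict_of_ae_restrict_of_subset
      (Ioo_subset_Ioo_right (min_le_left b c)) h, ae_restrict_mem measurableSet_Ioo] with x hx hx2
    exact hc2 ⟨hx2.1, hx2.2.trans_le (min_le_right _ _)⟩ hx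
  rw [eventually_false_iff_eq_bot, ae_eq_bot, Measure.restrict_eq_zero] at h2
  have h3 : a < min b c := lt_min hab hc
  simp [hab.not_ge, (show a < c from hc).not_ge] at h2

/-- Two functions agreeing almost everywhere to the left of a point have the same left limit. -/
theorem eq_of_tendsto_nhdsLT {a b : ℝ} (hab : a < b) {f g : ℝ → ℂ}
    (h : f =ᵐ[volume.restrict (Ioo a b)] g) {z z' : ℂ}
    (hf : Tendsto f (𝓝[<] b) (𝓝 z)) (hg : Tendsto g (𝓝[<] b) (𝓝 z')) : z = z' := by
  refine tendsto_nhds_unique_of_frequently_eq hf hg fun hne => ?_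
  obtain ⟨c, hc, hc2⟩ := mem_nhdsLT_iff_exists_Ioo_subset.1 hne
  have h2 : ∀ᵐ x ∂(volume.restrict (Ioo (max a c) b)), False := by
    filter_upwards [ae_restrict_of_ae_restrict_of_subset
      (Ioo_subset_Ioo_left (le_max_left a c)) h, ae_restrict_mem measurableSet_Ioo] with x hx hx2
    exact hc2 ⟨(le_max_right _ _).trans_lt hx2.1, hx2.2⟩ hx
  rw [eventually_false_iff_eq_bot, ae_eq_bot, Measure.restrict_eq_zero] at h2
  have h3 : max a c < b := max_lt hab hc
  simp [hab.not_ge, (show c < b from hc).not_ge] at h2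

/-- The carrier wave `x ↦ e^{2πiNx}`. -/
noncomputable def carrier (N : ℤ) (x : ℝ) : ℂ := Complex.exp (2 * Real.pi * Complex.I * N * x)

theorem norm_carrier (N : ℤ) (x : ℝ) : ‖carrier N x‖ = 1 := by
  rw [carrier, show (2 * Real.pi * Complex.I * N * x : ℂ) = ((2 * Real.pi * N * x : ℝ) : ℂ) * Complex.I by
    push_cast; ring]
  exact Complex.norm_exp_ofReal_mul_I _

theorem hasDerivAt_carrier (N : ℤ) (x : ℝ) :
    HasDerivAt (carrier N) (2 * Real.pi * Complex.I * N * carrier N x) x := by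
  have h : HasDerivAt (fun y : ℝ => (2 * Real.pi * Complex.I * N * y : ℂ))
      (2 * Real.pi * Complex.I * N * 1) x := (Complex.ofRealCLM.hasDerivAt (x := x)).const_mul _
  refine h.cexp.congr_deriv ?_
  rw [mul_one, mul_comm]
  rfl

theorem contDiff_carrier (N : ℤ) : ContDiff ℝ ∞ (carrier N) := by
  unfold carrier
  exact (contDiff_const.mul Complex.ofRealCLM.contDiff).cexp

theorem modulate_eq (β ε : ℝ) (w : ℝ → ℂ) :
    modulate β ε w = fun x => w x * carrier (pitchFloor β ε) x := rfl

/-- The modulated derivative `w' + 2πiNw`, up to the carrier. -/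
theorem IsL2WeakDeriv.mul_carrier {w v : ℝ → ℂ} (hw : MemLp w 2 (volume.restrict unitInt))
    (h : IsL2WeakDeriv unitInt w v) (N : ℤ) :
    IsL2WeakDeriv unitInt (fun x => w x * carrier N x)
      (fun x => (v x + 2 * Real.pi * Complex.I * N * w x) * carrier N x) := by
  have hm : AEStronglyMeasurable (carrier N) (volume.restrict unitInt) :=
    (contDiff_carrier N).continuous.aestronglyMeasurable
  have fin : volume unitInt ≠ ⊤ := by simp [volume_unitInt]
  have hwi : IntegrableOn w unitInt := integrableOn_of_memLp_two fin hw
  have hvi : IntegrableOn v unitInt := integrableOn_of_memLp_two fin h.1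
  constructor
  · have h1 : MemLp (fun x => v x + 2 * Real.pi * Complex.I * N * w x) 2 (volume.restrict unitInt) :=
      h.1.add (hw.const_mul _)
    refine h1.of_le (h1.1.mul hm) (.of_forall fun x => ?_)
    rw [norm_mul, norm_carrier, mul_one]
  -- The product rule is applied to the absolutely continuous representative and transported back
  -- almost everywhere.
  · obtain ⟨c, hc⟩ := h.2.ae_eq_primitive zero_lt_one hwi hvi
    have hP := IsACPrim.of_integral
      ((intervalIntegrable_iff_integrableOn_Ioo_of_le zero_le_one).2 hvi) c
    have hQ := hP.mul (IsACPrim.of_contDiff (a := 0) (b := 1)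
      ((contDiff_carrier N).of_le (by exact_mod_cast le_top)))
    refine (hQ.isWeakDeriv zero_le_one).congr ?_ ?_
    · exact hc.mono fun x hx => by simp only [hx]
    · refine hc.mono fun x hx => ?_
      simp only [(hasDerivAt_carrier N x).deriv, hx]
      ring

/-- An admissible function has an absolutely continuous representative attaining the boundary
values. -/
theorem Admissible.exists_rep {α : ℝ} {w : ℝ → ℂ} (h : Admissible α w) :
    ∃ f : ℝ → ℂ, IsACPrim 0 1 f (weakDeriv unitInt w) ∧ w =ᵐ[volume.restrict unitInt] f ∧
      f 0 = 1 ∧ f 1 = Complex.exp (Complex.I * α) ∧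
      MemLp (weakDeriv unitInt w) 2 (volume.restrict unitInt) := by
  obtain ⟨⟨hw, v, hv⟩, h0, h1⟩ := h
  have hs := weakDeriv_spec hv
  have fin : volume unitInt ≠ ⊤ := by simp [volume_unitInt]
  have hvi := integrableOn_of_memLp_two fin hs.1
  obtain ⟨c, hc⟩ := hs.2.ae_eq_primitive zero_lt_one (integrableOn_of_memLp_two fin hw) hvi
  have hP := IsACPrim.of_integral
      ((intervalIntegrable_iff_integrableOn_Ioo_of_le zero_le_one).2 hvi) c
  have hcont := hP.continuousOn zero_le_one
  refine ⟨_, hP, hc, ?_, ?_, hs.1⟩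
  · obtain ⟨g, hg, hgt⟩ := h0
    refine eq_of_tendsto_nhdsGT zero_lt_one (hg.trans hc).symm ?_ hgt
    have := (hcont 0 (by simp)).mono Ioo_subset_Icc_self
    rwa [ContinuousWithinAt, nhdsWithin_Ioo_eq_nhdsGT zero_lt_one] at this
  · obtain ⟨g, hg, hgt⟩ := h1
    refine eq_of_tendsto_nhdsLT zero_lt_one (hg.trans hc).symm ?_ hgt
    have := (hcont 1 (by simp)).mono Ioo_subset_Icc_self
    rwa [ContinuousWithinAt, nhdsWithin_Ioo_eq_nhdsLT zero_lt_one] at this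

/-! ### The Modica–Mortola lower bound -/

/-- The Modica–Mortola potential, a primitive of `s ↦ (1 - s²)/√2`. -/
noncomputable def wellPrimitive (s : ℝ) : ℝ := (s - s ^ 3 / 3) / √2

/-- The Modica–Mortola density of a function with modulus `r` and speed `d`. -/
noncomputable def wellDensity (ε r d : ℝ) : ℝ := ε / 2 * d ^ 2 + 1 / (4 * ε) * (r ^ 2 - 1) ^ 2

theorem wellDensity_nonneg {ε : ℝ} (hε : 0 < ε) (r d : ℝ) : 0 ≤ wellDensity ε r d := by
  unfold wellDensity; positivity

/-- Arithmetic–geometric mean inequality between the gradient and the potential: the difference is a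
perfect square over `4ε`. -/
theorem abs_mul_le_wellDensity {ε : ℝ} (hε : 0 < ε) {r d d' : ℝ} (hd : |d| ≤ d') :
    |(1 - r ^ 2) / √2 * d| ≤ wellDensity ε r d' := by
  have h2 : √2 ^ 2 = 2 := Real.sq_sqrt (by norm_num)
  have h2p : 0 < √2 := by positivity
  rw [abs_mul, abs_div, abs_of_pos h2p]
  have h1 : |1 - r ^ 2| / √2 * |d| ≤ |1 - r ^ 2| / √2 * d' := by gcongr
  refine h1.trans ?_
  have e : wellDensity ε r d' - |1 - r ^ 2| / √2 * d'
      = 1 / (4 * ε) * (|1 - r ^ 2| - √2 * ε * d') ^ 2 := by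
    have h3 : (r ^ 2 - 1) ^ 2 = |1 - r ^ 2| ^ 2 := by rw [sq_abs]; ring
    rw [wellDensity, h3]
    field_simp
    have : √2 ^ 3 = 2 * √2 := by rw [pow_succ, h2]
    ring_nf
    rw [this, h2]; ring
  have : 0 ≤ 1 / (4 * ε) * (|1 - r ^ 2| - √2 * ε * d') ^ 2 := by positivity
  linarith

/-- The reverse triangle inequality for difference quotients, passed to the limit. -/
theorem abs_deriv_norm_le {E : Type*} [NormedAddCommGroup E] [NormedSpace ℝ E] {f : ℝ → E} {f' : E}
    {d x : ℝ} (h : HasDerivAt f f' x) (h2 : HasDerivAt (fun y => ‖f y‖) d x) : |d| ≤ ‖f'‖ := by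
  rw [hasDerivAt_iff_tendsto_slope] at h h2
  refine le_of_tendsto_of_tendsto h2.abs h.norm (.of_forall fun y => ?_)
  simp only [slope, vsub_eq_sub, smul_eq_mul, abs_mul, norm_smul, Real.norm_eq_abs]
  gcongr
  exact abs_norm_sub_norm_le _ _

/-- The Modica–Mortola lower bound. -/
theorem ofReal_abs_sub_le_lintegral_wellDensity {ε : ℝ} (hε : 0 < ε) {a b : ℝ} (hab : a ≤ b)
    {f g : ℝ → ℂ} (h : IsACPrim a b f g) :
    ENNReal.ofReal |wellPrimitive ‖f b‖ - wellPrimitive ‖f a‖| ≤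
      ∫⁻ x in Ioo a b, ENNReal.ofReal (wellDensity ε ‖f x‖ ‖g x‖) := by
  have hr : AbsolutelyContinuousOnInterval (fun x => ‖f x‖) a b :=
    .of_dist_le 1 h.ac fun x _ y _ => by
      rw [one_mul, Real.dist_eq, dist_eq_norm]; exact abs_norm_sub_norm_le _ _
  have hP : AbsolutelyContinuousOnInterval (fun x => wellPrimitive ‖f x‖) a b := by
    have e : (fun x => wellPrimitive ‖f x‖)
        = fun x => (√2)⁻¹ * (‖f x‖ - 3⁻¹ * (‖f x‖ * (‖f x‖ * ‖f x‖))) := by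
      ext x; rw [wellPrimitive]; ring
    rw [e]
    exact (hr.fun_sub ((hr.fun_mul (hr.fun_mul hr)).const_mul _)).const_mul _
  have e1 := hP.integral_deriv_eq_sub
  rw [← e1, intervalIntegral.integral_of_le hab, integral_Ioc_eq_integral_Ioo, ← Real.norm_eq_abs,
    ofReal_norm]
  refine (enorm_integral_le_lintegral_enorm _).trans (lintegral_mono_ae ?_)
  rw [ae_restrict_iff' measurableSet_Ioo]
  filter_upwards [h.hasDeriv, hr.ae_differentiableAt] with x h1 h2 hx
  have d1 := h1 hx
  have d2 := (h2 (Icc_subset_uIcc (Ioo_subset_Icc_self hx))).hasDerivAt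
  have d3 : HasDerivAt (fun y => wellPrimitive ‖f y‖)
      ((1 - ‖f x‖ ^ 2) / √2 * deriv (fun y => ‖f y‖) x) x := by
    have := (d2.sub ((d2.pow 3).div_const 3)).div_const (√2)
    refine this.congr_deriv ?_
    simp; ring
  rw [d3.deriv, ← ofReal_norm, Real.norm_eq_abs]
  exact ENNReal.ofReal_le_ofReal (abs_mul_le_wellDensity hε (abs_deriv_norm_le d1 d2))

/-- The maximum at `s = 1` is `√2/3`, and the deficit is quadratic there: `2/3 - (s - s³/3) = (1 -
s)²(2 + s)/3`, to be divided by `√2`. -/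
theorem wellPrimitive_lower {s δ : ℝ} (hs : 0 ≤ s) (hδ : δ ≤ 1) (h : |s ^ 2 - 1| ≤ δ) :
    √2 / 3 - δ ≤ wellPrimitive s := by
  have h2 : √2 ^ 2 = 2 := Real.sq_sqrt (by norm_num)
  have h2p : 1 < √2 := by rw [Real.lt_sqrt] <;> norm_num
  have hδ0 : 0 ≤ δ := (abs_nonneg _).trans h
  obtain ⟨ha, hb⟩ := abs_le.1 h
  have h3 : (1 - s) ^ 2 ≤ δ ^ 2 := by
    have : (1 - s) ^ 2 * 1 ≤ (1 - s) ^ 2 * (1 + s) ^ 2 := by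
      gcongr; nlinarith
    have : (s ^ 2 - 1) ^ 2 ≤ δ ^ 2 := sq_le_sq' ha hb
    nlinarith
  have h4 : s ≤ 2 := by nlinarith
  have e : √2 / 3 = (2 / 3) / √2 := by field_simp; linarith
  rw [wellPrimitive, e, sub_le_iff_le_add, div_le_iff₀ (by positivity), add_mul,
    div_mul_cancel₀ _ (by positivity)]
  have : (1 - s) ^ 2 * (2 + s) ≤ δ ^ 2 * 4 := by gcongr; linarith
  nlinarith

theorem wellPrimitive_upper {s : ℝ} (hs : 0 ≤ s) : wellPrimitive s ≤ s := by
  have h2p : 1 < √2 := by rw [Real.lt_sqrt] <;> norm_num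
  rw [wellPrimitive, div_le_iff₀ (by positivity)]
  have : 0 ≤ s ^ 3 := by positivity
  nlinarith

/-- A bounded potential energy forces the modulus close to one somewhere. -/
theorem exists_modulus_near_one {ε δ M s t : ℝ} (hε : 0 < ε) (hδ : 0 < δ) (hst : s < t)
    {r d : ℝ → ℝ} (hM : ∫⁻ x in Ioo s t, ENNReal.ofReal (wellDensity ε (r x) (d x))
      ≤ ENNReal.ofReal M)
    (hsmall : 4 * ε * M < δ ^ 2 * (t - s)) : ∃ p ∈ Ioo s t, |r p ^ 2 - 1| ≤ δ := by
  by_contra! hcon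
  have h1 : ∫⁻ x in Ioo s t, ENNReal.ofReal (δ ^ 2 / (4 * ε)) ≤
      ∫⁻ x in Ioo s t, ENNReal.ofReal (wellDensity ε (r x) (d x)) := by
    refine setLIntegral_mono' measurableSet_Ioo fun x hx => ENNReal.ofReal_le_ofReal ?_
    have h2 : δ ^ 2 ≤ (r x ^ 2 - 1) ^ 2 := by
      rw [← sq_abs (r x ^ 2 - 1)]
      exact pow_le_pow_left₀ hδ.le (hcon x hx).le 2
    have h3 : 0 ≤ ε / 2 * d x ^ 2 := by positivity
    have h4 : δ ^ 2 / (4 * ε) ≤ 1 / (4 * ε) * (r x ^ 2 - 1) ^ 2 := by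
      rw [div_mul_eq_mul_div, one_mul]; gcongr
    rw [wellDensity]; linarith
  have h5 := h1.trans hM
  rw [setLIntegral_const, Real.volume_Ioo, ← ENNReal.ofReal_mul (by positivity)] at h5
  have hpos : 0 < δ ^ 2 / (4 * ε) * (t - s) := mul_pos (by positivity) (sub_pos.2 hst)
  rw [ENNReal.ofReal_le_ofReal_iff'] at h5
  rcases h5 with h5 | h5
  · rw [div_mul_eq_mul_div, div_le_iff₀ (by positivity)] at h5
    linarith
  · linarith

/-- A zero of the modulus between two points of modulus near one costs almost `2√2/3`. -/
theorem well_cost {ε δ : ℝ} (hε : 0 < ε) (hδ : δ ≤ 1) {p y q : ℝ} (hpy : p ≤ y) (hyq : y ≤ q)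
    {f g : ℝ → ℂ} (h : IsACPrim p q f g) (hp : |‖f p‖ ^ 2 - 1| ≤ δ) (hq : |‖f q‖ ^ 2 - 1| ≤ δ)
    (hy : ‖f y‖ ≤ δ) :
    ENNReal.ofReal (2 * √2 / 3 - 4 * δ) ≤
      ∫⁻ x in Ioo p q, ENNReal.ofReal (wellDensity ε ‖f x‖ ‖g x‖) := by
  have l1 := ofReal_abs_sub_le_lintegral_wellDensity hε hpy (h.mono le_rfl hpy hyq)
  have l2 := ofReal_abs_sub_le_lintegral_wellDensity hε hyq (h.mono hpy hyq le_rfl)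
  have b1 := wellPrimitive_lower (norm_nonneg _) hδ hp
  have b2 := wellPrimitive_lower (norm_nonneg _) hδ hq
  have b3 := (wellPrimitive_upper (norm_nonneg (f y))).trans hy
  have hd : Disjoint (Ioo p y) (Ioo y q) :=
    disjoint_left.2 fun x hx hx2 => lt_asymm hx.2 hx2.1
  calc ENNReal.ofReal (2 * √2 / 3 - 4 * δ)
      ≤ ENNReal.ofReal (|wellPrimitive ‖f y‖ - wellPrimitive ‖f p‖|
        + |wellPrimitive ‖f q‖ - wellPrimitive ‖f y‖|) := by
        -- Each of the two monotone comparisons loses at most `δ` at the end of modulus near one and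
        -- `δ` at the end near zero; together `4δ`.
        apply ENNReal.ofReal_le_ofReal
        have := neg_abs_le (wellPrimitive ‖f y‖ - wellPrimitive ‖f p‖)
        have := le_abs_self (wellPrimitive ‖f q‖ - wellPrimitive ‖f y‖)
        linarith
    _ ≤ _ := by
        rw [ENNReal.ofReal_add (abs_nonneg _) (abs_nonneg _)]
        refine (add_le_add l1 l2).trans ?_
        rw [← lintegral_union measurableSet_Ioo hd]
        exact lintegral_mono_set (union_subset (Ioo_subset_Ioo_right hyq) (Ioo_subset_Ioo_left hpy))

/-! ### Points where the modulus vanishes in the limit -/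

/-- The moduli `‖f l‖` come arbitrarily close to zero near `x`, along the filter `𝓕`. -/
def Vanishes (𝓕 : Filter ℕ) (f : ℕ → ℝ → ℂ) (x : ℝ) : Prop :=
  ∀ s > 0, ∀ᶠ l in 𝓕, ∃ y ∈ Icc (0 : ℝ) 1, |y - x| < s ∧ ‖f l y‖ < s

/-- On each side of `x`, within distance `r`, the bounded potential energy provides a point of
modulus near one. If `x` is an endpoint, the endpoint itself serves on that side, so a well at the
boundary costs as much as an interior one. -/
theorem eventually_well_cost_at {𝓕 : Filter ℕ} {ε : ℕ → ℝ} (hεpos : ∀ l, 0 < ε l)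
    (hε : Tendsto ε 𝓕 (𝓝 0)) {f g : ℕ → ℝ → ℂ} (hfg : ∀ᶠ l in 𝓕, IsACPrim 0 1 (f l) (g l))
    (h0 : ∀ᶠ l in 𝓕, ‖f l 0‖ = 1) (h1 : ∀ᶠ l in 𝓕, ‖f l 1‖ = 1) {M : ℝ}
    (hM : ∀ᶠ l in 𝓕, ∫⁻ x in unitInt, ENNReal.ofReal (wellDensity (ε l) ‖f l x‖ ‖g l x‖)
      ≤ ENNReal.ofReal M) {x : ℝ} (hx : x ∈ Icc (0 : ℝ) 1) {r : ℝ} (hr : 0 < r)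
    (h0r : x = 0 ∨ r ≤ x) (h1r : x = 1 ∨ r ≤ 1 - x) (hv : Vanishes 𝓕 f x) {δ : ℝ} (hδ : 0 < δ)
    (hδ1 : δ ≤ 1) :
    ∀ᶠ l in 𝓕, ENNReal.ofReal (2 * √2 / 3 - 4 * δ) ≤
      ∫⁻ t in Ioo (x - r) (x + r) ∩ unitInt,
        ENNReal.ofReal (wellDensity (ε l) ‖f l t‖ ‖g l t‖) := by
  have hsmall : ∀ᶠ l in 𝓕, 4 * ε l * M < δ ^ 2 * (r / 2) := by
    have : Tendsto (fun l => 4 * ε l * M) 𝓕 (𝓝 (4 * 0 * M)) := (hε.const_mul 4).mul_const M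
    exact this.eventually_lt_const (by simp; positivity)
  have hδr : 0 < min δ (r / 2) := by positivity
  filter_upwards [hfg, h0, h1, hM, hsmall, hv _ hδr] with l hfg h0 h1 hM hsmall ⟨y, hy, hyx, hyd⟩
  have hyx' := abs_lt.1 (hyx.trans_le (min_le_right _ _))
  have hyd' : ‖f l y‖ ≤ δ := (hyd.trans_le (min_le_left _ _)).le
  have near : ∀ s t, 0 ≤ s → t ≤ 1 → t = s + r / 2 → ∃ p ∈ Ioo s t, |‖f l p‖ ^ 2 - 1| ≤ δ := by
    intro s t hs ht hst
    refine exists_modulus_near_one (hεpos l) hδ (by linarith) (d := fun x => ‖g l x‖) (M := M)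
      ((lintegral_mono_set (Ioo_subset_Ioo hs ht)).trans hM) ?_
    rw [hst]; linarith
  obtain ⟨p, hp0, hpr, hpy, hpd⟩ : ∃ p, 0 ≤ p ∧ x - r ≤ p ∧ p ≤ y ∧ |‖f l p‖ ^ 2 - 1| ≤ δ := by
    rcases h0r with h | h
    · exact ⟨0, le_rfl, by linarith, hy.1, by simp [h0, hδ.le]⟩
    · obtain ⟨p, hp, hp2⟩ := near (x - r) (x - r / 2) (by linarith) (by linarith [hx.2]) (by ring)
      exact ⟨p, by linarith [hp.1], hp.1.le, by linarith [hp.2], hp2⟩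
  obtain ⟨q, hq0, hqr, hqy, hqd⟩ : ∃ q, q ≤ 1 ∧ q ≤ x + r ∧ y ≤ q ∧ |‖f l q‖ ^ 2 - 1| ≤ δ := by
    rcases h1r with h | h
    · exact ⟨1, le_rfl, by linarith, hy.2, by simp [h1, hδ.le]⟩
    · obtain ⟨p, hp, hp2⟩ := near (x + r / 2) (x + r) (by linarith [hx.1]) (by linarith) (by ring)
      exact ⟨p, by linarith [hp.2], hp.2.le, by linarith [hp.1], hp2⟩
  refine (well_cost (hεpos l) hδ1 hpy hqy (hfg.mono hp0 (hpy.trans hqy) hq0) hpd hqd hyd').trans ?_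
  exact lintegral_mono_set (subset_inter (Ioo_subset_Ioo hpr hqr) (Ioo_subset_Ioo hp0 hq0))

theorem exists_separation (V : Finset ℝ) : ∃ r > 0, (∀ x ∈ V, x ∈ Icc (0 : ℝ) 1 →
    (x = 0 ∨ r ≤ x) ∧ (x = 1 ∨ r ≤ 1 - x)) ∧ ∀ x ∈ V, ∀ y ∈ V, x ≠ y → 2 * r ≤ |x - y| := by
  have small : ∀ c : ℝ, 0 < c → ∀ᶠ r in 𝓝[>] (0 : ℝ), r ≤ c := fun c hc =>
    (eventually_le_nhds hc).filter_mono nhdsWithin_le_nhds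
  have e1 : ∀ᶠ r in 𝓝[>] (0 : ℝ), ∀ x ∈ V, x ∈ Icc (0 : ℝ) 1 →
      (x = 0 ∨ r ≤ x) ∧ (x = 1 ∨ r ≤ 1 - x) := by
    rw [eventually_all_finset]
    intro x _
    rcases eq_or_ne x 0 with h0 | h0
    · filter_upwards [small 1 one_pos] with r hr _
      exact ⟨Or.inl h0, Or.inr (by linarith)⟩
    rcases eq_or_ne x 1 with h1 | h1
    · filter_upwards [small 1 one_pos] with r hr _
      exact ⟨Or.inr (by linarith), Or.inl h1⟩
    by_cases hx : x ∈ Icc (0 : ℝ) 1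
    · filter_upwards [small x (lt_of_le_of_ne hx.1 h0.symm),
        small (1 - x) (sub_pos.2 (lt_of_le_of_ne hx.2 h1))] with r h1 h2 _
      exact ⟨Or.inr h1, Or.inr h2⟩
    · exact .of_forall fun r h => absurd h hx
  have e2 : ∀ᶠ r in 𝓝[>] (0 : ℝ), ∀ x ∈ V, ∀ y ∈ V, x ≠ y → 2 * r ≤ |x - y| := by
    simp only [eventually_all_finset]
    intro x _ y _
    rcases eq_or_ne x y with h | h
    · exact .of_forall fun r h' => absurd h h'
    · filter_upwards [small (|x - y| / 2) (by have := abs_pos.2 (sub_ne_zero.2 h); positivity)]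
        with r hr _
      linarith
  obtain ⟨r, ⟨h1, h2⟩, hr⟩ := ((e1.and e2).and self_mem_nhdsWithin).exists
  exact ⟨r, hr, h1, h2⟩

/-- Finitely many vanishing points cost almost `2√2/3` each. -/
theorem eventually_wells_cost {𝓕 : Filter ℕ} {ε : ℕ → ℝ} (hεpos : ∀ l, 0 < ε l)
    (hε : Tendsto ε 𝓕 (𝓝 0)) {f g : ℕ → ℝ → ℂ} (hfg : ∀ᶠ l in 𝓕, IsACPrim 0 1 (f l) (g l))
    (h0 : ∀ᶠ l in 𝓕, ‖f l 0‖ = 1) (h1 : ∀ᶠ l in 𝓕, ‖f l 1‖ = 1) {M : ℝ}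
    (hM : ∀ᶠ l in 𝓕, ∫⁻ x in unitInt, ENNReal.ofReal (wellDensity (ε l) ‖f l x‖ ‖g l x‖)
      ≤ ENNReal.ofReal M) (V : Finset ℝ) (hV : ∀ x ∈ V, x ∈ Icc (0 : ℝ) 1 ∧ Vanishes 𝓕 f x)
    {δ : ℝ} (hδ : 0 < δ) (hδ1 : δ ≤ 1) :
    ∀ᶠ l in 𝓕, V.card * ENNReal.ofReal (2 * √2 / 3 - 4 * δ) ≤
      ∫⁻ t in unitInt, ENNReal.ofReal (wellDensity (ε l) ‖f l t‖ ‖g l t‖) := by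
  obtain ⟨r, hr, hr1, hr2⟩ := exists_separation V
  have key : ∀ᶠ l in 𝓕, ∀ x ∈ V, ENNReal.ofReal (2 * √2 / 3 - 4 * δ) ≤
      ∫⁻ t in Ioo (x - r) (x + r) ∩ unitInt,
        ENNReal.ofReal (wellDensity (ε l) ‖f l t‖ ‖g l t‖) := by
    rw [eventually_all_finset]
    intro x hx
    obtain ⟨a, b⟩ := hr1 x hx (hV x hx).1
    exact eventually_well_cost_at hεpos hε hfg h0 h1 hM (hV x hx).1 hr a b (hV x hx).2 hδ hδ1
  filter_upwards [key] with l hl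
  calc V.card * ENNReal.ofReal (2 * √2 / 3 - 4 * δ)
      = ∑ x ∈ V, ENNReal.ofReal (2 * √2 / 3 - 4 * δ) := by simp
    _ ≤ ∑ x ∈ V, ∫⁻ t in Ioo (x - r) (x + r) ∩ unitInt,
        ENNReal.ofReal (wellDensity (ε l) ‖f l t‖ ‖g l t‖) := Finset.sum_le_sum hl
    _ = ∫⁻ t in ⋃ x ∈ V, Ioo (x - r) (x + r) ∩ unitInt,
        ENNReal.ofReal (wellDensity (ε l) ‖f l t‖ ‖g l t‖) := by
        rw [lintegral_biUnion_finset]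
        · intro x hx y hy hxy
          refine disjoint_left.2 fun t ht ht2 => ?_
          have := hr2 x hx y hy hxy
          have a := ht.1
          have b := ht2.1
          rw [mem_Ioo] at a b
          have : |x - y| < 2 * r := abs_lt.2 ⟨by linarith, by linarith⟩
          linarith
        · exact fun x _ => measurableSet_Ioo.inter measurableSet_unitInt
    _ ≤ _ := lintegral_mono_set (iUnion₂_subset fun x _ => inter_subset_right)

/-- Each vanishing point consumes a fixed positive amount of energy, so more than a certain number
of them would exceed `M`. -/
theorem finite_vanishing {𝓕 : Filter ℕ} [NeBot 𝓕] {ε : ℕ → ℝ} (hεpos : ∀ l, 0 < ε l)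
    (hε : Tendsto ε 𝓕 (𝓝 0)) {f g : ℕ → ℝ → ℂ} (hfg : ∀ᶠ l in 𝓕, IsACPrim 0 1 (f l) (g l))
    (h0 : ∀ᶠ l in 𝓕, ‖f l 0‖ = 1) (h1 : ∀ᶠ l in 𝓕, ‖f l 1‖ = 1) {M : ℝ}
    (hM : ∀ᶠ l in 𝓕, ∫⁻ x in unitInt, ENNReal.ofReal (wellDensity (ε l) ‖f l x‖ ‖g l x‖)
      ≤ ENNReal.ofReal M) : {x | x ∈ Icc (0 : ℝ) 1 ∧ Vanishes 𝓕 f x}.Finite := by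
  by_contra hinf
  -- Any `δ` with `4δ < 2√2/3` would do; `1/12` needs only `√2 > 1`.
  have hc : 0 < ENNReal.ofReal (2 * √2 / 3 - 4 * (1 / 12)) := by
    have h2p : 1 < √2 := by rw [Real.lt_sqrt] <;> norm_num
    exact ENNReal.ofReal_pos.2 (by linarith)
  obtain ⟨n, hn⟩ := ENNReal.exists_nat_mul_gt hc.ne' (ENNReal.ofReal_ne_top (r := M))
  obtain ⟨V, hV, hVc⟩ := Set.Infinite.exists_subset_card_eq hinf n
  obtain ⟨l, hl, hl2⟩ := ((eventually_wells_cost hεpos hε hfg h0 h1 hM V (fun x hx => hV hx)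
    (δ := 1 / 12) (by norm_num) (by norm_num)).and hM).exists
  rw [hVc] at hl
  exact absurd (hl.trans hl2) (not_le.2 hn)

/-- Away from the vanishing points the modulus stays bounded below, along an ultrafilter. -/
theorem exists_modulus_bound {𝒰 : Ultrafilter ℕ} {f : ℕ → ℝ → ℂ} {K : Set ℝ} (hK : IsCompact K)
    (hK1 : K ⊆ Icc 0 1) (hv : ∀ x ∈ K, ¬ Vanishes 𝒰 f x) :
    ∃ δ > 0, ∀ᶠ l in (𝒰 : Filter ℕ), ∀ y ∈ K, δ ≤ ‖f l y‖ := by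
  refine hK.induction_on (p := fun s => ∃ δ > 0, ∀ᶠ l in (𝒰 : Filter ℕ), ∀ y ∈ s, δ ≤ ‖f l y‖)
    ⟨1, one_pos, by simp⟩ ?_ ?_ ?_
  · rintro s t hst ⟨δ, hδ, h⟩
    exact ⟨δ, hδ, h.mono fun l hl y hy => hl y (hst hy)⟩
  · rintro s t ⟨δ, hδ, h⟩ ⟨δ', hδ', h'⟩
    refine ⟨min δ δ', lt_min hδ hδ', ?_⟩
    filter_upwards [h, h'] with l h h' y hy
    exact hy.elim (fun hy => (min_le_left _ _).trans (h y hy))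
      (fun hy => (min_le_right _ _).trans (h' y hy))
  · intro x hx
    have := hv x hx
    -- Here the ultrafilter matters: failing to hold eventually means that the negation holds
    -- eventually, so non-vanishing at `x` gives a lower bound near `x` for eventually all indices.
    simp only [Vanishes, not_forall, ← Ultrafilter.eventually_not] at this
    obtain ⟨s, hs, h⟩ := this
    refine ⟨Metric.ball x s ∩ K, ?_, s, hs, ?_⟩
    · rw [inter_comm]; exact inter_mem_nhdsWithin _ (Metric.ball_mem_nhds x hs)
    · filter_upwards [h] with l hl y hy
      by_contra! hy2
      exact hl ⟨y, hK1 hy.2, hy.1, hy2⟩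

/-! ### Weak compactness in `L²` -/

/-- Bounded sequences in a Hilbert space converge weakly along ultrafilters. -/
theorem exists_weak_limit {H : Type*} [NormedAddCommGroup H] [InnerProductSpace ℝ H]
    [CompleteSpace H] (𝒰 : Ultrafilter ℕ) (h : ℕ → H) (B : ℝ)
    (hb : ∀ᶠ l in (𝒰 : Filter ℕ), ‖h l‖ ≤ B) :
    ∃ h' : H, ∀ ψ, Tendsto (fun l => inner ℝ (h l) ψ) 𝒰 (𝓝 (inner ℝ h' ψ)) := by
  set F : ℕ → WeakDual ℝ H := fun l => StrongDual.toWeakDual (InnerProductSpace.toDual ℝ H (h l))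
  -- Banach–Alaoglu, with the dual identified with `H` by the Riesz map; an ultrafilter on a compact
  -- set converges.
  have hc := WeakDual.isCompact_closedBall (𝕜 := ℝ) (0 : StrongDual ℝ H) B
  obtain ⟨φ, -, hφ⟩ := hc.ultrafilter_le_nhds (𝒰.map F) (by
    rw [Ultrafilter.coe_map, le_principal_iff, mem_map]
    filter_upwards [hb] with l hl
    simpa [F] using hl)
  refine ⟨(InnerProductSpace.toDual ℝ H).symm (WeakDual.toStrongDual φ), fun ψ => ?_⟩
  have h1 : Tendsto F 𝒰 (𝓝 φ) := hφ
  have h2 := ((WeakDual.eval_continuous ψ).tendsto φ).comp h1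
  rw [InnerProductSpace.toDual_symm_apply]
  exact h2

theorem integral_inner_le_of_memLp {X : Type*} [MeasurableSpace X] {μ : Measure X} {f g : X → ℝ}
    (hf : MemLp f 2 μ) (hg : MemLp g 2 μ) :
    2 * ∫ x, f x * g x ∂μ ≤ ∫ x, f x ^ 2 ∂μ + ∫ x, g x ^ 2 ∂μ := by
  rw [← integral_const_mul, ← integral_add hf.integrable_sq hg.integrable_sq]
  refine integral_mono ((hf.integrable_mul hg).const_mul 2)
    (hf.integrable_sq.add hg.integrable_sq) fun x => ?_
  nlinarith [sq_nonneg (f x - g x)]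

/-- Weak compactness in `L²` along an ultrafilter, with lower semicontinuity of the norm. -/
theorem exists_weak_limit_memLp {X : Type*} [MeasurableSpace X] {μ : Measure X}
    (𝒰 : Ultrafilter ℕ) (h : ℕ → X → ℝ) (hm : ∀ᶠ l in (𝒰 : Filter ℕ), MemLp (h l) 2 μ) (B : ℝ)
    (hb : ∀ᶠ l in (𝒰 : Filter ℕ), ∫ x, h l x ^ 2 ∂μ ≤ B) :
    ∃ H : X → ℝ, MemLp H 2 μ ∧
      (∀ ψ, MemLp ψ 2 μ → Tendsto (fun l => ∫ x, h l x * ψ x ∂μ) 𝒰 (𝓝 (∫ x, H x * ψ x ∂μ))) ∧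
      ∀ B', (∀ᶠ l in (𝒰 : Filter ℕ), ∫ x, h l x ^ 2 ∂μ ≤ B') → ∫ x, H x ^ 2 ∂μ ≤ B' := by
  classical
  have inner_eq : ∀ {f g : X → ℝ} (hf : MemLp f 2 μ) (hg : MemLp g 2 μ),
      inner ℝ (hf.toLp f) (hg.toLp g) = ∫ x, f x * g x ∂μ := by
    intro f g hf hg
    rw [L2.inner_def]
    refine integral_congr_ae ?_
    filter_upwards [hf.coeFn_toLp, hg.coeFn_toLp] with x h1 h2
    rw [h1, h2]; simp [mul_comm]
  -- The value 0 is a dummy for indices that the ultrafilter eventually ignores.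
  set k : ℕ → Lp ℝ 2 μ := fun l => if hl : MemLp (h l) 2 μ then hl.toLp (h l) else 0
  obtain ⟨H, hH⟩ := exists_weak_limit 𝒰 k (√B) (by
    filter_upwards [hm, hb] with l h1 h2
    rw [← sq_le_sq₀ (norm_nonneg _) (Real.sqrt_nonneg _)]
    have h0 : 0 ≤ B := le_trans (integral_nonneg fun x => sq_nonneg _) h2
    rw [Real.sq_sqrt h0, ← real_inner_self_eq_norm_sq]
    simp only [k, dif_pos h1, inner_eq]
    simpa [sq] using h2)
  have hlim : ∀ ψ, MemLp ψ 2 μ →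
      Tendsto (fun l => ∫ x, h l x * ψ x ∂μ) 𝒰 (𝓝 (∫ x, H x * ψ x ∂μ)) := by
    intro ψ hψ
    have := hH (hψ.toLp ψ)
    have e : inner ℝ H (hψ.toLp ψ) = ∫ x, H x * ψ x ∂μ := by
      conv_lhs => rw [← Lp.toLp_coeFn H (Lp.memLp H)]
      exact inner_eq _ _
    rw [e] at this
    refine this.congr' ?_
    filter_upwards [hm] with l hl
    simp only [k, dif_pos hl, inner_eq]
  refine ⟨H, Lp.memLp H, hlim, fun B' hB' => ?_⟩
  -- Lower semicontinuity: test with `H` itself and use `2∫hH ≤ ∫h² + ∫H²`.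
  have := hlim H (Lp.memLp H)
  have h2 : ∀ᶠ l in (𝒰 : Filter ℕ), 2 * ∫ x, h l x * H x ∂μ ≤ B' + ∫ x, H x ^ 2 ∂μ := by
    filter_upwards [hm, hB'] with l h1 h2
    exact (integral_inner_le_of_memLp h1 (Lp.memLp H)).trans (by gcongr)
  have h3 := le_of_tendsto (this.const_mul 2) h2
  simp only [← sq] at h3
  linarith

/-! ### The phase equation and its limit -/

/-- Integrability of the derivative comes for free: the real and imaginary parts are absolutely
continuous, so their derivatives are integrable. -/
theorem IsACPrim.of_ac {a b : ℝ} (hab : a ≤ b) {f g : ℝ → ℂ}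
    (h : AbsolutelyContinuousOnInterval f a b)
    (hd : ∀ᵐ x, x ∈ Ioo a b → HasDerivAt f (g x) x) : IsACPrim a b f g := by
  refine ⟨h, ?_, hd⟩
  have hre : AbsolutelyContinuousOnInterval (fun x => (f x).re) a b :=
    .of_dist_le 1 h fun x _ y _ => by
      rw [one_mul, Real.dist_eq, Complex.dist_eq, ← Complex.sub_re]; exact Complex.abs_re_le_norm _
  have him : AbsolutelyContinuousOnInterval (fun x => (f x).im) a b :=
    .of_dist_le 1 h fun x _ y _ => by
      rw [one_mul, Real.dist_eq, Complex.dist_eq, ← Complex.sub_im]; exact Complex.abs_im_le_norm _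
  have i1 := hre.intervalIntegrable_deriv
  have i2 := him.intervalIntegrable_deriv
  rw [intervalIntegrable_iff_integrableOn_Ioo_of_le hab] at i1 i2 ⊢
  refine (i1.ofReal.add (i2.ofReal.mul_const Complex.I)).congr ?_
  rw [EventuallyEq, ae_restrict_iff' measurableSet_Ioo]
  filter_upwards [hd] with x hx hx2
  have d1 : HasDerivAt (fun x => (f x).re) (g x).re x :=
    (Complex.reCLM.hasFDerivAt (x := f x)).comp_hasDerivAt x (hx hx2)
  have d2 : HasDerivAt (fun x => (f x).im) (g x).im x :=
    (Complex.imCLM.hasFDerivAt (x := f x)).comp_hasDerivAt x (hx hx2)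
  simp [d1.deriv, d2.deriv]

/-- Decompose `|f|² f' = ⟨f, f'⟩ f + i twist(f, f') f`. Normalising removes the radial part and
leaves the rotation. -/
theorem hasDerivAt_normalize {f : ℝ → ℂ} {f' : ℂ} {x : ℝ} (h : HasDerivAt f f' x) (h0 : f x ≠ 0) :
    HasDerivAt (fun y => ‖f y‖⁻¹ • f y)
      (Complex.I * (twist (f x) f' / ‖f x‖ ^ 2 : ℝ) * (‖f x‖⁻¹ • f x)) x := by
  have hn : 0 < ‖f x‖ := norm_pos_iff.2 h0
  have h1 : HasDerivAt (fun y => ‖f y‖) (inner ℝ (f x) f' / ‖f x‖) x := by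
    have := h.norm_sq.sqrt (by positivity)
    simp only [Real.sqrt_sq (norm_nonneg _)] at this
    refine this.congr_deriv ?_
    field_simp
  refine ((h1.inv hn.ne').smul h).congr_deriv ?_
  have hsq : ‖f x‖ ^ 2 = (f x).re * (f x).re + (f x).im * (f x).im := by
    rw [← Complex.normSq_eq_norm_sq, Complex.normSq_apply]
  have key : ((‖f x‖ ^ 2 : ℝ) : ℂ) * f' =
      ((inner ℝ (f x) f' : ℝ) : ℂ) * f x + Complex.I * (twist (f x) f' : ℝ) * f x := by
    rw [hsq, Complex.inner, twist]
    apply Complex.ext <;> simp <;> ring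
  have hc : (‖f x‖ : ℂ) ≠ 0 := by exact_mod_cast hn.ne'
  simp only [Complex.real_smul, Pi.inv_apply]
  push_cast at key ⊢
  field_simp
  linear_combination key

theorem mem_tsupport_of_deriv_ne_zero {φ : ℝ → ℝ} {x : ℝ} (h : deriv φ x ≠ 0) : x ∈ tsupport φ :=
  tsupport_deriv_subset (subset_tsupport _ h)

/-- Integration by parts for the phase of `f`, on a region where `f` does not vanish. -/
theorem integral_phase {f g : ℝ → ℂ} (h : IsACPrim 0 1 f g) {δ : ℝ} (hδ : 0 < δ)
    {φ : ℝ → ℝ} (hφ : ContDiff ℝ 1 φ) (hsupp : ∀ x ∈ Icc (0 : ℝ) 1, x ∈ tsupport φ → δ ≤ ‖f x‖)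
    (h0 : ‖f 0‖ = 1) (h1 : ‖f 1‖ = 1) :
    IntegrableOn (fun x => deriv φ x • (‖f x‖⁻¹ • f x)
      + φ x • (Complex.I * (twist (f x) (g x) / ‖f x‖ ^ 2 : ℝ) * (‖f x‖⁻¹ • f x))) unitInt ∧
    ∫ x in unitInt, (deriv φ x • (‖f x‖⁻¹ • f x)
      + φ x • (Complex.I * (twist (f x) (g x) / ‖f x‖ ^ 2 : ℝ) * (‖f x‖⁻¹ • f x)))
      = φ 1 • f 1 - φ 0 • f 0 := by
  -- Truncation below at `δ/2` makes the reciprocal modulus absolutely continuous on the whole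
  -- interval. On the support of `φ`, where the modulus is at least `δ`, nothing changes, even in a
  -- neighbourhood.
  set m : ℝ → ℝ := fun x => (max ‖f x‖ (δ / 2))⁻¹
  have hmac : AbsolutelyContinuousOnInterval m 0 1 := by
    refine .of_dist_le ((δ / 2)⁻¹ * (δ / 2)⁻¹) h.ac fun x _ y _ => ?_
    have a1 : 0 < δ / 2 := by positivity
    have hx : δ / 2 ≤ max ‖f x‖ (δ / 2) := le_max_right _ _
    have hy : δ / 2 ≤ max ‖f y‖ (δ / 2) := le_max_right _ _
    have hx0 := a1.trans_le hx
    have hy0 := a1.trans_le hy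
    have e : m x - m y = (max ‖f x‖ (δ / 2))⁻¹ * (max ‖f y‖ (δ / 2))⁻¹ *
        (max ‖f y‖ (δ / 2) - max ‖f x‖ (δ / 2)) := by
      simp only [m]; field_simp
    rw [Real.dist_eq, e, abs_mul, abs_of_pos (by positivity)]
    have e2 : |max ‖f y‖ (δ / 2) - max ‖f x‖ (δ / 2)| ≤ dist (f x) (f y) := by
      rw [dist_comm, dist_eq_norm]
      refine (abs_max_sub_max_le_abs _ _ _).trans (abs_norm_sub_norm_le _ _)
    gcongr
  have hF : AbsolutelyContinuousOnInterval (fun x => φ x • (m x • f x)) 0 1 :=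
    (IsACPrim.of_contDiff hφ).ac.smul (hmac.smul h.ac)
  set G : ℝ → ℂ := fun x => deriv φ x • (‖f x‖⁻¹ • f x)
      + φ x • (Complex.I * (twist (f x) (g x) / ‖f x‖ ^ 2 : ℝ) * (‖f x‖⁻¹ • f x)) with hG
  have hP : IsACPrim 0 1 (fun x => φ x • (m x • f x)) G := by
    refine .of_ac zero_le_one hF ?_
    filter_upwards [h.hasDeriv] with x hx hx01
    by_cases hxs : x ∈ tsupport φ
    · have hge := hsupp x (Ioo_subset_Icc_self hx01) hxs
      have hne : f x ≠ 0 := norm_pos_iff.1 (hδ.trans_le hge)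
      have hz := hasDerivAt_normalize (hx hx01) hne
      have hev : ∀ᶠ y in 𝓝 x, m y • f y = ‖f y‖⁻¹ • f y := by
        have : ∀ᶠ y in 𝓝 x, δ / 2 < ‖f y‖ :=
          (hx hx01).continuousAt.norm.eventually_const_lt (by linarith)
        filter_upwards [this] with y hy
        simp only [m, max_eq_left hy.le]
      have := ((hφ.differentiable one_ne_zero x).hasDerivAt).smul (hz.congr_of_eventuallyEq hev)
      refine this.congr_deriv ?_
      rw [hev.self_of_nhds, hG, add_comm]
    · have hev : φ =ᶠ[𝓝 x] 0 := notMem_tsupport_iff_eventuallyEq.1 hxs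
      have h0 : φ x = 0 := hev.self_of_nhds
      have h1 : deriv φ x = 0 := by rw [hev.deriv_eq]; simp
      have : G x = 0 := by simp [hG, h0, h1]
      rw [this]
      refine (hasDerivAt_const x (0 : ℂ)).congr_of_eventuallyEq ?_
      filter_upwards [hev] with y hy
      simp [hy]
  refine ⟨(intervalIntegrable_iff_integrableOn_Ioo_of_le zero_le_one).1 hP.int, ?_⟩
  have e := hP.integral_eq zero_le_one
  rw [unitInt, setIntegral_Ioo_eq_intervalIntegral zero_le_one, e]
  have b : ∀ x ∈ Icc (0 : ℝ) 1, ‖f x‖ = 1 → φ x • (m x • f x) = φ x • f x := by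
    intro x hx hx1
    by_cases hxs : x ∈ tsupport φ
    · have := hsupp x hx hxs
      have : m x = 1 := by
        simp only [m]; rw [max_eq_left (by linarith), hx1, inv_one]
      rw [this, one_smul]
    · simp [image_eq_zero_of_notMem_tsupport hxs]
  simp only [b 1 (by simp) h1, b 0 (by simp) h0]

theorem abs_integral_mul_le {X : Type*} [MeasurableSpace X] {μ : Measure X} {f g : X → ℝ}
    (hf : MemLp f 2 μ) (hg : MemLp g 2 μ) :
    ∫ x, |f x| * |g x| ∂μ ≤ √(∫ x, f x ^ 2 ∂μ) * √(∫ x, g x ^ 2 ∂μ) := by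
  have h := integral_mul_norm_le_Lp_mul_Lq (μ := μ) (f := f) (g := g) Real.HolderConjugate.two_two
    (by simpa using hf) (by simpa using hg)
  simpa [Real.sqrt_eq_rpow] using h

/-- The pointwise comparison of the phase derivative with its limit form. -/
theorem norm_phase_sub_le {z w : ℂ} {δ τ h n e A a b C : ℝ} (hδ : 0 < δ) (hz : δ ≤ ‖z‖)
    (hA : A ∈ Icc (0 : ℝ) 1) (he : 0 ≤ e) (ha : |a| ≤ C) (hb : |b| ≤ C)
    (hh : h = τ + ‖z‖ ^ 2 * (2 * Real.pi * n) - 2 * Real.pi * e) :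
    ‖(a • (‖z‖⁻¹ • z) + b • (Complex.I * (τ / ‖z‖ ^ 2 : ℝ) * (‖z‖⁻¹ • z)))
      - (a • w + b • (Complex.I * ((h + 2 * Real.pi * A : ℝ) : ℂ) * w))‖ ≤
      C * ((1 + 2 * Real.pi) * (1 + δ⁻¹ ^ 2)) * ((|1 - ‖z‖ ^ 2| + ‖z - w‖)
        + |h| * (|1 - ‖z‖ ^ 2| + ‖z - w‖) + e * |1 - ‖z‖ ^ 2| + |e - n - A|) := by
  set r := ‖z‖ with hr
  have hr0 : 0 < r := hδ.trans_le hz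
  have hC : 0 ≤ C := (abs_nonneg a).trans ha
  set ζ : ℂ := r⁻¹ • z with hζ
  have hζ1 : ‖ζ‖ = 1 := by rw [hζ, norm_smul, norm_inv, Real.norm_eq_abs, abs_of_pos hr0, ← hr]; field_simp
  have hpi := Real.pi_pos
  set d := |1 - r ^ 2| + ‖z - w‖ with hd
  have hd0 : 0 ≤ d := by positivity
  have hζw : ‖ζ - w‖ ≤ d := by
    have h1 : ‖ζ - z‖ ≤ |1 - r ^ 2| := by
      have e1 : ζ - z = (1 - r) • ζ := by
        rw [hζ, sub_smul, one_smul, smul_smul, mul_inv_cancel₀ hr0.ne', one_smul]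
      rw [e1, norm_smul, hζ1, mul_one, Real.norm_eq_abs]
      have : 1 - r ^ 2 = (1 - r) * (1 + r) := by ring
      rw [this, abs_mul, abs_of_pos (by linarith : 0 < 1 + r)]
      nlinarith [abs_nonneg (1 - r)]
    calc ‖ζ - w‖ = ‖(ζ - z) + (z - w)‖ := by ring_nf
      _ ≤ _ := (norm_add_le _ _).trans (add_le_add h1 le_rfl)
  set k := τ / r ^ 2 - (h + 2 * Real.pi * A) with hk
  have hkb : |k| ≤ δ⁻¹ ^ 2 * |1 - r ^ 2| * (|h| + 2 * Real.pi * e) + 2 * Real.pi * |e - n - A| := by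
    -- Eliminating the twist through `h` separates the error into a modulus defect, amplified by the
    -- large number `e`, and the deviation of the fractional part from `A`.
    have e1 : k = (1 - r ^ 2) / r ^ 2 * (h + 2 * Real.pi * e) + 2 * Real.pi * (e - n - A) := by
      rw [hk, hh]; field_simp; ring
    have e2 : |(1 - r ^ 2) / r ^ 2| ≤ δ⁻¹ ^ 2 * |1 - r ^ 2| := by
      rw [abs_div, abs_of_pos (by positivity : 0 < r ^ 2), inv_pow, mul_comm, ← div_eq_mul_inv]
      gcongr
    have e3 : |h + 2 * Real.pi * e| ≤ |h| + 2 * Real.pi * e := by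
      refine (abs_add_le _ _).trans ?_
      rw [abs_of_nonneg (by positivity : 0 ≤ 2 * Real.pi * e)]
    rw [e1]
    refine (abs_add_le _ _).trans ?_
    rw [abs_mul, abs_mul (2 * Real.pi), abs_of_pos (by positivity : 0 < 2 * Real.pi)]
    gcongr
  have split : (a • ζ + b • (Complex.I * (τ / r ^ 2 : ℝ) * ζ))
      - (a • w + b • (Complex.I * ((h + 2 * Real.pi * A : ℝ) : ℂ) * w))
      = a • (ζ - w) + b • (Complex.I * (k : ℝ) * ζ)
        + b • (Complex.I * ((h + 2 * Real.pi * A : ℝ) : ℂ) * (ζ - w)) := by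
    rw [hk]; simp only [Complex.real_smul]; push_cast; ring
  rw [split]
  have hhA : |h + 2 * Real.pi * A| ≤ |h| + 2 * Real.pi := by
    refine (abs_add_le _ _).trans ?_
    rw [abs_of_nonneg (mul_nonneg (by positivity) hA.1)]
    have : 2 * Real.pi * A ≤ 2 * Real.pi * 1 := by gcongr; exact hA.2
    linarith
  have n1 : ‖a • (ζ - w)‖ ≤ C * d := by
    rw [norm_smul, Real.norm_eq_abs]; gcongr
  have n2 : ‖b • (Complex.I * (k : ℝ) * ζ)‖ ≤ C * |k| := by
    rw [norm_smul, norm_mul, norm_mul, hζ1, Complex.norm_I, Complex.norm_real, Real.norm_eq_abs,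
      Real.norm_eq_abs, one_mul, mul_one]
    gcongr
  have n3 : ‖b • (Complex.I * ((h + 2 * Real.pi * A : ℝ) : ℂ) * (ζ - w))‖
      ≤ C * ((|h| + 2 * Real.pi) * d) := by
    rw [norm_smul, norm_mul, norm_mul, Complex.norm_I, Complex.norm_real, Real.norm_eq_abs,
      Real.norm_eq_abs, one_mul]
    gcongr
  refine (norm_add₃_le).trans ?_
  have hs : |1 - r ^ 2| ≤ d := by rw [hd]; linarith [norm_nonneg (z - w)]
  have hD : 0 ≤ δ⁻¹ ^ 2 := by positivity
  have p1 : δ⁻¹ ^ 2 * |1 - r ^ 2| * |h| ≤ δ⁻¹ ^ 2 * d * |h| := by gcongr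
  have q0 : 0 ≤ |h| * d := by positivity
  have q1 : 0 ≤ e * |1 - r ^ 2| := by positivity
  have q2 := abs_nonneg (e - n - A)
  have q3 : 0 ≤ 2 * Real.pi * δ⁻¹ ^ 2 := by positivity
  have q4 : 0 ≤ 2 * Real.pi := by positivity
  have total : d + |k| + (|h| + 2 * Real.pi) * d ≤ ((1 + 2 * Real.pi) * (1 + δ⁻¹ ^ 2)) * (d
        + |h| * d + e * |1 - r ^ 2| + |e - n - A|) := by
    have e4 : ((1 + 2 * Real.pi) * (1 + δ⁻¹ ^ 2)) * (d
        + |h| * d + e * |1 - r ^ 2| + |e - n - A|) - (d + (δ⁻¹ ^ 2 * d * |h| +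
          δ⁻¹ ^ 2 * |1 - r ^ 2| * (2 * Real.pi * e) + 2 * Real.pi * |e - n - A|)
          + (|h| + 2 * Real.pi) * d)
        = (δ⁻¹ ^ 2 + 2 * Real.pi * δ⁻¹ ^ 2) * d + (2 * Real.pi + 2 * Real.pi * δ⁻¹ ^ 2) * (|h| * d)
          + (1 + 2 * Real.pi + δ⁻¹ ^ 2) * (e * |1 - r ^ 2|)
          + (1 + δ⁻¹ ^ 2 + 2 * Real.pi * δ⁻¹ ^ 2) * |e - n - A| := by ring
    have e5 : 0 ≤ (δ⁻¹ ^ 2 + 2 * Real.pi * δ⁻¹ ^ 2) * d + (2 * Real.pi + 2 * Real.pi * δ⁻¹ ^ 2) * (|h| * d)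
          + (1 + 2 * Real.pi + δ⁻¹ ^ 2) * (e * |1 - r ^ 2|)
          + (1 + δ⁻¹ ^ 2 + 2 * Real.pi * δ⁻¹ ^ 2) * |e - n - A| := by positivity
    linarith
  calc ‖a • (ζ - w)‖ + ‖b • (Complex.I * (k : ℝ) * ζ)‖
        + ‖b • (Complex.I * ((h + 2 * Real.pi * A : ℝ) : ℂ) * (ζ - w))‖
      ≤ C * (d + |k| + (|h| + 2 * Real.pi) * d) := by linarith
    _ ≤ _ := by rw [mul_assoc]; gcongr

/-- Weak convergence tested against complex functions. -/
theorem tendsto_integral_mul_complex {X : Type*} [MeasurableSpace X] {μ : Measure X}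
    {𝓕 : Filter ℕ} {h : ℕ → X → ℝ} {H : X → ℝ} (hm : ∀ᶠ l in 𝓕, MemLp (h l) 2 μ)
    (hH : MemLp H 2 μ) (hlim : ∀ ψ, MemLp ψ 2 μ →
      Tendsto (fun l => ∫ x, h l x * ψ x ∂μ) 𝓕 (𝓝 (∫ x, H x * ψ x ∂μ)))
    {ψ : X → ℂ} (hψ : MemLp ψ 2 μ) :
    Tendsto (fun l => ∫ x, (h l x : ℂ) * ψ x ∂μ) 𝓕 (𝓝 (∫ x, (H x : ℂ) * ψ x ∂μ)) := by
  have e : ∀ {k : X → ℝ}, MemLp k 2 μ → ∫ x, (k x : ℂ) * ψ x ∂μ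
      = ((∫ x, k x * (ψ x).re ∂μ : ℝ) : ℂ) + ((∫ x, k x * (ψ x).im ∂μ : ℝ) : ℂ) * Complex.I := by
    intro k hk
    have hi : Integrable (fun x => (k x : ℂ) * ψ x) μ := hk.ofReal.integrable_mul hψ
    have := integral_re_add_im hi
    rw [← this]
    simp
  rw [e hH]
  refine Tendsto.congr' (hm.mono fun l hl => (e hl).symm) ?_
  exact ((Complex.continuous_ofReal.tendsto _).comp (hlim _ hψ.re)).add
    (((Complex.continuous_ofReal.tendsto _).comp (hlim _ hψ.im)).mul_const _)

theorem IsACPrim.memLp {f g : ℝ → ℂ} (h : IsACPrim 0 1 f g) (p : ℝ≥0∞) :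
    MemLp f p (volume.restrict unitInt) := by
  have hc := h.continuousOn zero_le_one
  obtain ⟨C, hC⟩ := isCompact_Icc.exists_bound_of_continuousOn hc
  refine MemLp.of_bound ((hc.mono Ioo_subset_Icc_self).aestronglyMeasurable measurableSet_unitInt) C ?_
  filter_upwards [ae_restrict_mem measurableSet_unitInt] with x hx
  exact hC x (Ioo_subset_Icc_self hx)

theorem IsACPrim.memLp_one_sub_sq {f g : ℝ → ℂ} (h : IsACPrim 0 1 f g) (p : ℝ≥0∞) :
    MemLp (fun x => 1 - ‖f x‖ ^ 2) p (volume.restrict unitInt) := by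
  have hc : ContinuousOn (fun x => 1 - ‖f x‖ ^ 2) (Icc 0 1) :=
    continuousOn_const.sub ((h.continuousOn zero_le_one).norm.pow 2)
  obtain ⟨C, hC⟩ := isCompact_Icc.exists_bound_of_continuousOn hc
  refine MemLp.of_bound ((hc.mono Ioo_subset_Icc_self).aestronglyMeasurable measurableSet_unitInt) C ?_
  filter_upwards [ae_restrict_mem measurableSet_unitInt] with x hx
  exact hC x (Ioo_subset_Icc_self hx)

theorem integral_abs_le_sqrt {X : Type*} [MeasurableSpace X] {μ : Measure X}
    [IsProbabilityMeasure μ] {f : X → ℝ} (hf : MemLp f 2 μ) :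
    ∫ x, |f x| ∂μ ≤ √(∫ x, f x ^ 2 ∂μ) := by
  have := abs_integral_mul_le hf (memLp_const (μ := μ) (p := 2) (1 : ℝ))
  simpa using this

/-- The error made by replacing the phase derivative with its limit form tends to zero. -/
theorem tendsto_phase_error {𝓕 : Filter ℕ} {d h k : ℕ → ℝ → ℝ} {e s : ℕ → ℝ} {B : ℝ}
    (he : ∀ l, 0 ≤ e l)
    (hd : ∀ᶠ l in 𝓕, MemLp (d l) 2 (volume.restrict unitInt))
    (hk : ∀ᶠ l in 𝓕, MemLp (k l) 2 (volume.restrict unitInt))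
    (hm : ∀ᶠ l in 𝓕, MemLp (h l) 2 (volume.restrict unitInt))
    (hb : ∀ᶠ l in 𝓕, ∫ x in unitInt, h l x ^ 2 ≤ B)
    (hd0 : Tendsto (fun l => ∫ x in unitInt, d l x ^ 2) 𝓕 (𝓝 0))
    (hk0 : Tendsto (fun l => e l * √(∫ x in unitInt, k l x ^ 2)) 𝓕 (𝓝 0))
    (hs : Tendsto s 𝓕 (𝓝 0)) :
    (∀ᶠ l in 𝓕, IntegrableOn (fun x => |d l x| + |h l x| * |d l x| + e l * |k l x| + |s l|) unitInt) ∧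
    Tendsto (fun l => ∫ x in unitInt, (|d l x| + |h l x| * |d l x| + e l * |k l x| + |s l|))
      𝓕 (𝓝 0) := by
  have ints : ∀ᶠ l in 𝓕, Integrable (fun x => |d l x|) (volume.restrict unitInt) ∧
      Integrable (fun x => |h l x| * |d l x|) (volume.restrict unitInt) ∧
      Integrable (fun x => e l * |k l x|) (volume.restrict unitInt) := by
    filter_upwards [hd, hk, hm] with l hd hk hm
    exact ⟨(hd.integrable (by norm_num)).abs, (hm.abs.integrable_mul hd.abs),
      ((hk.integrable (by norm_num)).abs.const_mul _)⟩
  refine ⟨ints.mono fun l h => ((h.1.add h.2.1).add h.2.2).add (integrable_const _), ?_⟩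
  have hlim : Tendsto (fun l => √(∫ x in unitInt, d l x ^ 2) + √B * √(∫ x in unitInt, d l x ^ 2)
      + e l * √(∫ x in unitInt, k l x ^ 2) + |s l|) 𝓕 (𝓝 0) := by
    have h1 := hd0.sqrt
    have := ((h1.add (h1.const_mul (√B))).add hk0).add hs.abs
    simpa using this
  refine squeeze_zero' (.of_forall fun l => integral_nonneg fun x => ?_) ?_ hlim
  · have := he l; positivity
  filter_upwards [ints, hd, hk, hm, hb] with l ⟨i1, i2, i3⟩ hd hk hm hb
  have i12 : Integrable (fun x => |d l x| + |h l x| * |d l x|) (volume.restrict unitInt) := i1.add i2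
  have i123 : Integrable (fun x => |d l x| + |h l x| * |d l x| + e l * |k l x|)
    (volume.restrict unitInt) := i12.add i3
  rw [integral_add i123 (integrable_const _), integral_add i12 i3,
    integral_add i1 i2, integral_const_mul]
  have a1 := integral_abs_le_sqrt hd
  have a2 := (abs_integral_mul_le hm hd).trans
    (mul_le_mul_of_nonneg_right (Real.sqrt_le_sqrt hb) (Real.sqrt_nonneg _))
  have a3 := mul_le_mul_of_nonneg_left (integral_abs_le_sqrt hk) (he l)
  have a4 : ∫ _ in unitInt, |s l| = |s l| := by simp
  rw [a4]
  linarith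

theorem MemLp.smul_of_bound {p : ℝ≥0∞} {φ : ℝ → ℝ} (hφ : Continuous φ) {u : ℝ → ℂ}
    (hu : MemLp u p (volume.restrict unitInt)) :
    MemLp (fun x => φ x • u x) p (volume.restrict unitInt) := by
  obtain ⟨C, hC⟩ := isCompact_Icc.exists_bound_of_continuousOn (s := Icc (0 : ℝ) 1) hφ.continuousOn
  refine hu.of_le_mul (c := C) (hφ.aestronglyMeasurable.smul hu.1) ?_
  filter_upwards [ae_restrict_mem measurableSet_unitInt] with x hx
  rw [norm_smul]
  gcongr
  exact hC x (Ioo_subset_Icc_self hx)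

/-- The weak equation satisfied by the limit, with boundary values, away from the vanishing
points. -/
theorem phase_limit {𝒰 : Ultrafilter ℕ} {f g : ℕ → ℝ → ℂ} {w : ℝ → ℂ} {h : ℕ → ℝ → ℝ} {H : ℝ → ℝ}
    {e n : ℕ → ℝ} {A B : ℝ} {z : ℂ} (hfg : ∀ᶠ l in (𝒰 : Filter ℕ), IsACPrim 0 1 (f l) (g l))
    (f0 : ∀ᶠ l in (𝒰 : Filter ℕ), f l 0 = 1) (f1 : ∀ᶠ l in (𝒰 : Filter ℕ), f l 1 = z)
    (hz : ‖z‖ = 1) (he : ∀ l, 0 ≤ e l) (hA : A ∈ Icc (0 : ℝ) 1)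
    (hh : ∀ l x, h l x = twist (f l x) (g l x) + ‖f l x‖ ^ 2 * (2 * Real.pi * n l)
      - 2 * Real.pi * e l)
    (hm : ∀ᶠ l in (𝒰 : Filter ℕ), MemLp (h l) 2 (volume.restrict unitInt))
    (hb : ∀ᶠ l in (𝒰 : Filter ℕ), ∫ x in unitInt, h l x ^ 2 ≤ B)
    (hw : MemLp w 2 (volume.restrict unitInt))
    (hd : Tendsto (fun l => ∫ x in unitInt, ‖f l x - w x‖ ^ 2) 𝒰 (𝓝 0))
    (hr : Tendsto (fun l => ∫ x in unitInt, (1 - ‖f l x‖ ^ 2) ^ 2) 𝒰 (𝓝 0))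
    (her : Tendsto (fun l => e l * √(∫ x in unitInt, (1 - ‖f l x‖ ^ 2) ^ 2)) 𝒰 (𝓝 0))
    (hn : Tendsto (fun l => e l - n l) 𝒰 (𝓝 A)) (hH : MemLp H 2 (volume.restrict unitInt))
    (hlim : ∀ ψ, MemLp ψ 2 (volume.restrict unitInt) →
      Tendsto (fun l => ∫ x in unitInt, h l x * ψ x) 𝒰 (𝓝 (∫ x in unitInt, H x * ψ x)))
    {φ : ℝ → ℝ} (hφ : ContDiff ℝ 1 φ)
    (hφv : ∀ x ∈ Icc (0 : ℝ) 1, x ∈ tsupport φ → ¬ Vanishes 𝒰 f x) :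
    φ 1 • z - φ 0 • (1 : ℂ) = ∫ x in unitInt, (deriv φ x • w x
      + φ x • (Complex.I * ((H x + 2 * Real.pi * A : ℝ) : ℂ) * w x)) := by
  have hφ' : Continuous (deriv φ) := hφ.continuous_deriv le_rfl
  set D : ℝ → ℂ := fun x => deriv φ x • w x + φ x • (Complex.I * ((2 * Real.pi * A : ℝ) : ℂ) * w x)
    with hD
  set ψ : ℝ → ℂ := fun x => φ x • (Complex.I * w x) with hψdef
  have hψ : MemLp ψ 2 (volume.restrict unitInt) :=
    MemLp.smul_of_bound hφ.continuous (hw.const_mul Complex.I)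
  have hDi : IntegrableOn D unitInt := by
    have h1 : MemLp D 2 (volume.restrict unitInt) := (MemLp.smul_of_bound hφ' hw).add
      (MemLp.smul_of_bound hφ.continuous (hw.const_mul (Complex.I * ((2 * Real.pi * A : ℝ) : ℂ))))
    exact h1.integrable (by norm_num)
  have form : ∀ k : ℝ → ℝ, (fun x => deriv φ x • w x
      + φ x • (Complex.I * ((k x + 2 * Real.pi * A : ℝ) : ℂ) * w x))
      = fun x => (k x : ℂ) * ψ x + D x := by
    intro k; ext x
    simp only [hψdef, hD, Complex.real_smul]; push_cast; ring
  have intform : ∀ k : ℝ → ℝ, MemLp k 2 (volume.restrict unitInt) →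
      Integrable (fun x => (k x : ℂ) * ψ x) (volume.restrict unitInt) := fun k hk =>
    hk.ofReal.integrable_mul hψ
  have lim1 : Tendsto (fun l => ∫ x in unitInt, (deriv φ x • w x
      + φ x • (Complex.I * ((h l x + 2 * Real.pi * A : ℝ) : ℂ) * w x))) 𝒰
      (𝓝 (∫ x in unitInt, (deriv φ x • w x
      + φ x • (Complex.I * ((H x + 2 * Real.pi * A : ℝ) : ℂ) * w x)))) := by
    rw [form H, integral_add (intform H hH) hDi]
    refine Tendsto.congr' (f₁ := fun l => (∫ x in unitInt, (h l x : ℂ) * ψ x) + ∫ x in unitInt, D x)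
      ?_ ((tendsto_integral_mul_complex hm hH hlim hψ).add_const _)
    filter_upwards [hm] with l hl
    rw [form (h l), integral_add (intform _ hl) hDi]
  -- The integrals with `h l` converge to the right-hand side by weak convergence. It remains to see
  -- that they also converge to the boundary terms, to which the exact phase integrals are equal.
  refine tendsto_nhds_unique ?_ lim1
  -- The support of `φ` within `[0, 1]` is compact and free of vanishing points, so one `δ` serves
  -- along the ultrafilter.
  obtain ⟨δ, hδ, hK⟩ := exists_modulus_bound (𝒰 := 𝒰) (f := f) (K := Icc 0 1 ∩ tsupport φ)
    (isCompact_Icc.inter_right (isClosed_tsupport φ)) inter_subset_left (fun x hx => hφv x hx.1 hx.2)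
  obtain ⟨C1, hC1⟩ := isCompact_Icc.exists_bound_of_continuousOn (s := Icc (0 : ℝ) 1)
    hφ.continuous.continuousOn
  obtain ⟨C2, hC2⟩ := isCompact_Icc.exists_bound_of_continuousOn (s := Icc (0 : ℝ) 1)
    hφ'.continuousOn
  set C := max C1 C2
  have hd' : ∀ᶠ l in (𝒰 : Filter ℕ),
      MemLp (fun x => |1 - ‖f l x‖ ^ 2| + ‖f l x - w x‖) 2 (volume.restrict unitInt) := by
    filter_upwards [hfg] with l hl
    exact (hl.memLp_one_sub_sq 2).abs.add ((hl.memLp 2).sub hw).norm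
  have hk' : ∀ᶠ l in (𝒰 : Filter ℕ),
      MemLp (fun x => 1 - ‖f l x‖ ^ 2) 2 (volume.restrict unitInt) := by
    filter_upwards [hfg] with l hl
    exact hl.memLp_one_sub_sq 2
  have hd0 : Tendsto (fun l => ∫ x in unitInt, (|1 - ‖f l x‖ ^ 2| + ‖f l x - w x‖) ^ 2) 𝒰 (𝓝 0) := by
    have l2 := (hr.const_mul 2).add (hd.const_mul 2)
    simp only [mul_zero, add_zero] at l2
    refine squeeze_zero' (.of_forall fun l => integral_nonneg fun x => sq_nonneg _) ?_ l2
    filter_upwards [hfg, hd'] with l hl hdl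
    have i1 := (hl.memLp_one_sub_sq 2).integrable_sq
    have i2 : Integrable (fun x => ‖f l x - w x‖ ^ 2) (volume.restrict unitInt) :=
      ((hl.memLp 2).sub hw).norm.integrable_sq
    rw [← integral_const_mul, ← integral_const_mul, ← integral_add (i1.const_mul 2) (i2.const_mul 2)]
    refine integral_mono hdl.integrable_sq ((i1.const_mul 2).add (i2.const_mul 2)) fun x => ?_
    have := sq_nonneg (|1 - ‖f l x‖ ^ 2| - ‖f l x - w x‖)
    have h3 := sq_abs (1 - ‖f l x‖ ^ 2)
    dsimp only
    nlinarith
  have hs : Tendsto (fun l => e l - n l - A) 𝒰 (𝓝 0) := by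
    simpa using hn.sub_const A
  obtain ⟨ei, et⟩ := tendsto_phase_error he hd' hk' hm hb hd0 her hs
  rw [tendsto_iff_norm_sub_tendsto_zero]
  have et2 := et.const_mul (C * ((1 + 2 * Real.pi) * (1 + δ⁻¹ ^ 2)))
  rw [mul_zero] at et2
  refine squeeze_zero' (.of_forall fun l => norm_nonneg _) ?_ et2
  filter_upwards [hfg, f0, f1, hm, ei, hK] with l hl f0 f1 hm ei hK
  have hsupp : ∀ x ∈ Icc (0 : ℝ) 1, x ∈ tsupport φ → δ ≤ ‖f l x‖ := fun x hx hx2 => hK x ⟨hx, hx2⟩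
  obtain ⟨ip, ep⟩ := integral_phase hl hδ hφ hsupp (by simp [f0]) (by simp [f1, hz])
  rw [f0, f1] at ep
  have iB : IntegrableOn (fun x => deriv φ x • w x
      + φ x • (Complex.I * ((h l x + 2 * Real.pi * A : ℝ) : ℂ) * w x)) unitInt := by
    rw [form]; exact (intform _ hm).add hDi
  rw [norm_sub_rev, ← ep, ← integral_sub ip iB, ← integral_const_mul]
  refine (norm_integral_le_integral_norm _).trans
    (integral_mono_ae (ip.sub iB).norm (ei.const_mul _) ?_)
  filter_upwards [ae_restrict_mem measurableSet_unitInt] with x hx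
  have hx' : x ∈ Icc (0 : ℝ) 1 := Ioo_subset_Icc_self hx
  by_cases hxs : x ∈ tsupport φ
  · have := norm_phase_sub_le (w := w x) (h := h l x) (n := n l) hδ (hsupp x hx' hxs) hA (he l)
      ((hC2 x hx').trans (le_max_right C1 C2)) ((hC1 x hx').trans (le_max_left C1 C2)) (hh l x)
    rw [abs_of_nonneg (by positivity : 0 ≤ |1 - ‖f l x‖ ^ 2| + ‖f l x - w x‖)]
    exact this
  · have h0 : φ x = 0 := image_eq_zero_of_notMem_tsupport hxs
    have h1 : deriv φ x = 0 := by
      by_contra h; exact hxs (mem_tsupport_of_deriv_ne_zero h)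
    have : 0 ≤ C := (norm_nonneg _).trans ((hC1 x hx').trans (le_max_left C1 C2))
    have := he l
    simp only [h0, h1, zero_smul, add_zero, sub_zero, norm_zero]
    positivity

/-! ### Existence and minimality of the jump set -/

theorem restrict_unitInt_diff {S : Set ℝ} (hS : S.Finite) :
    volume.restrict (unitInt \ S) = volume.restrict unitInt :=
  Measure.restrict_congr_set (sdiff_null_ae_eq_self (hS.measure_zero _))

theorem isOpen_unitInt_diff {S : Set ℝ} (hS : S.Finite) : IsOpen (unitInt \ S) :=
  isOpen_unitInt.sdiff hS.isClosed

theorem IsWeakDeriv.mono {U U' : Set ℝ} (hU : IsOpen U) (hUU' : U' ⊆ U)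
    {u v : ℝ → ℂ} (h : IsWeakDeriv U u v) : IsWeakDeriv U' u v := by
  intro φ h1 h2 h3
  have := h φ h1 h2 (h3.trans hUU')
  rw [← setIntegral_eq_of_subset_of_forall_sdiff_eq_zero hU.measurableSet hUU',
    ← setIntegral_eq_of_subset_of_forall_sdiff_eq_zero hU.measurableSet hUU', this]
  · intro x hx
    rw [image_eq_zero_of_notMem_tsupport fun h => hx.2 (h3 h), zero_smul]
  · intro x hx
    rw [image_eq_zero_of_notMem_tsupport fun h => hx.2 (h3 (tsupport_deriv_subset h)), zero_smul]

/-- A function that is `H¹` with values in the circle off a finite set has a jump set. -/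
theorem exists_isJumpSet (α : ℝ) {w : ℝ → ℂ} {V : Finset ℝ}
    (h : MemH1Circle (unitInt \ (V : Set ℝ)) w) : ∃ J, IsJumpSet α w J := by
  classical
  set V0 := V.filter (· ∈ unitInt) with hV0
  have h0 : MemH1Circle (unitInt \ (V0 : Set ℝ)) w := by
    have : unitInt \ (V0 : Set ℝ) = unitInt \ (V : Set ℝ) := by
      ext x; simp only [Set.mem_sdiff, hV0, Finset.coe_filter, mem_ofPred_eq]; tauto
    rwa [this]
  -- A regularity-preserving subset of least cardinality admits no removal of a point. The endpoints
  -- play no role for regularity on the open interval and are added afterwards according to the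
  -- traces.
  obtain ⟨K, hK, hmin⟩ := Finset.exists_min_image
    (V0.powerset.filter fun K : Finset ℝ => MemH1Circle (unitInt \ (K : Set ℝ)) w) Finset.card
    ⟨V0, by simp [h0]⟩
  rw [Finset.mem_filter, Finset.mem_powerset] at hK
  set J := K ∪ (({0} : Finset ℝ).filter fun _ => ¬ HasTraceZero w 1) ∪
    (({1} : Finset ℝ).filter fun _ => ¬ HasTraceOne w (Complex.exp (Complex.I * α))) with hJ
  have hKu : ∀ x ∈ K, x ∈ unitInt := fun x hx => (Finset.mem_filter.1 (hK.1 hx)).2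
  have h0K : (0 : ℝ) ∉ K := fun h => by simpa [unitInt] using hKu _ h
  have h1K : (1 : ℝ) ∉ K := fun h => by simpa [unitInt] using hKu _ h
  have hJK : ∀ x ∈ unitInt, x ∈ J ↔ x ∈ K := by
    intro x hx
    have hx0 : x ≠ 0 := hx.1.ne'
    have hx1 : x ≠ 1 := hx.2.ne
    simp only [hJ, Finset.mem_union, Finset.mem_filter, Finset.mem_singleton]; simp [hx0, hx1]
  refine ⟨J, ⟨?_, ?_, ?_, ?_, ?_⟩⟩
  · intro x hx
    simp only [hJ, Finset.coe_union, mem_union, Finset.mem_coe, Finset.mem_filter,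
      Finset.mem_singleton] at hx
    rcases hx with (hx | ⟨rfl, -⟩) | ⟨rfl, -⟩
    · exact Ioo_subset_Icc_self (hKu x hx)
    · simp
    · simp
  · have : unitInt \ (J : Set ℝ) = unitInt \ (K : Set ℝ) := by
      ext x; simp only [Set.mem_sdiff, Finset.mem_coe]
      exact and_congr_right fun hx => not_congr (hJK x hx)
    rw [this]; exact hK.2
  · intro x hxJ hx hcon
    have hxK := (hJK x hx).1 hxJ
    have e : unitInt \ ((J : Set ℝ) \ {x}) = unitInt \ ((K.erase x : Finset ℝ) : Set ℝ) := by
      ext y; simp only [Set.mem_sdiff, Finset.mem_coe, Finset.mem_erase, mem_singleton_iff]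
      refine and_congr_right fun hy => not_congr ?_
      rw [hJK y hy, and_comm]
    rw [e] at hcon
    have := hmin (K.erase x) (by
      simp only [Finset.mem_filter, Finset.mem_powerset]
      exact ⟨(Finset.erase_subset _ _).trans hK.1, hcon⟩)
    exact absurd this (not_le.2 (Finset.card_erase_lt_of_mem hxK))
  · simp only [hJ, Finset.mem_union, Finset.mem_filter, Finset.mem_singleton]; simp [h0K]
  · simp only [hJ, Finset.mem_union, Finset.mem_filter, Finset.mem_singleton]; simp [h1K]

/-- The jump set is contained in every finite set off which `w` is regular. -/
theorem IsJumpSet.subset_of_regular {α : ℝ} {w : ℝ → ℂ} {J V : Finset ℝ} (hJ : IsJumpSet α w J)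
    (h : MemH1Circle (unitInt \ (V : Set ℝ)) w) (h0 : (0 : ℝ) ∉ V → HasTraceZero w 1)
    (h1 : (1 : ℝ) ∉ V → HasTraceOne w (Complex.exp (Complex.I * α))) : J ⊆ V := by
  intro x hxJ
  by_contra hxV
  have hx01 := hJ.subset hxJ
  rcases eq_or_ne x 0 with rfl | hx0
  · exact hJ.zero_mem_iff.1 hxJ (h0 hxV)
  rcases eq_or_ne x 1 with rfl | hx1
  · exact hJ.one_mem_iff.1 hxJ (h1 hxV)
  have hx : x ∈ unitInt := ⟨lt_of_le_of_ne hx01.1 hx0.symm, lt_of_le_of_ne hx01.2 hx1⟩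
  refine hJ.minimal x hxJ hx ?_
  have fJ := J.finite_toSet
  have fV := V.finite_toSet
  have fJx : ((J : Set ℝ) \ {x}).Finite := fJ.sdiff
  obtain ⟨⟨hw, v, hv⟩, hc⟩ := h
  obtain ⟨⟨-, v', hv'⟩, -⟩ := hJ.memH1
  -- Regularity off `J` and off `V` glues to regularity off `J ∩ V`, which misses `x`; this
  -- contradicts the minimality of `J` at `x`.
  have eU : (unitInt \ (J : Set ℝ)) ∪ (unitInt \ (V : Set ℝ)) = unitInt \ ((J : Set ℝ) ∩ V) := by
    rw [sdiff_inter]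
  have fJV : ((J : Set ℝ) ∩ V).Finite := fJ.inter_of_left _
  have rV := restrict_unitInt_diff fV
  have rJ := restrict_unitInt_diff fJ
  rw [rV] at hw hc
  have hvm := hv.1
  have hvm' := hv'.1
  rw [rV] at hvm
  rw [rJ] at hvm'
  have fin : volume unitInt ≠ ⊤ := by simp [volume_unitInt]
  have iv := integrableOn_of_memLp_two fin hvm
  have iv' := integrableOn_of_memLp_two fin hvm'
  have iw := integrableOn_of_memLp_two fin hw
  have sub1 : unitInt \ ((J : Set ℝ) ∪ V) ⊆ unitInt \ (J : Set ℝ) :=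
    sdiff_subset_sdiff_right subset_union_left
  have sub2 : unitInt \ ((J : Set ℝ) ∪ V) ⊆ unitInt \ (V : Set ℝ) :=
    sdiff_subset_sdiff_right subset_union_right
  -- The two weak derivatives agree off the finite set `J ∪ V`, hence almost everywhere, so a single
  -- function serves on both sets.
  have veq : v =ᵐ[volume.restrict (unitInt \ ((J : Set ℝ) ∪ V))] v' :=
    IsWeakDeriv.unique (isOpen_unitInt_diff (fJ.union fV)) (iv.mono_set sdiff_subset)
      (iv'.mono_set sdiff_subset) (hv.2.mono (isOpen_unitInt_diff fV) sub2)
      (hv'.2.mono (isOpen_unitInt_diff fJ) sub1)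
  rw [restrict_unitInt_diff (fJ.union fV)] at veq
  have hvJ : IsWeakDeriv (unitInt \ (J : Set ℝ)) w v :=
    hv'.2.congr .rfl (by rw [rJ]; exact veq.symm)
  have hun : IsWeakDeriv (unitInt \ ((J : Set ℝ) ∩ V)) w v := by
    rw [← eU]
    refine IsWeakDeriv.union (isOpen_unitInt_diff fJ) (isOpen_unitInt_diff fV) ?_ ?_ hvJ hv.2
    · exact iw.mono_set (union_subset sdiff_subset sdiff_subset)
    · exact iv.mono_set (union_subset sdiff_subset sdiff_subset)
  have hsub : unitInt \ ((J : Set ℝ) \ {x}) ⊆ unitInt \ ((J : Set ℝ) ∩ V) := by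
    intro y hy
    refine ⟨hy.1, fun hy2 => hy.2 ⟨hy2.1, ?_⟩⟩
    rintro rfl
    exact hxV hy2.2
  have rx := restrict_unitInt_diff fJx
  refine ⟨⟨by rwa [rx], v, by rwa [rx], hun.mono (isOpen_unitInt_diff fJV) hsub⟩, by rwa [rx]⟩

/-! ### Weak derivatives with boundary values -/

/-- `v` is the weak derivative of `w` off `V`, with boundary values `1` and `z` at those endpoints
of `(0, 1)` that do not lie in `V`. -/
def IsWeakDerivBdry (V : Finset ℝ) (w v : ℝ → ℂ) (z : ℂ) : Prop :=
  ∀ φ : ℝ → ℝ, ContDiff ℝ ∞ φ → (∀ x ∈ Icc (0 : ℝ) 1, x ∈ tsupport φ → x ∉ V) →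
    φ 1 • z - φ 0 • (1 : ℂ) = ∫ x in unitInt, (deriv φ x • w x + φ x • v x)

theorem contDiff_one_of_infty {φ : ℝ → ℝ} (h : ContDiff ℝ ∞ φ) : ContDiff ℝ 1 φ :=
  h.of_le (by exact_mod_cast le_top)

theorem integrableOn_smul_of_continuous {φ : ℝ → ℝ} (hφ : Continuous φ) {u : ℝ → ℂ}
    (hu : IntegrableOn u unitInt) : IntegrableOn (fun x => φ x • u x) unitInt := by
  have := MemLp.smul_of_bound hφ (memLp_one_iff_integrable.2 hu)
  exact memLp_one_iff_integrable.1 this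

namespace IsWeakDerivBdry

variable {V : Finset ℝ} {w v : ℝ → ℂ} {z : ℂ}

theorem isWeakDeriv (h : IsWeakDerivBdry V w v z) (hw : IntegrableOn w unitInt)
    (hv : IntegrableOn v unitInt) : IsWeakDeriv (unitInt \ (V : Set ℝ)) w v := by
  intro φ h1 h2 h3
  rw [restrict_unitInt_diff V.finite_toSet]
  have h4 := h φ h1 fun x _ hx => (h3 hx).2
  have z0 : φ 0 = 0 := image_eq_zero_of_notMem_tsupport fun h => by simpa [unitInt] using (h3 h).1
  have z1 : φ 1 = 0 := image_eq_zero_of_notMem_tsupport fun h => by simpa [unitInt] using (h3 h).1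
  rw [integral_add (integrableOn_smul_of_continuous
    ((contDiff_one_of_infty h1).continuous_deriv le_rfl) hw)
    (integrableOn_smul_of_continuous h1.continuous hv), z0, z1] at h4
  simp only [zero_smul, sub_zero] at h4
  exact eq_neg_of_add_eq_zero_left h4.symm

/-- Integration by parts against the representative `W` on `(s, t)`, for a test function that does
not see the rest of the unit interval. It evaluates the boundary formula near one endpoint. -/
theorem setIntegral_eq {s t : ℝ} (hs : 0 ≤ s) (hst : s < t) (ht : t ≤ 1)
    {c : ℂ} {W : ℝ → ℂ} (hv : IntegrableOn v unitInt)
    (hW : W = fun x => c + ∫ y in s..x, v y) (hc : w =ᵐ[volume.restrict (Ioo s t)] W)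
    {φ : ℝ → ℝ} (h1 : ContDiff ℝ ∞ φ)
    (h2 : ∀ x ∈ unitInt, x ∉ Ioo s t → φ x = 0 ∧ deriv φ x = 0) :
    ∫ x in unitInt, (deriv φ x • w x + φ x • v x) = φ t • W t - φ s • W s := by
  have hsub : Ioo s t ⊆ unitInt := Ioo_subset_Ioo hs ht
  rw [setIntegral_eq_of_subset_of_forall_sdiff_eq_zero measurableSet_unitInt hsub (by
    intro x hx
    obtain ⟨a, b⟩ := h2 x hx.1 hx.2
    rw [a, b, zero_smul, zero_smul, add_zero])]
  have hvi : IntervalIntegrable v volume s t :=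
    (intervalIntegrable_iff_integrableOn_Ioo_of_le hst.le).2 (hv.mono_set hsub)
  have hP := IsACPrim.of_integral hvi c
  rw [← hW] at hP
  have e := (IsACPrim.of_contDiff (a := s) (b := t) (contDiff_one_of_infty h1)).smul hP
  have e2 := e.integral_eq hst.le
  rw [← e2, ← setIntegral_Ioo_eq_intervalIntegral hst.le]
  exact integral_congr_ae (hc.mono fun x hx => by simp only [hx])

/-- Near 0 the function is a primitive `W` of `v`. A test function with `φ 0 = 1`, supported near 0,
turns the boundary formula into `W 0 = 1`. -/
theorem hasTraceZero (h : IsWeakDerivBdry V w v z) (hw : IntegrableOn w unitInt)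
    (hv : IntegrableOn v unitInt) (h0 : (0 : ℝ) ∉ V) : HasTraceZero w 1 := by
  have hev : ∀ᶠ x in 𝓝 (0 : ℝ), x ∉ (V : Set ℝ) := V.finite_toSet.isClosed.isOpen_compl.mem_nhds h0
  obtain ⟨r', hr', hball⟩ := Metric.eventually_nhds_iff.1 hev
  set r := min r' 1 with hr
  have hr0 : 0 < r := lt_min hr' one_pos
  have hr1 : r ≤ 1 := min_le_right _ _
  have hV : ∀ x ∈ Ioo (-r) r, x ∉ V := fun x hx => hball (by
    rw [Real.dist_eq, sub_zero]; exact (abs_lt.2 hx).trans_le (min_le_left _ _))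
  have hsub : Ioo 0 r ⊆ unitInt := Ioo_subset_Ioo_right hr1
  have hwd : IsWeakDeriv (Ioo 0 r) w v :=
    (h.isWeakDeriv hw hv).mono (isOpen_unitInt_diff V.finite_toSet) fun x hx =>
      ⟨hsub hx, hV x ⟨by linarith [hx.1], hx.2⟩⟩
  obtain ⟨c, hc⟩ := hwd.ae_eq_primitive hr0 (hw.mono_set hsub) (hv.mono_set hsub)
  set W : ℝ → ℂ := fun x => c + ∫ y in (0 : ℝ)..x, v y with hW
  have hvi : IntervalIntegrable v volume 0 r :=
    (intervalIntegrable_iff_integrableOn_Ioo_of_le hr0.le).2 (hv.mono_set hsub)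
  obtain ⟨φ, φs, -, φd, -, φ1⟩ := exists_contDiff_tsupport_subset (n := ⊤)
    (isOpen_Ioo.mem_nhds (⟨by linarith, hr0⟩ : (0 : ℝ) ∈ Ioo (-r) r))
  have φd : ContDiff ℝ ∞ φ := φd
  have φr : ∀ x, r ≤ x → φ x = 0 ∧ deriv φ x = 0 := by
    intro x hx
    have : x ∉ tsupport φ := fun h => absurd (φs h).2 (not_lt.2 hx)
    refine ⟨image_eq_zero_of_notMem_tsupport this, ?_⟩
    by_contra h; exact this (mem_tsupport_of_deriv_ne_zero h)
  have e1 := h φ φd fun x _ hx => hV x (φs hx)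
  rw [setIntegral_eq le_rfl hr0 hr1 hv hW hc φd
    (fun x hx hx2 => φr x (not_lt.1 fun h => hx2 ⟨hx.1, h⟩)), (φr 1 hr1).1, (φr r le_rfl).1, φ1] at e1
  have hc1 : c = 1 := by simpa [hW] using e1.symm
  refine ⟨fun x => if x < r then W x else w x, ?_, ?_⟩
  · have h3 : ∀ᵐ x ∂volume.restrict unitInt, x ∈ Ioo 0 r → w x = W x := by
      rw [EventuallyEq, ae_restrict_iff' measurableSet_Ioo] at hc
      exact ae_restrict_of_ae hc
    filter_upwards [h3, ae_restrict_mem measurableSet_unitInt] with x hx hx2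
    by_cases hxr : x < r
    · simp only [hxr, if_true]; exact (hx ⟨hx2.1, hxr⟩).symm
    · simp [hxr]
  · have hcont := (IsACPrim.of_integral hvi c).continuousOn hr0.le 0 (by simp [hr0.le])
    have := hcont.mono Ioo_subset_Icc_self
    rw [ContinuousWithinAt, nhdsWithin_Ioo_eq_nhdsGT hr0] at this
    simp only [intervalIntegral.integral_same, add_zero, hc1] at this
    refine this.congr' ?_
    filter_upwards [Ioo_mem_nhdsGT hr0] with x hx
    rw [if_pos hx.2, hW, hc1]

theorem hasTraceOne (h : IsWeakDerivBdry V w v z) (hw : IntegrableOn w unitInt)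
    (hv : IntegrableOn v unitInt) (h0 : (1 : ℝ) ∉ V) : HasTraceOne w z := by
  have hev : ∀ᶠ x in 𝓝 (1 : ℝ), x ∉ (V : Set ℝ) := V.finite_toSet.isClosed.isOpen_compl.mem_nhds h0
  obtain ⟨r', hr', hball⟩ := Metric.eventually_nhds_iff.1 hev
  set r := min r' 1 with hr
  have hr0 : 0 < r := lt_min hr' one_pos
  have hr1 : r ≤ 1 := min_le_right _ _
  have hV : ∀ x ∈ Ioo (1 - r) (1 + r), x ∉ V := fun x hx => hball (by
    rw [Real.dist_eq]
    exact (abs_lt.2 ⟨by linarith [hx.1], by linarith [hx.2]⟩).trans_le (min_le_left _ _))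
  have hsub : Ioo (1 - r) 1 ⊆ unitInt := Ioo_subset_Ioo_left (by linarith)
  have hwd : IsWeakDeriv (Ioo (1 - r) 1) w v :=
    (h.isWeakDeriv hw hv).mono (isOpen_unitInt_diff V.finite_toSet) fun x hx =>
      ⟨hsub hx, hV x ⟨hx.1, by linarith [hx.2]⟩⟩
  have hlt : 1 - r < 1 := by linarith
  obtain ⟨c, hc⟩ := hwd.ae_eq_primitive hlt (hw.mono_set hsub) (hv.mono_set hsub)
  set W : ℝ → ℂ := fun x => c + ∫ y in (1 - r)..x, v y with hW
  have hvi : IntervalIntegrable v volume (1 - r) 1 :=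
    (intervalIntegrable_iff_integrableOn_Ioo_of_le hlt.le).2 (hv.mono_set hsub)
  obtain ⟨φ, φs, -, φd, -, φ1⟩ := exists_contDiff_tsupport_subset (n := ⊤)
    (isOpen_Ioo.mem_nhds (⟨hlt, by linarith⟩ : (1 : ℝ) ∈ Ioo (1 - r) (1 + r)))
  have φd : ContDiff ℝ ∞ φ := φd
  have φr : ∀ x, x ≤ 1 - r → φ x = 0 ∧ deriv φ x = 0 := by
    intro x hx
    have : x ∉ tsupport φ := fun h => absurd (φs h).1 (not_lt.2 hx)
    refine ⟨image_eq_zero_of_notMem_tsupport this, ?_⟩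
    by_contra h; exact this (mem_tsupport_of_deriv_ne_zero h)
  have e1 := h φ φd fun x _ hx => hV x (φs hx)
  rw [setIntegral_eq (by linarith) hlt le_rfl hv hW hc φd
    (fun x hx hx2 => φr x (not_lt.1 fun h => hx2 ⟨h, hx.2⟩)), (φr 0 (by linarith)).1,
    (φr (1 - r) le_rfl).1, φ1] at e1
  have hc1 : W 1 = z := by simpa using e1.symm
  refine ⟨fun x => if 1 - r < x then W x else w x, ?_, ?_⟩
  · have h3 : ∀ᵐ x ∂volume.restrict unitInt, x ∈ Ioo (1 - r) 1 → w x = W x := by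
      rw [EventuallyEq, ae_restrict_iff' measurableSet_Ioo] at hc
      exact ae_restrict_of_ae hc
    filter_upwards [h3, ae_restrict_mem measurableSet_unitInt] with x hx hx2
    by_cases hxr : 1 - r < x
    · simp only [hxr, if_true]; exact (hx ⟨hxr, hx2.2⟩).symm
    · simp [hxr]
  · have hcont := (IsACPrim.of_integral hvi c).continuousOn hlt.le 1 (by simp [hr0.le])
    have := hcont.mono Ioo_subset_Icc_self
    rw [ContinuousWithinAt, nhdsWithin_Ioo_eq_nhdsLT hlt] at this
    change Tendsto W _ (𝓝 (W 1)) at this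
    rw [hc1] at this
    refine this.congr' ?_
    filter_upwards [Ioo_mem_nhdsLT hlt] with x hx
    rw [if_pos hx.1]

end IsWeakDerivBdry

/-! ### Twist and splitting of the energy -/

theorem twist_eq_im (z z' : ℂ) : twist z z' = (starRingEnd ℂ z * z').im := by
  simp [twist]; ring

theorem abs_twist_le (z z' : ℂ) : |twist z z'| ≤ ‖z‖ * ‖z'‖ := by
  rw [twist_eq_im]
  refine (Complex.abs_im_le_norm _).trans ?_
  rw [norm_mul, RCLike.norm_conj]

theorem twist_smul_I {w : ℂ} (hw : ‖w‖ = 1) (s : ℝ) : twist w (Complex.I * (s : ℂ) * w) = s := by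
  have h : w.re * w.re + w.im * w.im = 1 := by
    rw [← Complex.normSq_apply, Complex.normSq_eq_norm_sq, hw, one_pow]
  simp only [twist, Complex.mul_re, Complex.mul_im, Complex.I_re, Complex.I_im, Complex.ofReal_re,
    Complex.ofReal_im]
  linear_combination s * h

/-- The deviation of the twist of the modulated function from its preferred value. -/
noncomputable def twistDefect (β ε : ℝ) (f g : ℝ → ℂ) (x : ℝ) : ℝ :=
  twist (f x) (g x) + ‖f x‖ ^ 2 * (2 * Real.pi * (pitchFloor β ε : ℝ)) - 2 * Real.pi * ε ^ (-β)

theorem memLp_twist {f g : ℝ → ℂ} (h : IsACPrim 0 1 f g)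
    (hg : MemLp g 2 (volume.restrict unitInt)) :
    MemLp (fun x => twist (f x) (g x)) 2 (volume.restrict unitInt) := by
  obtain ⟨C, hC⟩ := isCompact_Icc.exists_bound_of_continuousOn (h.continuousOn zero_le_one)
  have hf := (h.memLp 2).1
  refine hg.of_le_mul (c := C) ?_ ?_
  · exact (hf.re.mul hg.1.im).sub (hf.im.mul hg.1.re)
  · filter_upwards [ae_restrict_mem measurableSet_unitInt] with x hx
    refine (abs_twist_le _ _).trans ?_
    gcongr
    exact hC x (Ioo_subset_Icc_self hx)

theorem memLp_twistDefect {f g : ℝ → ℂ} (h : IsACPrim 0 1 f g)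
    (hg : MemLp g 2 (volume.restrict unitInt)) (β ε : ℝ) :
    MemLp (twistDefect β ε f g) 2 (volume.restrict unitInt) := by
  set c := 2 * Real.pi * (pitchFloor β ε : ℝ)
  have e : twistDefect β ε f g = fun x => (twist (f x) (g x) - c * (1 - ‖f x‖ ^ 2))
      + (c - 2 * Real.pi * ε ^ (-β)) := by
    ext x; rw [twistDefect]; ring
  rw [e]
  exact ((memLp_twist h hg).sub ((h.memLp_one_sub_sq 2).const_mul c)).add (memLp_const _)

/-- The derivative of the modulated function `f e^{2πiNx}`. -/
noncomputable def modulatedDeriv (N : ℤ) (f g : ℝ → ℂ) (x : ℝ) : ℂ :=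
  g x * carrier N x + f x * deriv (carrier N) x

theorem modulatedDeriv_eq (N : ℤ) (f g : ℝ → ℂ) (x : ℝ) :
    modulatedDeriv N f g x = (g x + 2 * Real.pi * Complex.I * N * f x) * carrier N x := by
  rw [modulatedDeriv, (hasDerivAt_carrier N x).deriv]; ring

theorem IsACPrim.modulated {f g : ℝ → ℂ} (h : IsACPrim 0 1 f g) (N : ℤ) :
    IsACPrim 0 1 (fun x => f x * carrier N x) (modulatedDeriv N f g) :=
  h.mul (IsACPrim.of_contDiff ((contDiff_carrier N).of_le (by exact_mod_cast le_top)))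

theorem lintegral_ofReal_sq {X : Type*} [MeasurableSpace X] {μ : Measure X} {h : X → ℝ}
    (hm : MemLp h 2 μ) {c : ℝ} (hc : 0 ≤ c) :
    ∫⁻ x, ENNReal.ofReal (c * h x ^ 2) ∂μ = ENNReal.ofReal (c * ∫ x, h x ^ 2 ∂μ) := by
  rw [← integral_const_mul, ofReal_integral_eq_lintegral_ofReal (hm.integrable_sq.const_mul c)]
  exact .of_forall fun x => by positivity

/-- The carrier has modulus one, so the first two terms form the Modica–Mortola energy of the
modulated representative; the last is the twist defect. Uniqueness identifies the chosen weak
derivative of the product with the one given by the product rule. -/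
theorem lintegral_demodDensity {L α β ε : ℝ} (hL : 0 < L) (hε : 0 < ε) {w f : ℝ → ℂ}
    (hw : Admissible α w) (hf : IsACPrim 0 1 f (weakDeriv unitInt w))
    (hwf : w =ᵐ[volume.restrict unitInt] f)
    (hg : MemLp (weakDeriv unitInt w) 2 (volume.restrict unitInt)) :
    (∫⁻ x in unitInt, ENNReal.ofReal (wellDensity ε ‖f x * carrier (pitchFloor β ε) x‖
      ‖modulatedDeriv (pitchFloor β ε) f (weakDeriv unitInt w) x‖)) +
      ENNReal.ofReal (L / 2 * ∫ x in unitInt, twistDefect β ε f (weakDeriv unitInt w) x ^ 2)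
    = ∫⁻ x in unitInt, ENNReal.ofReal (demodDensity L β ε w x) := by
  obtain ⟨⟨hw2, v, hv⟩, -, -⟩ := hw
  have hmod : weakDeriv unitInt (modulate β ε w) =ᵐ[volume.restrict unitInt]
      modulatedDeriv (pitchFloor β ε) f (weakDeriv unitInt w) := by
    have h1 := weakDeriv_ae_eq isOpen_unitInt (by simp [volume_unitInt])
      ((weakDeriv_spec hv).mul_carrier hw2 (pitchFloor β ε))
    rw [modulate_eq]
    filter_upwards [h1, hwf] with x hx hx2
    rw [hx, modulatedDeriv_eq, hx2]
  have hm := memLp_twistDefect hf hg β ε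
  rw [← lintegral_ofReal_sq hm (by positivity),
    ← lintegral_add_right' _ ((hm.1.aemeasurable.pow_const 2).const_mul _).ennreal_ofReal]
  refine lintegral_congr_ae ?_
  filter_upwards [hmod, hwf] with x hx hx2
  rw [← ENNReal.ofReal_add (wellDensity_nonneg hε _ _) (by positivity), demodDensity, hx, hx2,
    wellDensity, norm_mul (f x), norm_carrier, mul_one, twistDefect]

theorem integral_one_sub_sq_le {ε M : ℝ} (hε : 0 < ε) (hM : 0 ≤ M) {f g : ℝ → ℂ} {d : ℝ → ℝ}
    (h : IsACPrim 0 1 f g)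
    (hw : ∫⁻ x in unitInt, ENNReal.ofReal (wellDensity ε ‖f x‖ (d x)) ≤ ENNReal.ofReal M) :
    ∫ x in unitInt, (1 - ‖f x‖ ^ 2) ^ 2 ≤ 4 * ε * M := by
  have h1 := lintegral_ofReal_sq (h.memLp_one_sub_sq 2) (c := 1 / (4 * ε)) (by positivity)
  have h2 : ∫⁻ x in unitInt, ENNReal.ofReal (1 / (4 * ε) * (1 - ‖f x‖ ^ 2) ^ 2) ≤
      ENNReal.ofReal M := by
    refine le_trans (lintegral_mono fun x => ENNReal.ofReal_le_ofReal ?_) hw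
    have : 0 ≤ ε / 2 * d x ^ 2 := by positivity
    rw [wellDensity, ← neg_sq (‖f x‖ ^ 2 - 1), neg_sub]
    linarith
  rw [h1, ENNReal.ofReal_le_ofReal_iff hM, one_div_mul_eq_div, div_le_iff₀ (by positivity)] at h2
  linarith

theorem norm_sq_eq_integral {X : Type*} [MeasurableSpace X] {μ : Measure X} (F : Lp ℂ 2 μ) :
    ‖F‖ ^ 2 = ∫ x, ‖F x‖ ^ 2 ∂μ := by
  rw [← real_inner_self_eq_norm_sq, L2.inner_def]
  simp only [real_inner_self_eq_norm_sq]

/-- Pointwise `(|w| - 1)² ≤ 2(1 - |f|²)² + 2|f - w|²`, and both integrals on the right tend to zero.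
-/
theorem norm_eq_one_of_tendsto {𝓕 : Filter ℕ} [NeBot 𝓕] {f g : ℕ → ℝ → ℂ} {w : ℝ → ℂ}
    (hfg : ∀ᶠ l in 𝓕, IsACPrim 0 1 (f l) (g l)) (hw : MemLp w 2 (volume.restrict unitInt))
    (hd : Tendsto (fun l => ∫ x in unitInt, ‖f l x - w x‖ ^ 2) 𝓕 (𝓝 0))
    (hr : Tendsto (fun l => ∫ x in unitInt, (1 - ‖f l x‖ ^ 2) ^ 2) 𝓕 (𝓝 0)) :
    ∀ᵐ x ∂(volume.restrict unitInt), ‖w x‖ = 1 := by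
  have h1 : MemLp (fun x => ‖w x‖ - 1) 2 (volume.restrict unitInt) := hw.norm.sub (memLp_const 1)
  have l2 := (hr.const_mul 2).add (hd.const_mul 2)
  simp only [mul_zero, add_zero] at l2
  have h2 : ∫ x in unitInt, (‖w x‖ - 1) ^ 2 ≤ 0 := by
    refine ge_of_tendsto l2 ?_
    filter_upwards [hfg] with l hl
    have i1 := (hl.memLp_one_sub_sq 2).integrable_sq
    have i2 : Integrable (fun x => ‖f l x - w x‖ ^ 2) (volume.restrict unitInt) :=
      ((hl.memLp 2).sub hw).norm.integrable_sq
    rw [← integral_const_mul, ← integral_const_mul, ← integral_add (i1.const_mul 2) (i2.const_mul 2)]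
    refine integral_mono h1.integrable_sq ((i1.const_mul 2).add (i2.const_mul 2)) fun x => ?_
    dsimp only
    have a1 : |1 - ‖f l x‖| ≤ |1 - ‖f l x‖ ^ 2| := by
      have : 1 - ‖f l x‖ ^ 2 = (1 - ‖f l x‖) * (1 + ‖f l x‖) := by ring
      rw [this, abs_mul, abs_of_nonneg (by positivity : 0 ≤ 1 + ‖f l x‖)]
      nlinarith [abs_nonneg (1 - ‖f l x‖), norm_nonneg (f l x)]
    have a2 : |‖f l x‖ - ‖w x‖| ≤ ‖f l x - w x‖ := abs_norm_sub_norm_le _ _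
    have a3 := sq_le_sq.2 a1
    have a4 : (‖f l x‖ - ‖w x‖) ^ 2 ≤ ‖f l x - w x‖ ^ 2 := by
      rw [← sq_abs (‖f l x‖ - ‖w x‖)]; gcongr
    nlinarith [sq_nonneg ((1 - ‖f l x‖) - (‖f l x‖ - ‖w x‖))]
  have h3 : ∫ x in unitInt, (‖w x‖ - 1) ^ 2 = 0 :=
    le_antisymm h2 (integral_nonneg fun x => sq_nonneg _)
  rw [integral_eq_zero_iff_of_nonneg (fun x => sq_nonneg _) h1.integrable_sq] at h3
  filter_upwards [h3] with x hx
  have : ‖w x‖ - 1 = 0 := by simpa using hx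
  linarith

/-! ### The liminf inequality -/

/-- The lower bound along an ultrafilter. -/
theorem limitEnergy_le_of_eventually {L α β A : ℝ} (hL : 0 < L) (hβ : β < 1 / 2)
    (hA : A ∈ Icc (0 : ℝ) 1) {ε : ℕ → ℝ} (hεpos : ∀ l, 0 < ε l) {𝒰 : Ultrafilter ℕ}
    (hε : Tendsto ε 𝒰 (𝓝 0))
    (hlim : Tendsto (fun l => (ε l) ^ (-β) - (⌊(ε l) ^ (-β)⌋ : ℝ)) 𝒰 (𝓝 A))
    {u : ℕ → L2Space} {w : L2Space} (hu : Tendsto u 𝒰 (𝓝 w)) {M : ℝ} (hM : 0 ≤ M)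
    (hE : ∀ᶠ l in (𝒰 : Filter ℕ), demodEnergy L α β (ε l) (u l) ≤ ENNReal.ofReal M) :
    limitEnergy L α A w ≤ ENNReal.ofReal M := by
  have hadm : ∀ᶠ l in (𝒰 : Filter ℕ), Admissible α (u l) := by
    filter_upwards [hE] with l hl
    by_contra h
    rw [demodEnergy, if_neg h] at hl
    simp at hl
  have hrep : ∀ l, ∃ f : ℝ → ℂ, Admissible α (u l) → IsACPrim 0 1 f (weakDeriv unitInt (u l)) ∧
      (u l) =ᵐ[volume.restrict unitInt] f ∧ f 0 = 1 ∧ f 1 = Complex.exp (Complex.I * α) ∧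
      MemLp (weakDeriv unitInt (u l)) 2 (volume.restrict unitInt) := fun l => by
    by_cases h : Admissible α (u l)
    · obtain ⟨f, hf⟩ := h.exists_rep; exact ⟨f, fun _ => hf⟩
    · exact ⟨0, fun h' => absurd h' h⟩
  choose f hf using hrep
  set g : ℕ → ℝ → ℂ := fun l => weakDeriv unitInt (u l) with hgdef
  set z : ℂ := Complex.exp (Complex.I * α) with hz
  have hz1 : ‖z‖ = 1 := by rw [hz, mul_comm]; exact Complex.norm_exp_ofReal_mul_I α
  have hfg : ∀ᶠ l in (𝒰 : Filter ℕ), IsACPrim 0 1 (f l) (g l) := hadm.mono fun l h => (hf l h).1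
  have f0 : ∀ᶠ l in (𝒰 : Filter ℕ), f l 0 = 1 := hadm.mono fun l h => (hf l h).2.2.1
  have f1 : ∀ᶠ l in (𝒰 : Filter ℕ), f l 1 = z := hadm.mono fun l h => (hf l h).2.2.2.1
  set N : ℕ → ℤ := fun l => pitchFloor β (ε l) with hN
  set U : ℕ → ℝ → ℂ := fun l x => f l x * carrier (N l) x with hU
  set U' : ℕ → ℝ → ℂ := fun l => modulatedDeriv (N l) (f l) (g l) with hU'
  have hnorm : ∀ l x, ‖U l x‖ = ‖f l x‖ := fun l x => by rw [hU, norm_mul, norm_carrier, mul_one]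
  have hUU : ∀ᶠ l in (𝒰 : Filter ℕ), IsACPrim 0 1 (U l) (U' l) := hfg.mono fun l h => h.modulated _
  have hU0 : ∀ᶠ l in (𝒰 : Filter ℕ), ‖U l 0‖ = 1 := f0.mono fun l h => by simp [hnorm, h]
  have hU1 : ∀ᶠ l in (𝒰 : Filter ℕ), ‖U l 1‖ = 1 := f1.mono fun l h => by simp [hnorm, h, hz1]
  set h : ℕ → ℝ → ℝ := fun l => twistDefect β (ε l) (f l) (g l) with hh
  have hm : ∀ᶠ l in (𝒰 : Filter ℕ), MemLp (h l) 2 (volume.restrict unitInt) :=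
    hadm.mono fun l hl => memLp_twistDefect (hf l hl).1 (hf l hl).2.2.2.2 _ _
  have split : ∀ᶠ l in (𝒰 : Filter ℕ),
      (∫⁻ x in unitInt, ENNReal.ofReal (wellDensity (ε l) ‖U l x‖ ‖U' l x‖)) +
      ENNReal.ofReal (L / 2 * ∫ x in unitInt, h l x ^ 2) ≤ ENNReal.ofReal M := by
    filter_upwards [hadm, hE] with l hl hEl
    rw [demodEnergy, if_pos hl] at hEl
    refine le_of_eq_of_le ?_ hEl
    exact lintegral_demodDensity hL (hεpos l) hl (hf l hl).1 (hf l hl).2.1 (hf l hl).2.2.2.2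
  have hMM : ∀ᶠ l in (𝒰 : Filter ℕ),
      ∫⁻ x in unitInt, ENNReal.ofReal (wellDensity (ε l) ‖U l x‖ ‖U' l x‖) ≤ ENNReal.ofReal M :=
    split.mono fun l hl => le_self_add.trans hl
  have hr4 : ∀ᶠ l in (𝒰 : Filter ℕ), ∫ x in unitInt, (1 - ‖f l x‖ ^ 2) ^ 2 ≤ 4 * ε l * M := by
    filter_upwards [hfg, hMM] with l h1 h2
    simp only [hnorm] at h2
    exact integral_one_sub_sq_le (hεpos l) hM h1 h2
  have hr : Tendsto (fun l => ∫ x in unitInt, (1 - ‖f l x‖ ^ 2) ^ 2) 𝒰 (𝓝 0) := by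
    have : Tendsto (fun l => 4 * ε l * M) 𝒰 (𝓝 0) := by
      simpa using (hε.const_mul 4).mul_const M
    exact squeeze_zero' (.of_forall fun l => integral_nonneg fun x => sq_nonneg _) hr4 this
  -- Here `β < 1/2` enters: the potential energy gives the bound `√(4M) ε^{1/2 - β}`.
  have her : Tendsto (fun l => (ε l) ^ (-β) * √(∫ x in unitInt, (1 - ‖f l x‖ ^ 2) ^ 2)) 𝒰 (𝓝 0) := by
    have h1 : Tendsto (fun l => √(4 * M) * (ε l) ^ (1 / 2 - β)) 𝒰 (𝓝 0) := by
      have := (hε.rpow_const (p := 1 / 2 - β) (Or.inr (by linarith))).const_mul (√(4 * M))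
      rwa [Real.zero_rpow (by linarith), mul_zero] at this
    refine squeeze_zero' (.of_forall fun l => ?_) ?_ h1
    · have := (hεpos l).le; positivity
    filter_upwards [hr4] with l hl
    have h0 := hεpos l
    calc (ε l) ^ (-β) * √(∫ x in unitInt, (1 - ‖f l x‖ ^ 2) ^ 2)
        ≤ (ε l) ^ (-β) * √(4 * M * ε l) := by gcongr; linarith
      _ = √(4 * M) * (ε l) ^ (1 / 2 - β) := by
        rw [Real.sqrt_mul (by positivity), Real.sqrt_eq_rpow (ε l), sub_eq_add_neg,
          Real.rpow_add h0]
        ring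
  have hwm : MemLp w 2 (volume.restrict unitInt) := Lp.memLp w
  have hd : Tendsto (fun l => ∫ x in unitInt, ‖f l x - w x‖ ^ 2) 𝒰 (𝓝 0) := by
    have h1 : Tendsto (fun l => ‖u l - w‖ ^ 2) 𝒰 (𝓝 0) := by
      have := (tendsto_iff_norm_sub_tendsto_zero.1 hu).pow 2
      simpa using this
    refine h1.congr' ?_
    filter_upwards [hadm] with l hl
    rw [norm_sq_eq_integral]
    refine integral_congr_ae ?_
    filter_upwards [Lp.coeFn_sub (u l) w, (hf l hl).2.1] with x hx hx2
    rw [hx, Pi.sub_apply, hx2]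
  have hw1 := norm_eq_one_of_tendsto hfg hwm hd hr
  have hsplit : ∀ᶠ l in (𝒰 : Filter ℕ), L / 2 * ∫ x in unitInt, h l x ^ 2 ≤ M :=
    split.mono fun l hl => (ENNReal.ofReal_le_ofReal_iff hM).1 (le_add_self.trans hl)
  obtain ⟨H, hH, hHlim, hHb⟩ := exists_weak_limit_memLp 𝒰 h hm (2 / L * M) (by
    filter_upwards [hsplit] with l hl
    rw [div_mul_eq_mul_div, le_div_iff₀ hL]; linarith)
  have hfin := finite_vanishing hεpos hε hUU hU0 hU1 hMM
  set V := hfin.toFinset with hV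
  have memV : ∀ x, x ∈ V ↔ x ∈ Icc (0 : ℝ) 1 ∧ Vanishes 𝒰 U x := by simp [hV]
  have hvan : ∀ x, Vanishes 𝒰 f x ↔ Vanishes 𝒰 U x := by simp only [Vanishes, hnorm, implies_true]
  -- The candidate for the derivative of `w`, read off from the limit phase equation; its twist
  -- against `w` is `H + 2πA` because `|w| = 1`.
  set v : ℝ → ℂ := fun x => Complex.I * ((H x + 2 * Real.pi * A : ℝ) : ℂ) * w x with hv
  have hbd : IsWeakDerivBdry V w v z := by
    intro φ h1 h2
    refine phase_limit (h := h) (B := 2 / L * M) (n := fun l => (N l : ℝ)) (e := fun l => ε l ^ (-β))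
      hfg f0 f1 hz1 (fun l => (Real.rpow_pos_of_pos (hεpos l) _).le) hA (fun l x => rfl) hm ?_ hwm
      hd hr her hlim hH hHlim (contDiff_one_of_infty h1) ?_
    · filter_upwards [hsplit] with l hl
      rw [div_mul_eq_mul_div, le_div_iff₀ hL]; linarith
    · intro x hx hxs hvx
      exact h2 x hx hxs ((memV x).2 ⟨hx, (hvan x).1 hvx⟩)
  have hvm : MemLp v 2 (volume.restrict unitInt) := by
    have hk : MemLp (fun x => H x + 2 * Real.pi * A) 2 (volume.restrict unitInt) :=
      hH.add (memLp_const _)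
    refine hk.of_le ((aestronglyMeasurable_const.mul hk.ofReal.1).mul hwm.1) ?_
    filter_upwards [hw1] with x hx
    rw [hv, norm_mul, norm_mul, hx, Complex.norm_I, Complex.norm_real, one_mul, mul_one]
  have fin : volume unitInt ≠ ⊤ := by simp [volume_unitInt]
  have iw := integrableOn_of_memLp_two fin hwm
  have iv := integrableOn_of_memLp_two fin hvm
  have hwd := hbd.isWeakDeriv iw iv
  have rV := restrict_unitInt_diff V.finite_toSet
  have hreg : MemH1Circle (unitInt \ (V : Set ℝ)) w :=
    ⟨⟨by rwa [rV], v, by rwa [rV], hwd⟩, by rwa [rV]⟩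
  have hex := exists_isJumpSet α hreg
  rw [limitEnergy, dif_pos hex]
  have hJ := hex.choose_spec
  set J := hex.choose
  have hJV : J ⊆ V := hJ.subset_of_regular hreg (hbd.hasTraceZero iw iv) (hbd.hasTraceOne iw iv)
  -- The limit energy uses the derivative off `J`, whereas `v` was found off the possibly larger set
  -- `V`. They agree off `V`, hence almost everywhere.
  have hweak : weakDeriv (unitInt \ (J : Set ℝ)) w =ᵐ[volume.restrict unitInt] v := by
    obtain ⟨⟨-, v', hv'⟩, -⟩ := hJ.memH1
    have hs := weakDeriv_spec hv'
    have rJ := restrict_unitInt_diff J.finite_toSet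
    have i1 : IntegrableOn (weakDeriv (unitInt \ (J : Set ℝ)) w) unitInt := by
      have := hs.1; rw [rJ] at this
      exact integrableOn_of_memLp_two fin this
    have := IsWeakDeriv.unique (isOpen_unitInt_diff V.finite_toSet) (i1.mono_set sdiff_subset)
      (iv.mono_set sdiff_subset) (hs.2.mono (isOpen_unitInt_diff J.finite_toSet)
        (sdiff_subset_sdiff_right (by exact_mod_cast hJV))) hwd
    rwa [rV] at this
  have hbulk : ∫⁻ x in unitInt, ENNReal.ofReal (L / 2 *
      (twist (w x) (weakDeriv (unitInt \ (J : Set ℝ)) w x) - 2 * Real.pi * A) ^ 2)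
      = ENNReal.ofReal (L / 2 * ∫ x in unitInt, H x ^ 2) := by
    rw [← lintegral_ofReal_sq hH (by positivity)]
    refine lintegral_congr_ae ?_
    filter_upwards [hweak, hw1] with x hx hx1
    rw [hx, hv, twist_smul_I hx1]; congr 3; ring
  have hreal : ∀ δ : ℝ, 0 < δ → δ ≤ 1 / 12 →
      L / 2 * ∫ x in unitInt, H x ^ 2 ≤ M - V.card * (2 * √2 / 3 - 4 * δ) := by
    intro δ hδ hδ1
    have h2p : 1 < √2 := by rw [Real.lt_sqrt] <;> norm_num
    have hc : 0 ≤ 2 * √2 / 3 - 4 * δ := by linarith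
    have hev := eventually_wells_cost hεpos hε hUU hU0 hU1 hMM V (fun x hx => (memV x).1 hx) hδ
      (by linarith)
    -- The wells take their share of the budget `M`. What remains bounds `∫ h²`, and the bound
    -- passes to the weak limit.
    have := hHb (2 / L * (M - V.card * (2 * √2 / 3 - 4 * δ))) (by
      filter_upwards [hev, split] with l h1 h2
      have h3 := (add_le_add_left h1 _).trans h2
      have hi : 0 ≤ ∫ x in unitInt, h l x ^ 2 := integral_nonneg fun x => sq_nonneg _
      rw [← ENNReal.ofReal_natCast, ← ENNReal.ofReal_mul (by positivity),
        ← ENNReal.ofReal_add (by positivity) (by positivity), ENNReal.ofReal_le_ofReal_iff hM] at h3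
      rw [div_mul_eq_mul_div, le_div_iff₀ hL]; linarith)
    rw [div_mul_eq_mul_div, le_div_iff₀ hL] at this
    linarith
  have hfinal : L / 2 * ∫ x in unitInt, H x ^ 2 ≤ M - V.card * (2 * √2 / 3) := by
    have ht : Tendsto (fun δ : ℝ => M - V.card * (2 * √2 / 3 - 4 * δ)) (𝓝[>] 0)
        (𝓝 (M - V.card * (2 * √2 / 3 - 4 * 0))) :=
      ((by fun_prop : Continuous (fun δ : ℝ => M - V.card * (2 * √2 / 3 - 4 * δ))).tendsto 0).mono_left
        nhdsWithin_le_nhds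
    rw [mul_zero, sub_zero] at ht
    refine ge_of_tendsto ht ?_
    filter_upwards [Ioc_mem_nhdsGT (by norm_num : (0 : ℝ) < 1 / 12)] with δ hδ
    exact hreal δ hδ.1 hδ.2
  rw [jumpTwistValue, hbulk]
  calc ENNReal.ofReal (L / 2 * ∫ x in unitInt, H x ^ 2) + ENNReal.ofReal (2 * √2 / 3) * (J.card : ℝ≥0∞)
      ≤ ENNReal.ofReal (L / 2 * ∫ x in unitInt, H x ^ 2)
        + ENNReal.ofReal (2 * √2 / 3) * (V.card : ℝ≥0∞) := by
        gcongr
    _ ≤ _ := by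
        have hi : 0 ≤ ∫ x in unitInt, H x ^ 2 := integral_nonneg fun x => sq_nonneg _
        rw [← ENNReal.ofReal_natCast, ← ENNReal.ofReal_mul (by positivity),
          ← ENNReal.ofReal_add (by positivity) (by positivity)]
        apply ENNReal.ofReal_le_ofReal
        linarith

/-- The liminf inequality. -/
theorem limitEnergy_le_liminf {L α β A : ℝ} (hL : 0 < L) (hβ : β < 1 / 2)
    (hA : A ∈ Icc (0 : ℝ) 1) {ε : ℕ → ℝ} (hεpos : ∀ l, 0 < ε l) (hε : Tendsto ε atTop (𝓝 0))
    (hlim : Tendsto (fun l => (ε l) ^ (-β) - (⌊(ε l) ^ (-β)⌋ : ℝ)) atTop (𝓝 A))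
    {u : ℕ → L2Space} {w : L2Space} (hu : Tendsto u atTop (𝓝 w)) :
    limitEnergy L α A w ≤ liminf (fun l => demodEnergy L α β (ε l) (u l)) atTop := by
  refine le_of_forall_gt fun c hc => ?_
  obtain ⟨d, hd1, hd2⟩ := exists_between hc
  have hfr : ∃ᶠ l in atTop, demodEnergy L α β (ε l) (u l) < d :=
    frequently_lt_of_liminf_lt (by isBoundedDefault) hd1
  -- For `d` above the liminf the indices of energy below `d` are cofinal, so some ultrafilter finer
  -- than `atTop` contains them.
  have hne : NeBot (atTop ⊓ 𝓟 {l | demodEnergy L α β (ε l) (u l) < d}) :=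
    frequently_iff_neBot.1 hfr
  set 𝒰 := Ultrafilter.of (atTop ⊓ 𝓟 {l | demodEnergy L α β (ε l) (u l) < d})
  have hle : (𝒰 : Filter ℕ) ≤ atTop ⊓ 𝓟 {l | demodEnergy L α β (ε l) (u l) < d} := Ultrafilter.of_le _
  have hle1 := hle.trans inf_le_left
  have hev : ∀ᶠ l in (𝒰 : Filter ℕ), demodEnergy L α β (ε l) (u l) < d :=
    le_principal_iff.1 (hle.trans inf_le_right)
  refine lt_of_le_of_lt ?_ hd2
  rw [← ENNReal.ofReal_toReal hd2.ne_top]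
  refine limitEnergy_le_of_eventually hL hβ hA hεpos (hε.mono_left hle1) (hlim.mono_left hle1)
    (hu.mono_left hle1) ENNReal.toReal_nonneg ?_
  rw [ENNReal.ofReal_toReal hd2.ne_top]
  exact hev.mono fun l hl => hl.le

/-! ### Nearly optimal smooth well profiles -/

/-- A smooth function close to the identity on `[0, 1]` and constant near and beyond the ends. -/
theorem exists_smooth_clamp {κ : ℝ} (hκ : 0 < κ) (hκ8 : κ < 1 / 8) :
    ∃ S : ℝ → ℝ, ContDiff ℝ ∞ S ∧ (∀ s, S s ∈ Icc (0 : ℝ) 1) ∧ (∀ s ≤ κ, S s = 0) ∧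
      (∀ s, 1 - κ ≤ s → S s = 1) ∧ (∀ s, |deriv S s| ≤ (1 - 4 * κ)⁻¹) ∧
      (∀ s, s ≤ κ ∨ 1 - κ ≤ s → deriv S s = 0) ∧ ∀ s ∈ Icc (0 : ℝ) 1, s - 4 * κ ≤ S s := by
  -- `S` will be the primitive of this plateau function, divided by its total integral, which lies
  -- between `1 - 4κ` and 1.
  obtain ⟨χ, χd, χr, χs, χ1⟩ := exists_contMDiff_support_eq_eq_one_iff (n := ⊤)
    (modelWithCornersSelf ℝ ℝ) (s := Ioo κ (1 - κ)) (t := Icc (2 * κ) (1 - 2 * κ)) isOpen_Ioo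
    isClosed_Icc (Icc_subset_Ioo (by linarith) (by linarith))
  have χd : ContDiff ℝ ∞ χ := χd.contDiff
  have χc := χd.continuous
  have χ01 : ∀ x, χ x ∈ Icc (0 : ℝ) 1 := fun x => χr ⟨x, rfl⟩
  have χ0 : ∀ x, x ≤ κ ∨ 1 - κ ≤ x → χ x = 0 := by
    intro x hx
    rw [← Function.notMem_support, χs]
    rintro ⟨h1, h2⟩
    rcases hx with h | h <;> linarith
  have ii : ∀ a b, IntervalIntegrable χ volume a b := fun a b => χc.intervalIntegrable a b
  have zero_le : ∀ s ≤ κ, ∫ t in (0 : ℝ)..s, χ t = 0 := by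
    intro s hs
    rw [intervalIntegral.integral_congr (g := fun _ => (0 : ℝ))]
    · simp
    · intro t ht
      exact χ0 t (Or.inl (ht.2.trans (max_le hκ.le hs)))
  set I := ∫ t in (0 : ℝ)..1, χ t with hI
  have const_ge : ∀ s, 1 - κ ≤ s → ∫ t in (0 : ℝ)..s, χ t = I := by
    intro s hs
    rw [hI, ← intervalIntegral.integral_add_adjacent_intervals (ii 0 1) (ii 1 s),
      intervalIntegral.integral_congr (a := 1) (b := s) (g := fun _ => (0 : ℝ))]
    · simp
    · intro t ht
      exact χ0 t (Or.inr (le_trans (le_min (by linarith) hs) ht.1))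
  have lower : ∀ s ∈ Icc (0 : ℝ) 1, s - 4 * κ ≤ ∫ t in (0 : ℝ)..s, χ t := by
    intro s hs
    rcases le_or_gt s (2 * κ) with h | h
    · have : 0 ≤ ∫ t in (0 : ℝ)..s, χ t :=
        intervalIntegral.integral_nonneg hs.1 fun t _ => (χ01 t).1
      linarith
    set s' := min s (1 - 2 * κ)
    have hs' : 2 * κ ≤ s' := le_min h.le (by linarith)
    have h1 : ∫ t in (2 * κ)..s', χ t = s' - 2 * κ := by
      rw [intervalIntegral.integral_congr (g := fun _ => (1 : ℝ))]
      · simp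
      · intro t ht
        rw [uIcc_of_le hs'] at ht
        exact (χ1 t).1 ⟨ht.1, ht.2.trans (min_le_right _ _)⟩
    have h0 : 0 ≤ ∫ t in (0 : ℝ)..(2 * κ), χ t :=
      intervalIntegral.integral_nonneg (by linarith) fun t _ => (χ01 t).1
    have h2 : 0 ≤ ∫ t in s'..s, χ t :=
      intervalIntegral.integral_nonneg (min_le_left _ _) fun t _ => (χ01 t).1
    rw [← intervalIntegral.integral_add_adjacent_intervals (ii 0 s') (ii s' s),
      ← intervalIntegral.integral_add_adjacent_intervals (ii 0 (2 * κ)) (ii (2 * κ) s'), h1]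
    have : s - 2 * κ ≤ s' := le_min (by linarith) (by linarith [hs.2])
    linarith
  have hI1 : 1 - 4 * κ ≤ I := lower 1 (by simp)
  have hI0 : 0 < I := by linarith
  have hIle : I ≤ 1 := by
    have : I ≤ ∫ _ in (0 : ℝ)..1, (1 : ℝ) :=
      intervalIntegral.integral_mono zero_le_one (ii 0 1) (by simp) fun t => (χ01 t).2
    simpa using this
  set S : ℝ → ℝ := fun s => (∫ t in (0 : ℝ)..s, χ t) / I with hS
  have Sder : ∀ s, HasDerivAt S (χ s / I) s := fun s =>
    (intervalIntegral.integral_hasDerivAt_right (ii 0 s)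
      (χc.stronglyMeasurableAtFilter _ _) χc.continuousAt).div_const I
  have Sd' : deriv S = fun s => χ s / I := funext fun s => (Sder s).deriv
  have S0 : ∀ s ≤ κ, S s = 0 := fun s hs => by simp only [hS, zero_le s hs, zero_div]
  have S1 : ∀ s, 1 - κ ≤ s → S s = 1 := fun s hs => by
    simp only [hS, const_ge s hs]; exact div_self hI0.ne'
  have Smono : Monotone S := monotone_of_deriv_nonneg (fun s => (Sder s).differentiableAt)
    fun s => by rw [Sd']; exact div_nonneg (χ01 s).1 hI0.le
  refine ⟨S, ?_, ?_, S0, S1, ?_, ?_, ?_⟩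
  · rw [contDiff_infty_iff_deriv, Sd']
    exact ⟨fun s => (Sder s).differentiableAt, χd.div_const I⟩
  · intro s
    constructor
    · rcases le_total s κ with h | h
      · exact (S0 s h).ge
      · rw [← S0 κ le_rfl]; exact Smono h
    · rcases le_total (1 - κ) s with h | h
      · exact (S1 s h).le
      · rw [← S1 _ le_rfl]; exact Smono h
  · intro s
    rw [Sd', abs_of_nonneg (div_nonneg (χ01 s).1 hI0.le), div_eq_mul_inv]
    calc χ s * I⁻¹ ≤ 1 * (1 - 4 * κ)⁻¹ :=
          mul_le_mul (χ01 s).2 (inv_anti₀ (by linarith) hI1) (inv_nonneg.2 hI0.le) zero_le_one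
      _ = _ := one_mul _
  · intro s hs
    rw [Sd']; simp [χ0 s hs]
  · intro s hs
    have h1 := lower s hs
    have h0 : 0 ≤ ∫ t in (0 : ℝ)..s, χ t :=
      intervalIntegral.integral_nonneg hs.1 fun t _ => (χ01 t).1
    refine h1.trans ?_
    rw [hS, le_div_iff₀ hI0]
    nlinarith

theorem hasDerivAt_tanh (x : ℝ) : HasDerivAt Real.tanh (1 - Real.tanh x ^ 2) x := by
  have hc : Real.cosh x ≠ 0 := (Real.cosh_pos x).ne'
  have h := (Real.hasDerivAt_sinh x).div (Real.hasDerivAt_cosh x) hc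
  have e : (Real.sinh / Real.cosh) = Real.tanh := by
    ext y; rw [Pi.div_apply, Real.tanh_eq_sinh_div_cosh]
  rw [e] at h
  refine h.congr_deriv ?_
  rw [Real.tanh_eq_sinh_div_cosh]
  field_simp

theorem contDiff_tanh : ContDiff ℝ ∞ Real.tanh := by
  have e : Real.tanh = fun y => Real.sinh y / Real.cosh y := by
    ext y; rw [Real.tanh_eq_sinh_div_cosh]
  rw [e]
  exact Real.contDiff_sinh.div Real.contDiff_cosh fun x => (Real.cosh_pos x).ne'

/-- A smooth transition profile on the half line with energy at most `m² c³ √2/3`. -/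
theorem exists_half_profile {κ : ℝ} (hκ : 0 < κ) (hκ8 : κ < 1 / 8) :
    ∃ q : ℝ → ℝ, ∃ κ' > 0, ∃ T > 0, ContDiff ℝ ∞ q ∧ (∀ t, q t ∈ Icc (0 : ℝ) 1) ∧
      (∀ t ≤ κ', q t = 0) ∧ (∀ t, T ≤ t → q t = 1) ∧
      ∫ t in (0 : ℝ)..T, wellDensity 1 (q t) (deriv q t)
        ≤ (1 - 4 * κ)⁻¹ ^ 2 * (√(1 + 8 * κ) ^ 3 * (√2 / 3)) := by
  obtain ⟨S, Sd, S01, S0, S1, Sb, Sz, Sl⟩ := exists_smooth_clamp hκ hκ8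
  -- The value of `c` is chosen so that the clamp's loss is absorbed: `S(Y) ≥ Y - 4κ` gives `1 -
  -- S(Y)² ≤ c² - Y²` on `[0, 1]`.
  set c := √(1 + 8 * κ) with hc
  have hc2 : c ^ 2 = 1 + 8 * κ := Real.sq_sqrt (by linarith)
  have hc1 : 1 < c := by rw [hc, Real.lt_sqrt] <;> linarith
  have hc0 : 0 < c := by linarith
  have h22 : √2 ^ 2 = 2 := Real.sq_sqrt (by norm_num)
  have h2p : 0 < √2 := by positivity
  set m := (1 - 4 * κ)⁻¹ with hm
  have hm1 : 1 ≤ m := by rw [hm, one_le_inv₀ (by linarith)]; linarith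
  -- The optimal profile equation with the well moved from 1 to `c > 1`, so that the value 1 is
  -- reached at a finite time `T`; composing with `S` makes the profile flat at both ends.
  set y : ℝ → ℝ := fun t => c * Real.tanh (c / √2 * t) with hy
  have yd : ContDiff ℝ ∞ y := contDiff_const.mul (contDiff_tanh.comp (contDiff_const.mul contDiff_id))
  have yder : ∀ t, HasDerivAt y ((c ^ 2 - y t ^ 2) / √2) t := by
    intro t
    have h1 : HasDerivAt (fun t => c / √2 * t) (c / √2) t := by
      simpa using (hasDerivAt_id t).const_mul (c / √2)
    refine (((hasDerivAt_tanh _).comp t h1).const_mul c).congr_deriv ?_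
    simp only [hy]; field_simp
  have ylt : ∀ t, |y t| < c := by
    intro t
    simp only [hy]
    rw [abs_mul, abs_of_pos hc0]
    have := Real.abs_tanh_lt_one (c / √2 * t)
    nlinarith
  have ysq : ∀ t, 0 < c ^ 2 - y t ^ 2 := by
    intro t
    have := sq_lt_sq.2 ((ylt t).trans_le (le_abs_self c))
    linarith
  have ymono : StrictMono y := strictMono_of_deriv_pos fun t => by
    rw [(yder t).deriv]; have := ysq t; positivity
  have y0 : y 0 = 0 := by simp [hy]
  set T := √2 / c * Real.artanh (1 / c) with hT
  have hinv : 1 / c ∈ Ioo (0 : ℝ) 1 := ⟨by positivity, by rw [div_lt_one hc0]; exact hc1⟩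
  have hyT : y T = 1 := by
    simp only [hy, hT]
    rw [show c / √2 * (√2 / c * Real.artanh (1 / c)) = Real.artanh (1 / c) by field_simp,
      Real.tanh_artanh ⟨by linarith [hinv.1], hinv.2⟩]
    field_simp
  have hT0 : 0 < T := by
    rw [← ymono.lt_iff_lt, y0, hyT]; exact one_pos
  obtain ⟨κ', hκ', hsmall⟩ : ∃ κ' > 0, y κ' ≤ κ := by
    have : ∀ᶠ t in 𝓝[>] (0 : ℝ), y t < κ :=
      nhdsWithin_le_nhds (yd.continuous.continuousAt.eventually_lt_const (by rw [y0]; exact hκ))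
    obtain ⟨t, h1, h2⟩ := (this.and self_mem_nhdsWithin).exists
    exact ⟨t, h2, h1.le⟩
  have qder : ∀ t, HasDerivAt (fun t => S (y t)) (deriv S (y t) * ((c ^ 2 - y t ^ 2) / √2)) t :=
    fun t => ((Sd.differentiable (by simp) (y t)).hasDerivAt).comp t (yder t)
  have qd : ContDiff ℝ ∞ (fun t => S (y t)) := Sd.comp yd
  refine ⟨fun t => S (y t), κ', hκ', T, hT0, qd, fun t => S01 _,
    fun t ht => S0 _ ((ymono.monotone ht).trans hsmall), fun t ht => S1 _ ?_, ?_⟩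
  · have := ymono.monotone ht
    rw [hyT] at this; linarith
  -- Along the profile the bounds on the gradient and the potential combine into `m²(c² - y²)²/2`,
  -- which is an exact derivative by the equation for `y`.
  set G : ℝ → ℝ := fun t => m ^ 2 * ((c ^ 2 * y t - y t ^ 3 / 3) / √2) with hG
  have Gder : ∀ t, HasDerivAt G (m ^ 2 * ((c ^ 2 - y t ^ 2) ^ 2 / 2)) t := by
    intro t
    have := ((((yder t).const_mul (c ^ 2)).sub (((yder t).pow 3).div_const 3)).div_const (√2)).const_mul
      (m ^ 2)
    refine this.congr_deriv ?_
    have : √2 ≠ 0 := h2p.ne'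
    field_simp
    rw [h22]
    push_cast
    ring
  have bound : ∀ t ∈ Icc 0 T, wellDensity 1 (S (y t)) (deriv (fun t => S (y t)) t)
      ≤ m ^ 2 * ((c ^ 2 - y t ^ 2) ^ 2 / 2) := by
    intro t ht
    have hy0 : 0 ≤ y t := by rw [← y0]; exact ymono.monotone ht.1
    have hy1 : y t ≤ 1 := by rw [← hyT]; exact ymono.monotone ht.2
    set Y := y t
    have hpos := ysq t
    rw [(qder t).deriv, wellDensity]
    have b1 : (deriv S Y) ^ 2 ≤ m ^ 2 := by
      rw [← sq_abs]; exact pow_le_pow_left₀ (abs_nonneg _) (Sb Y) 2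
    have b2 : (deriv S Y * ((c ^ 2 - Y ^ 2) / √2)) ^ 2 ≤ m ^ 2 * ((c ^ 2 - Y ^ 2) ^ 2 / 2) := by
      rw [mul_pow, div_pow, h22]; gcongr
    obtain ⟨s0, s1⟩ := S01 Y
    have b3 : S Y ^ 2 ≥ Y ^ 2 - 8 * κ := by
      have h1 := Sl Y ⟨hy0, hy1⟩
      rcases le_total Y (4 * κ) with h | h
      · nlinarith
      · have : (Y - 4 * κ) ^ 2 ≤ S Y ^ 2 := pow_le_pow_left₀ (by linarith) h1 2
        nlinarith
    have b4 : (S Y ^ 2 - 1) ^ 2 ≤ (c ^ 2 - Y ^ 2) ^ 2 := by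
      rw [← neg_sq (S Y ^ 2 - 1)]
      exact pow_le_pow_left₀ (by nlinarith) (by linarith) 2
    have b5 : (c ^ 2 - Y ^ 2) ^ 2 / 2 ≤ m ^ 2 * ((c ^ 2 - Y ^ 2) ^ 2 / 2) :=
      le_mul_of_one_le_left (by positivity) (one_le_pow₀ hm1)
    linarith
  have cont1 : Continuous (fun t => wellDensity 1 (S (y t)) (deriv (fun t => S (y t)) t)) := by
    have h1 : Continuous (deriv (fun t => S (y t))) := qd.continuous_deriv (by simp)
    have h2 := qd.continuous
    unfold wellDensity
    fun_prop
  have cont2 : Continuous (fun t => m ^ 2 * ((c ^ 2 - y t ^ 2) ^ 2 / 2)) := by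
    have := yd.continuous
    fun_prop
  calc ∫ t in (0 : ℝ)..T, wellDensity 1 (S (y t)) (deriv (fun t => S (y t)) t)
      ≤ ∫ t in (0 : ℝ)..T, m ^ 2 * ((c ^ 2 - y t ^ 2) ^ 2 / 2) :=
        intervalIntegral.integral_mono_on hT0.le (cont1.intervalIntegrable _ _)
          (cont2.intervalIntegrable _ _) bound
    _ = G T - G 0 := intervalIntegral.integral_eq_sub_of_hasDerivAt (fun t _ => Gder t)
        (cont2.intervalIntegrable _ _)
    _ ≤ m ^ 2 * (c ^ 3 * (√2 / 3)) := by
        have e1 : G 0 = 0 := by simp [hG, y0]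
        rw [e1, sub_zero, hG]
        simp only [hyT]
        -- Equivalent to `(c - 1)²(2c + 1) ≥ 0`.
        have h3 : c ^ 2 * 1 - 1 ^ 3 / 3 ≤ c ^ 3 * 2 / 3 := by nlinarith [sq_nonneg (c - 1)]
        have h4 : (c ^ 2 * 1 - 1 ^ 3 / 3) / √2 ≤ c ^ 3 * (√2 / 3) := by
          rw [div_le_iff₀ h2p]
          nlinarith
        gcongr

/-- A smooth, even, compactly supported profile with almost optimal Modica–Mortola energy. -/
theorem exists_profile {δ : ℝ} (hδ : 0 < δ) :
    ∃ b : ℝ → ℝ, ∃ κ > 0, ∃ T > 0, ContDiff ℝ ∞ b ∧ (∀ t, b t ∈ Icc (0 : ℝ) 1) ∧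
      (∀ t, |t| ≤ κ → b t = 1) ∧ (∀ t, T ≤ |t| → b t = 0 ∧ deriv b t = 0) ∧
      ∫ t, wellDensity 1 (1 - b t) (deriv b t) ≤ 2 * √2 / 3 + δ := by
  have hk : ∀ᶠ κ in 𝓝[>] (0 : ℝ), (1 - 4 * κ)⁻¹ ^ 2 * (√(1 + 8 * κ) ^ 3 * (√2 / 3)) < √2 / 3 + δ / 2 := by
    have hc : ContinuousAt (fun κ : ℝ => (1 - 4 * κ)⁻¹ ^ 2 * (√(1 + 8 * κ) ^ 3 * (√2 / 3))) 0 := by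
      have h1 : ContinuousAt (fun κ : ℝ => (1 - 4 * κ)⁻¹) 0 :=
        ContinuousAt.inv₀ (by fun_prop) (by norm_num)
      fun_prop
    refine nhdsWithin_le_nhds (hc.eventually_lt_const ?_)
    simp; linarith
  obtain ⟨κ, ⟨hκ, hκ0⟩, hκ8⟩ := ((hk.and self_mem_nhdsWithin).and
    (Ioo_mem_nhdsGT (by norm_num : (0 : ℝ) < 1 / 8))).exists
  obtain ⟨q, κ', hκ', T, hT, qd, q01, q0, q1, qE⟩ := exists_half_profile hκ0 hκ8.2
  -- Even reflection: `q` vanishes up to `κ' > 0`, so at most one of the two terms is nonzero and `1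
  -- - b` is the half profile evaluated at `|t|`.
  set b : ℝ → ℝ := fun t => 1 - q t - q (-t) with hb
  have qdiff : ∀ t, HasDerivAt q (deriv q t) t := fun t => (qd.differentiable (by simp) t).hasDerivAt
  have bder : ∀ t, HasDerivAt b (- deriv q t + deriv q (-t)) t := by
    intro t
    have h1 : HasDerivAt (fun t => q (-t)) (deriv q (-t) * (-1)) t :=
      (qdiff (-t)).comp t (hasDerivAt_neg t)
    refine (((qdiff t).const_sub 1).sub h1).congr_deriv ?_
    ring
  have q0' : ∀ t < κ', deriv q t = 0 := by
    intro t ht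
    have : q =ᶠ[𝓝 t] fun _ => 0 := by
      filter_upwards [Iio_mem_nhds ht] with s hs
      exact q0 s (le_of_lt hs)
    rw [this.deriv_eq]; simp
  have q1' : ∀ t, T < t → deriv q t = 0 := by
    intro t ht
    have : q =ᶠ[𝓝 t] fun _ => 1 := by
      filter_upwards [Ioi_mem_nhds ht] with s hs
      exact q1 s (le_of_lt hs)
    rw [this.deriv_eq]; simp
  have qTκ : κ' < T := by
    by_contra! h
    have := q1 T le_rfl
    rw [q0 T h] at this
    norm_num at this
  have hpos : ∀ t, 0 ≤ t → b t = 1 - q t ∧ deriv b t = - deriv q t := by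
    intro t ht
    refine ⟨by simp only [hb]; rw [q0 (-t) (by linarith), sub_zero], ?_⟩
    rw [(bder t).deriv, q0' (-t) (by linarith), add_zero]
  have beven : ∀ t, b (-t) = b t ∧ deriv b (-t) = - deriv b t := by
    intro t
    refine ⟨by simp only [hb, neg_neg]; ring, ?_⟩
    rw [(bder t).deriv, (bder (-t)).deriv, neg_neg]; ring
  have habs : ∀ t, b |t| = b t := by
    intro t
    rcases abs_cases t with ⟨h, -⟩ | ⟨h, -⟩
    · rw [h]
    · rw [h]; exact (beven t).1
  have bd : ContDiff ℝ ∞ b := (contDiff_const.sub qd).sub (qd.comp contDiff_neg)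
  have bcont' : Continuous (deriv b) := bd.continuous_deriv (by simp)
  -- The radius is `T + 1` because the vanishing of the derivative was shown only strictly beyond
  -- `T`.
  refine ⟨b, κ', hκ', T + 1, by linarith, bd, ?_, ?_, ?_, ?_⟩
  · intro t
    rw [← habs t, (hpos _ (abs_nonneg t)).1]
    have := q01 |t|
    exact ⟨by linarith [this.2], by linarith [this.1]⟩
  · intro t ht
    rw [← habs t, (hpos _ (abs_nonneg t)).1, q0 _ ht, sub_zero]
  · intro t ht
    refine ⟨by rw [← habs t, (hpos _ (abs_nonneg t)).1, q1 _ (by linarith), sub_self], ?_⟩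
    have h1 : deriv b |t| = 0 := by
      rw [(hpos _ (abs_nonneg t)).2, q1' _ (by linarith), neg_zero]
    rcases abs_cases t with ⟨h, -⟩ | ⟨h, -⟩
    · rwa [h] at h1
    · rw [h, (beven t).2] at h1; linarith
  · have e1 : (fun t => wellDensity 1 (1 - b t) (deriv b t))
        = fun t => (fun s => wellDensity 1 (1 - b s) (deriv b s)) |t| := by
      ext t
      rcases abs_cases t with ⟨h, -⟩ | ⟨h, -⟩
      · rw [h]
      · simp only [h, beven t, wellDensity, neg_sq]
    rw [e1, integral_comp_abs (f := fun s => wellDensity 1 (1 - b s) (deriv b s))]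
    have e2 : ∫ s in Ioi (0 : ℝ), wellDensity 1 (1 - b s) (deriv b s)
        = ∫ s in (0 : ℝ)..T, wellDensity 1 (q s) (deriv q s) := by
      rw [intervalIntegral.integral_of_le hT.le,
        setIntegral_eq_of_subset_of_forall_sdiff_eq_zero measurableSet_Ioi
          (Ioc_subset_Ioi_self : Ioc (0 : ℝ) T ⊆ Ioi 0)]
      · refine setIntegral_congr_fun measurableSet_Ioc fun s hs => ?_
        simp only [hpos s hs.1.le, wellDensity, neg_sq, sub_sub_cancel]
      · intro s hs
        have hs0 : 0 < s := hs.1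
        have hsT : T < s := by
          by_contra! h; exact hs.2 ⟨hs0, h⟩
        rw [(hpos s hs0.le).1, (hpos s hs0.le).2, q1' s hsT, q1 s hsT.le, wellDensity]
        norm_num
    rw [e2]
    linarith

/-! ### Cutoffs with wells at the jump points -/

/-- Away from the zeros of `D`, every point is interior to `S` or to its complement, so that the
restriction of `D` to `S` inherits the smoothness of `D`. -/
def Splits (D : ℝ → ℝ) (S : Set ℝ) : Prop :=
  ∀ x, S ∈ 𝓝 x ∨ Sᶜ ∈ 𝓝 x ∨ D =ᶠ[𝓝 x] 0

namespace Splits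

variable {D : ℝ → ℝ} {S S' : Set ℝ}

theorem compl (h : Splits D S) : Splits D Sᶜ := fun x => by
  rw [compl_compl]
  rcases h x with h | h | h
  exacts [.inr (.inl h), .inl h, .inr (.inr h)]

theorem union (h : Splits D S) (h' : Splits D S') : Splits D (S ∪ S') := fun x => by
  rcases h x with h | h | h
  · exact .inl (mem_of_superset h subset_union_left)
  · rcases h' x with h' | h' | h'
    · exact .inl (mem_of_superset h' subset_union_right)
    · refine .inr (.inl ?_)
      rw [compl_union]
      exact inter_mem h h'
    · exact .inr (.inr h')
  · exact .inr (.inr h)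

theorem eventuallyEq (h : Splits D S) (x : ℝ) :
    S.indicator D =ᶠ[𝓝 x] 0 ∧ (x ∉ S ∨ D =ᶠ[𝓝 x] 0) ∨ S.indicator D =ᶠ[𝓝 x] D ∧ x ∈ S := by
  rcases h x with h | h | h
  · exact .inr ⟨by filter_upwards [h] with y hy using indicator_of_mem hy D, mem_of_mem_nhds h⟩
  · exact .inl ⟨by filter_upwards [h] with y hy using indicator_of_notMem hy D,
      .inl (mem_of_mem_nhds h)⟩
  · refine .inl ⟨?_, .inr h⟩
    filter_upwards [h] with y hy
    by_cases hS : y ∈ S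
    · rw [indicator_of_mem hS, hy]
    · exact indicator_of_notMem hS D

theorem contDiff (h : Splits D S) (hD : ContDiff ℝ ∞ D) : ContDiff ℝ ∞ (S.indicator D) := by
  rw [contDiff_iff_contDiffAt]
  intro x
  rcases h.eventuallyEq x with h | h
  · exact (contDiffAt_const (c := (0 : ℝ))).congr_of_eventuallyEq h.1
  · exact hD.contDiffAt.congr_of_eventuallyEq h.1

theorem deriv_indicator (h : Splits D S) : deriv (S.indicator D) = S.indicator (deriv D) := by
  ext x
  rcases h.eventuallyEq x with ⟨h1, h2⟩ | ⟨h1, h2⟩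
  · rw [h1.deriv_eq]
    have h0 : deriv (0 : ℝ → ℝ) x = 0 := by simp
    rw [h0]
    rcases h2 with h2 | h2
    · exact (indicator_of_notMem h2 _).symm
    · by_cases hS : x ∈ S
      · rw [indicator_of_mem hS, h2.deriv_eq, h0]
      · exact (indicator_of_notMem hS _).symm
  · rw [h1.deriv_eq, indicator_of_mem h2]

end Splits

/-- A cutoff `D` vanishing at the interior points of `J` and, to the right of a zone `S₀` around `0`
and to the left of a zone `S₁` around `1`, once more if `0 ∈ J` or `1 ∈ J`; off `B` nothing is
changed. -/
structure WellCutoff (J : Finset ℝ) (D : ℝ → ℝ) (S₀ S₁ B : Set ℝ) : Prop where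
  contDiff : ContDiff ℝ ∞ D
  mem_Icc : ∀ x, D x ∈ Icc (0 : ℝ) 1
  measurableSet_left : MeasurableSet S₀
  measurableSet_right : MeasurableSet S₁
  measurableSet : MeasurableSet B
  splits_left : Splits D S₀
  splits_right : Splits D S₁
  disjoint : Disjoint S₀ S₁
  vanishes : ∀ z ∈ J, z ∈ unitInt → D =ᶠ[𝓝 z] 0
  map_zero : D 0 = 1
  map_one : D 1 = 1
  left_mem : (0 : ℝ) ∈ J → S₀ ∈ 𝓝 0
  left_eq : (0 : ℝ) ∉ J → S₀ = ∅
  right_mem : (1 : ℝ) ∈ J → S₁ ∈ 𝓝 1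
  right_eq : (1 : ℝ) ∉ J → S₁ = ∅
  left_compl : S₀ᶜ ∈ 𝓝 1
  right_compl : S₁ᶜ ∈ 𝓝 0
  off : ∀ x ∈ unitInt, x ∉ B → D x = 1 ∧ deriv D x = 0 ∧ x ∉ S₀ ∧ x ∉ S₁

/-- The only boundary point of the half-line is `a`, where `D` vanishes. The proposition `P` lets
the zone be empty when the endpoint is not a jump. -/
theorem splits_Iio {D : ℝ → ℝ} {P : Prop} {a : ℝ} (h : P → D =ᶠ[𝓝 a] 0) :
    Splits D {x | P ∧ x < a} := by
  intro x
  by_cases hP : P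
  · simp only [hP, true_and]
    rcases lt_trichotomy x a with hx | rfl | hx
    · exact .inl (Iio_mem_nhds hx)
    · exact .inr (.inr (h hP))
    · exact .inr (.inl (mem_of_superset (Ioi_mem_nhds hx) fun y (hy : a < y) => not_lt.2 hy.le))
  · simp [hP]

theorem splits_Ioi {D : ℝ → ℝ} {P : Prop} {a : ℝ} (h : P → D =ᶠ[𝓝 a] 0) :
    Splits D {x | P ∧ a < x} := by
  intro x
  by_cases hP : P
  · simp only [hP, true_and]
    rcases lt_trichotomy x a with hx | rfl | hx
    · exact .inr (.inl (mem_of_superset (Iio_mem_nhds hx) fun y (hy : y < a) => not_lt.2 hy.le))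
    · exact .inr (.inr (h hP))
    · exact .inl (Ioi_mem_nhds hx)
  · simp [hP]

/-- The sum of copies of the profile `b` at scale `ε`, placed at the points `c z`. -/
noncomputable def wells (b : ℝ → ℝ) (ε : ℝ) (J : Finset ℝ) (c : ℝ → ℝ) (x : ℝ) : ℝ :=
  1 - ∑ z ∈ J, b ((x - c z) / ε)

section Wells

variable {b : ℝ → ℝ} {ε T κ : ℝ} {J : Finset ℝ} {c : ℝ → ℝ}

theorem contDiff_wells (hb : ContDiff ℝ ∞ b) : ContDiff ℝ ∞ (wells b ε J c) := by
  unfold wells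
  fun_prop

theorem deriv_wells (hb : ContDiff ℝ ∞ b) (x : ℝ) :
    deriv (wells b ε J c) x = - ∑ z ∈ J, deriv b ((x - c z) / ε) / ε := by
  have hd : Differentiable ℝ b := hb.differentiable (by simp)
  have h1 : ∀ z ∈ J, HasDerivAt (fun x => b ((x - c z) / ε)) (deriv b ((x - c z) / ε) / ε) x := by
    intro z _
    have := (hd ((x - c z) / ε)).hasDerivAt.comp x (((hasDerivAt_id x).sub_const (c z)).div_const ε)
    exact this.congr_deriv (by simp [div_eq_mul_inv])
  exact ((HasDerivAt.fun_sum h1).const_sub 1).deriv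

variable (hε : 0 < ε) (hT : ∀ t, T ≤ |t| → b t = 0 ∧ deriv b t = 0)

include hε hT in
theorem profile_far {x a : ℝ} (h : T * ε ≤ |x - a|) :
    b ((x - a) / ε) = 0 ∧ deriv b ((x - a) / ε) = 0 :=
  hT _ (by rwa [abs_div, abs_of_pos hε, le_div_iff₀ hε])

variable (hsep : ∀ z ∈ J, ∀ y ∈ J, z ≠ y → 2 * (T * ε) ≤ |c z - c y|)

include hε hT hsep in
-- The centres are at least `2Tε` apart, so within `Tε` of one of them every other profile is zero
-- together with its derivative.
theorem wells_near (hb : ContDiff ℝ ∞ b) {z x : ℝ} (hz : z ∈ J) (hx : |x - c z| ≤ T * ε) :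
    wells b ε J c x = 1 - b ((x - c z) / ε) ∧
      deriv (wells b ε J c) x = - (deriv b ((x - c z) / ε) / ε) := by
  have far : ∀ y ∈ J, y ≠ z → T * ε ≤ |x - c y| := by
    intro y hy hyz
    have h1 := hsep y hy z hz hyz
    have h2 : |c y - c z| ≤ |x - c y| + |x - c z| := by
      rw [abs_sub_comm x (c y)]
      exact abs_sub_le _ _ _
    linarith
  constructor
  · rw [wells, Finset.sum_eq_single z (fun y hy hyz => (profile_far hε hT (far y hy hyz)).1)
      (fun h => absurd hz h)]
  · rw [deriv_wells hb, Finset.sum_eq_single z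
      (fun y hy hyz => by rw [(profile_far hε hT (far y hy hyz)).2, zero_div])
      (fun h => absurd hz h)]

include hε hT in
theorem wells_far (hb : ContDiff ℝ ∞ b) {x : ℝ} (hx : ∀ z ∈ J, T * ε ≤ |x - c z|) :
    wells b ε J c x = 1 ∧ deriv (wells b ε J c) x = 0 := by
  constructor
  · rw [wells, Finset.sum_eq_zero fun z hz => (profile_far hε hT (hx z hz)).1, sub_zero]
  · rw [deriv_wells hb, Finset.sum_eq_zero fun z hz => by
      rw [(profile_far hε hT (hx z hz)).2, zero_div], neg_zero]

include hε hT hsep in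
theorem wells_mem_Icc (hb : ContDiff ℝ ∞ b) (hb01 : ∀ t, b t ∈ Icc (0 : ℝ) 1) (x : ℝ) :
    wells b ε J c x ∈ Icc (0 : ℝ) 1 := by
  by_cases h : ∃ z ∈ J, |x - c z| ≤ T * ε
  · obtain ⟨z, hz, hx⟩ := h
    rw [(wells_near hε hT hsep hb hz hx).1]
    have := hb01 ((x - c z) / ε)
    exact ⟨by linarith [this.2], by linarith [this.1]⟩
  · push Not at h
    rw [(wells_far hε hT hb fun z hz => (h z hz).le).1]
    exact ⟨zero_le_one, le_rfl⟩

include hε hT hsep in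
theorem wells_eventually_zero (hb : ContDiff ℝ ∞ b) (hκ : 0 < κ) (hκT : κ ≤ T)
    (hb1 : ∀ t, |t| ≤ κ → b t = 1) {z : ℝ} (hz : z ∈ J) : wells b ε J c =ᶠ[𝓝 (c z)] 0 := by
  filter_upwards [Metric.ball_mem_nhds (c z) (mul_pos hκ hε)] with x hx
  rw [Metric.mem_ball, Real.dist_eq] at hx
  rw [(wells_near hε hT hsep hb hz (hx.le.trans (by gcongr))).1, hb1, sub_self, Pi.zero_apply]
  rw [abs_div, abs_of_pos hε, div_le_iff₀ hε]
  exact hx.le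

include hε hT hsep in
-- The density scales as `ε⁻¹` times the unit-scale density at `(x - a)/ε`, so each well has the
-- energy of the profile whatever `ε` is. At any point at most the density of one well is active,
-- hence the sum bounds it.
theorem lintegral_wells_le (hb : ContDiff ℝ ∞ b) :
    ∫⁻ x, ENNReal.ofReal (wellDensity ε (wells b ε J c x) (deriv (wells b ε J c) x)) ≤
      J.card * ENNReal.ofReal (∫ t, wellDensity 1 (1 - b t) (deriv b t)) := by
  have hdc : Continuous (deriv b) := hb.continuous_deriv (by simp)
  have hcont : Continuous fun t => wellDensity 1 (1 - b t) (deriv b t) := by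
    have := hb.continuous
    unfold wellDensity
    fun_prop
  have hint : Integrable fun t => wellDensity 1 (1 - b t) (deriv b t) := by
    refine hcont.integrable_of_hasCompactSupport (HasCompactSupport.intro
      (isCompact_Icc (a := -T) (b := T)) fun t ht => ?_)
    have : T ≤ |t| := by
      by_contra h
      exact ht (abs_le.1 (not_le.1 h).le)
    rw [(hT t this).1, (hT t this).2]
    simp [wellDensity]
  have hscale : ∀ a : ℝ, ∫⁻ x, ENNReal.ofReal
      (wellDensity ε (1 - b ((x - a) / ε)) (deriv b ((x - a) / ε) / ε)) =
      ENNReal.ofReal (∫ t, wellDensity 1 (1 - b t) (deriv b t)) := by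
    intro a
    set F : ℝ → ℝ := fun t => wellDensity 1 (1 - b t) (deriv b t) with hF
    have e : (fun x => wellDensity ε (1 - b ((x - a) / ε)) (deriv b ((x - a) / ε) / ε)) =
        fun x => ε⁻¹ * F ((x - a) / ε) := by
      ext x
      simp only [hF, wellDensity]
      field_simp
    have hi : Integrable fun x => ε⁻¹ * F ((x - a) / ε) :=
      ((hint.comp_div hε.ne').comp_sub_right a).const_mul _
    rw [← e] at hi
    rw [← ofReal_integral_eq_lintegral_ofReal hi
      (Eventually.of_forall fun x => wellDensity_nonneg hε _ _), e, integral_const_mul,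
      integral_sub_right_eq_self (fun x => F (x / ε)) a, Measure.integral_comp_div F ε,
      abs_of_pos hε, smul_eq_mul, inv_mul_cancel_left₀ hε.ne']
  calc _ ≤ ∫⁻ x, ∑ z ∈ J, ENNReal.ofReal
            (wellDensity ε (1 - b ((x - c z) / ε)) (deriv b ((x - c z) / ε) / ε)) := by
        refine lintegral_mono fun x => ?_
        by_cases h : ∃ z ∈ J, |x - c z| ≤ T * ε
        · obtain ⟨z, hz, hx⟩ := h
          obtain ⟨h1, h2⟩ := wells_near hε hT hsep hb hz hx
          rw [h1, h2]
          refine le_trans (le_of_eq ?_) (Finset.single_le_sum (f := fun z => ENNReal.ofReal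
            (wellDensity ε (1 - b ((x - c z) / ε)) (deriv b ((x - c z) / ε) / ε)))
            (fun _ _ => bot_le) hz)
          simp [wellDensity]
        · push Not at h
          obtain ⟨h1, h2⟩ := wells_far hε hT hb fun z hz => (h z hz).le
          rw [h1, h2]
          simp [wellDensity]
    _ = _ := by
        rw [lintegral_finsetSum', Finset.sum_congr rfl fun z _ => hscale (c z)]
        · simp
        · intro z _
          have := hb.continuous
          refine Measurable.aemeasurable ?_
          unfold wellDensity
          fun_prop

end Wells

/-- Rescaled profiles are placed at the jumps. A well for an endpoint is centred at distance `Tε`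
inside the interval, so that `D` still equals one at the endpoint. The set `B` is a union of balls
of radius `Tε`, whence `K = 2T |J|`. -/
theorem exists_wellCutoff {J : Finset ℝ} (hJ : (J : Set ℝ) ⊆ Icc 0 1) {δ : ℝ} (hδ : 0 < δ) :
    ∃ K : ℝ, ∀ᶠ ε in 𝓝[>] (0 : ℝ), ∃ D S₀ S₁ B, WellCutoff J D S₀ S₁ B ∧
      volume B ≤ ENNReal.ofReal (K * ε) ∧
      ∫⁻ x, ENNReal.ofReal (wellDensity ε (D x) (deriv D x)) ≤
        J.card * ENNReal.ofReal (2 * √2 / 3 + δ) := by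
  obtain ⟨b, κ, hκ, T, hT0, hb, hb01, hb1, hT, hbE⟩ := exists_profile hδ
  obtain ⟨r, hr, hr01, hrs⟩ := exists_separation J
  have hκT : κ ≤ T := by
    by_contra h
    have h1 := hb1 T (by rw [abs_of_pos hT0]; exact (not_le.1 h).le)
    have h2 := (hT T (le_abs_self T)).1
    linarith
  refine ⟨J.card * (2 * T), ?_⟩
  -- The factor 4 leaves room for moving the endpoint centres: they stay `2Tε` apart from the others
  -- and the two end zones stay disjoint.
  have hsmall : ∀ᶠ ε in 𝓝[>] (0 : ℝ), 4 * (T * ε) < min r 1 := by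
    have : Tendsto (fun ε : ℝ => 4 * (T * ε)) (𝓝[>] 0) (𝓝 (4 * (T * 0))) :=
      (Continuous.tendsto (by fun_prop) 0).mono_left nhdsWithin_le_nhds
    rw [mul_zero, mul_zero] at this
    exact this.eventually (gt_mem_nhds (lt_min hr one_pos))
  filter_upwards [hsmall, self_mem_nhdsWithin] with ε hε' hε
  rw [mem_Ioi] at hε
  have hTε : 0 < T * ε := mul_pos hT0 hε
  have hεr := hε'.trans_le (min_le_left _ _)
  have hε1 := hε'.trans_le (min_le_right _ _)
  set c : ℝ → ℝ := fun z => if z = 0 then T * ε else if z = 1 then 1 - T * ε else z with hc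
  have c0 : c 0 = T * ε := by simp [hc]
  have c1 : c 1 = 1 - T * ε := by simp [hc]
  have ci : ∀ z ∈ unitInt, c z = z := fun z hz => by simp [hc, hz.1.ne', hz.2.ne]
  have cz : ∀ z, |c z - z| ≤ T * ε := by
    intro z
    by_cases h0 : z = 0
    · rw [h0, c0, sub_zero, abs_of_pos hTε]
    by_cases h1 : z = 1
    · rw [h1, c1, abs_le]; constructor <;> linarith
    · simp [hc, h0, h1, hTε.le]
  have cI : ∀ z ∈ J, T * ε ≤ c z ∧ c z ≤ 1 - T * ε := by
    intro z hz
    obtain ⟨h0, h1⟩ := hr01 z hz (hJ hz)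
    by_cases hz0 : z = 0
    · rw [hz0, c0]; constructor <;> linarith
    by_cases hz1 : z = 1
    · rw [hz1, c1]; constructor <;> linarith
    have h0 := h0.resolve_left hz0
    have h1 := h1.resolve_left hz1
    have : c z = z := by simp [hc, hz0, hz1]
    rw [this]
    constructor <;> linarith
  have hsep : ∀ z ∈ J, ∀ y ∈ J, z ≠ y → 2 * (T * ε) ≤ |c z - c y| := by
    intro z hz y hy hzy
    have h1 := hrs z hz y hy hzy
    have h2 : |z - y| ≤ |c z - z| + |c z - c y| + |c y - y| := by
      rw [abs_sub_comm (c z) z]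
      calc |z - y| ≤ |z - c z| + |c z - y| := abs_sub_le _ _ _
        _ ≤ |z - c z| + (|c z - c y| + |c y - y|) := by gcongr; exact abs_sub_le _ _ _
        _ = _ := by ring
    linarith [cz z, cz y]
  have hzero := fun z (hz : z ∈ J) => wells_eventually_zero hε hT hsep hb hκ hκT hb1 hz
  refine ⟨wells b ε J c, {x | (0 : ℝ) ∈ J ∧ x < T * ε}, {x | (1 : ℝ) ∈ J ∧ 1 - T * ε < x},
    ⋃ z ∈ J, Metric.closedBall (c z) (T * ε), ?_, ?_, ?_⟩
  · refine ⟨contDiff_wells hb, wells_mem_Icc hε hT hsep hb hb01, ?_, ?_, ?_, ?_, ?_, ?_, ?_, ?_, ?_,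
      ?_, ?_, ?_, ?_, ?_, ?_, ?_⟩
    · exact (MeasurableSet.const _).inter measurableSet_Iio
    · exact (MeasurableSet.const _).inter measurableSet_Ioi
    · exact Finset.measurableSet_biUnion _ fun z _ => Metric.isClosed_closedBall.measurableSet
    · exact splits_Iio fun h => c0 ▸ hzero 0 h
    · exact splits_Ioi fun h => c1 ▸ hzero 1 h
    · rw [Set.disjoint_left]
      rintro x ⟨_, h1⟩ ⟨_, h2⟩
      linarith
    · intro z hz hzu
      simpa only [ci z hzu] using hzero z hz
    · refine (wells_far hε hT hb fun z hz => ?_).1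
      rw [zero_sub, abs_neg]
      exact (cI z hz).1.trans (le_abs_self _)
    · refine (wells_far hε hT hb fun z hz => ?_).1
      exact le_trans (by linarith [(cI z hz).2]) (le_abs_self _)
    · intro h
      simp only [h, true_and]
      exact Iio_mem_nhds hTε
    · intro h
      simp [h]
    · intro h
      simp only [h, true_and]
      exact Ioi_mem_nhds (by linarith)
    · intro h
      simp [h]
    · exact mem_of_superset (Ioi_mem_nhds (show T * ε < 1 by linarith))
        fun x hx h => lt_asymm hx h.2
    · exact mem_of_superset (Iio_mem_nhds (show 0 < 1 - T * ε by linarith))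
        fun x hx h => lt_asymm hx h.2
    · intro x hx hxB
      simp only [mem_iUnion, Metric.mem_closedBall, Real.dist_eq, exists_prop, not_exists, not_and,
        not_le] at hxB
      obtain ⟨h1, h2⟩ := wells_far hε hT hb fun z hz => (hxB z hz).le
      refine ⟨h1, h2, ?_, ?_⟩
      · rintro ⟨h0, h3⟩
        have := hxB 0 h0
        rw [c0, lt_abs] at this
        rcases this with h | h <;> linarith [hx.1]
      · rintro ⟨h0, h3⟩
        have := hxB 1 h0
        rw [c1, lt_abs] at this
        rcases this with h | h <;> linarith [hx.2]
  · refine (measure_biUnion_finset_le _ _).trans ?_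
    simp only [Real.volume_closedBall, Finset.sum_const, nsmul_eq_mul]
    rw [show (J.card : ℝ) * (2 * T) * ε = J.card * (2 * (T * ε)) by ring,
      ENNReal.ofReal_mul (Nat.cast_nonneg _), ENNReal.ofReal_natCast]
  · refine (lintegral_wells_le hε hT hsep hb).trans ?_
    gcongr

/-! ### The competitor and its energy -/

theorem IsWeakDeriv.add {U : Set ℝ} {u v u' v' : ℝ → ℂ} (hu : IntegrableOn u U)
    (hv : IntegrableOn v U) (hu' : IntegrableOn u' U) (hv' : IntegrableOn v' U)
    (h : IsWeakDeriv U u v) (h' : IsWeakDeriv U u' v') :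
    IsWeakDeriv U (fun x => u x + u' x) (fun x => v x + v' x) := by
  intro φ φd φc φs
  have c1 : Continuous (deriv φ) := φd.continuous_deriv (by simp)
  simp only [smul_add]
  rw [integral_add (integrable_smul_of_compactSupport c1 φc.deriv hu)
      (integrable_smul_of_compactSupport c1 φc.deriv hu'),
    integral_add (integrable_smul_of_compactSupport φd.continuous φc hv)
      (integrable_smul_of_compactSupport φd.continuous φc hv'), h φ φd φc φs, h' φ φd φc φs,
    neg_add]

/-- Since `σ` vanishes near the jumps, `φσ` is an admissible test function off `J`; the factor
removes the jumps. -/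
theorem IsWeakDeriv.smul_of_eventually_zero {J : Finset ℝ} {w v : ℝ → ℂ}
    (hw : IntegrableOn w unitInt) (hv : IntegrableOn v unitInt)
    (h : IsWeakDeriv (unitInt \ (J : Set ℝ)) w v) {σ : ℝ → ℝ} (hσ : ContDiff ℝ ∞ σ)
    (hJ : ∀ z ∈ J, z ∈ unitInt → σ =ᶠ[𝓝 z] 0) :
    IsWeakDeriv unitInt (fun x => σ x • w x) (fun x => deriv σ x • w x + σ x • v x) := by
  intro φ φd φc φs
  have c1 : Continuous (deriv φ) := φd.continuous_deriv (by simp)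
  have c2 : Continuous (deriv σ) := hσ.continuous_deriv (by simp)
  have hd : ∀ x, deriv (fun y => φ y * σ y) x = deriv φ x * σ x + φ x * deriv σ x := fun x =>
    deriv_mul (φd.differentiable (by simp) x) (hσ.differentiable (by simp) x)
  have key := h (fun x => φ x * σ x) (φd.mul hσ) φc.mul_right ?_
  · rw [restrict_unitInt_diff J.finite_toSet] at key
    simp only [hd] at key
    have i1 : Integrable (fun x => deriv φ x • σ x • w x) (volume.restrict unitInt) :=
      integrable_smul_of_compactSupport c1 φc.deriv (integrableOn_smul_of_continuous hσ.continuous hw)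
    have i2 : Integrable (fun x => φ x • deriv σ x • w x) (volume.restrict unitInt) :=
      integrable_smul_of_compactSupport φd.continuous φc (integrableOn_smul_of_continuous c2 hw)
    have i3 : Integrable (fun x => φ x • σ x • v x) (volume.restrict unitInt) :=
      integrable_smul_of_compactSupport φd.continuous φc
        (integrableOn_smul_of_continuous hσ.continuous hv)
    simp only [add_smul, mul_smul, smul_add] at key ⊢
    rw [integral_add i1 i2] at key
    rw [integral_add i2 i3, neg_add, ← key]
    abel
  · intro x hx
    have hx1 : x ∈ unitInt := φs (closure_mono (Function.support_mul_subset_left φ σ) hx)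
    refine ⟨hx1, fun hxJ => ?_⟩
    have := notMem_tsupport_iff_eventuallyEq.2 (hJ x hxJ hx1)
    exact this (closure_mono (Function.support_mul_subset_right φ σ) hx)

open Classical in
/-- The function equal to `p` on `S₀`, to `q` on `S₁` and to `w` elsewhere. -/
noncomputable def glue (S₀ S₁ : Set ℝ) (p q : ℂ) (w : ℝ → ℂ) (x : ℝ) : ℂ :=
  if x ∈ S₀ then p else if x ∈ S₁ then q else w x

theorem aestronglyMeasurable_glue {S₀ S₁ : Set ℝ} (h0 : MeasurableSet S₀) (h1 : MeasurableSet S₁)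
    (p q : ℂ) {w : ℝ → ℂ} {μ : Measure ℝ} (hw : AEStronglyMeasurable w μ) :
    AEStronglyMeasurable (glue S₀ S₁ p q w) μ := by
  classical
  have e : glue S₀ S₁ p q w = S₀.piecewise (fun _ => p) (S₁.piecewise (fun _ => q) w) := by
    ext x
    simp only [glue, Set.piecewise]
  rw [e]
  exact AEStronglyMeasurable.piecewise h0 aestronglyMeasurable_const
    (AEStronglyMeasurable.piecewise h1 aestronglyMeasurable_const hw.restrict).restrict

theorem norm_glue_one {S₀ S₁ : Set ℝ} {p q : ℂ} (hp : ‖p‖ = 1) (hq : ‖q‖ = 1) {w : ℝ → ℂ} {x : ℝ}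
    (hw : ‖w x‖ = 1) : ‖glue S₀ S₁ p q w x‖ = 1 := by
  unfold glue
  split_ifs <;> assumption

theorem norm_glue_zero_le (S₀ S₁ : Set ℝ) (v : ℝ → ℂ) (x : ℝ) : ‖glue S₀ S₁ 0 0 v x‖ ≤ ‖v x‖ := by
  unfold glue
  split_ifs <;> simp

namespace WellCutoff

variable {J : Finset ℝ} {D : ℝ → ℝ} {S₀ S₁ B : Set ℝ}

/-- The product is a sum of three pieces, with `D` restricted to `S₀`, to `S₁` and to the rest. Each
restriction is smooth by `Splits`: at the interfaces of the zones `D` vanishes, so the change from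
constant to `w` is invisible. -/
theorem isWeakDeriv (h : WellCutoff J D S₀ S₁ B) {w v : ℝ → ℂ} (hw : IntegrableOn w unitInt)
    (hv : IntegrableOn v unitInt) (hwv : IsWeakDeriv (unitInt \ (J : Set ℝ)) w v) (p q : ℂ) :
    IsWeakDeriv unitInt (fun x => D x • glue S₀ S₁ p q w x)
      (fun x => deriv D x • glue S₀ S₁ p q w x + D x • glue S₀ S₁ 0 0 v x) := by
  have s2 := (h.splits_left.union h.splits_right).compl
  have cst : ∀ (S : Set ℝ) (c : ℂ), Splits D S → IsWeakDeriv unitInt (fun x => S.indicator D x • c)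
      (fun x => deriv (S.indicator D) x • c) := by
    intro S c hS
    have h1 := (IsACPrim.of_contDiff (a := 0) (b := 1)
      (contDiff_one_of_infty (hS.contDiff h.contDiff))).smul
      (IsACPrim.of_contDiff (contDiff_const (c := c)))
    have h2 : IsWeakDeriv unitInt _ _ := h1.isWeakDeriv zero_le_one
    simpa using h2
  have ic : ∀ (S : Set ℝ) (c : ℂ), Splits D S → IntegrableOn (fun x => S.indicator D x • c) unitInt
      ∧ IntegrableOn (fun x => deriv (S.indicator D) x • c) unitInt := by
    intro S c hS
    have hc := hS.contDiff h.contDiff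
    have i1 : IntegrableOn (fun _ => c) unitInt := integrableOn_const (by simp [volume_unitInt])
    exact ⟨integrableOn_smul_of_continuous hc.continuous i1,
      integrableOn_smul_of_continuous (hc.continuous_deriv (by simp)) i1⟩
  have hc2 := s2.contDiff h.contDiff
  have h2 := hwv.smul_of_eventually_zero hw hv hc2 fun z hz hzu => by
    filter_upwards [h.vanishes z hz hzu] with y hy
    simp [hy]
  have i2 := integrableOn_smul_of_continuous hc2.continuous hw
  have i2' : IntegrableOn (fun x => deriv ((S₀ ∪ S₁)ᶜ.indicator D) x • w x
      + (S₀ ∪ S₁)ᶜ.indicator D x • v x) unitInt :=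
    (integrableOn_smul_of_continuous (hc2.continuous_deriv (by simp)) hw).add
      (integrableOn_smul_of_continuous hc2.continuous hv)
  have h01 := (cst S₀ p h.splits_left).add (ic S₀ p h.splits_left).1 (ic S₀ p h.splits_left).2
    (ic S₁ q h.splits_right).1 (ic S₁ q h.splits_right).2 (cst S₁ q h.splits_right)
  have hall := h01.add ((ic S₀ p h.splits_left).1.add (ic S₁ q h.splits_right).1)
    ((ic S₀ p h.splits_left).2.add (ic S₁ q h.splits_right).2) i2 i2' h2
  simp only [h.splits_left.deriv_indicator, h.splits_right.deriv_indicator,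
    s2.deriv_indicator] at hall
  convert hall using 2 with x x <;>
  · by_cases h0 : x ∈ S₀
    · have h1 : x ∉ S₁ := Set.disjoint_left.1 h.disjoint h0
      simp [glue, h0, h1]
    · by_cases h1 : x ∈ S₁ <;> simp [glue, h0, h1]

/-- Either 0 is a jump and the glued constant supplies the boundary value, or the left zone is empty
and the trace of `w` survives because `D 0 = 1`. -/
theorem hasTraceZero (h : WellCutoff J D S₀ S₁ B) {w : ℝ → ℂ}
    (hw : (0 : ℝ) ∉ J → HasTraceZero w 1) (q : ℂ) :
    HasTraceZero (fun x => D x • glue S₀ S₁ 1 q w x) 1 := by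
  have hD : Tendsto D (𝓝[>] 0) (𝓝 1) := by
    have := h.contDiff.continuous.tendsto 0
    rw [h.map_zero] at this
    exact this.mono_left nhdsWithin_le_nhds
  by_cases h0 : (0 : ℝ) ∈ J
  · refine ⟨_, ae_eq_refl _, ?_⟩
    have := hD.smul_const (1 : ℂ)
    rw [one_smul] at this
    refine this.congr' ?_
    filter_upwards [nhdsWithin_le_nhds (h.left_mem h0)] with x hx
    simp [glue, hx]
  · obtain ⟨g, hg, hg1⟩ := hw h0
    refine ⟨fun x => D x • glue S₀ S₁ 1 q g x, ?_, ?_⟩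
    · filter_upwards [hg] with x hx
      simp [glue, hx]
    · have := hD.smul hg1
      rw [one_smul] at this
      refine this.congr' ?_
      filter_upwards [nhdsWithin_le_nhds h.right_compl] with x hx
      have hx : x ∉ S₁ := hx
      simp [glue, hx, h.left_eq h0]

theorem hasTraceOne (h : WellCutoff J D S₀ S₁ B) {w : ℝ → ℂ} {q : ℂ}
    (hw : (1 : ℝ) ∉ J → HasTraceOne w q) (p : ℂ) :
    HasTraceOne (fun x => D x • glue S₀ S₁ p q w x) q := by
  have hD : Tendsto D (𝓝[<] 1) (𝓝 1) := by
    have := h.contDiff.continuous.tendsto 1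
    rw [h.map_one] at this
    exact this.mono_left nhdsWithin_le_nhds
  by_cases h0 : (1 : ℝ) ∈ J
  · refine ⟨_, ae_eq_refl _, ?_⟩
    have := hD.smul_const q
    rw [one_smul] at this
    refine this.congr' ?_
    filter_upwards [nhdsWithin_le_nhds (h.right_mem h0)] with x hx
    have hx0 : x ∉ S₀ := Set.disjoint_right.1 h.disjoint hx
    simp [glue, hx, hx0]
  · obtain ⟨g, hg, hg1⟩ := hw h0
    refine ⟨fun x => D x • glue S₀ S₁ p q g x, ?_, ?_⟩
    · filter_upwards [hg] with x hx
      simp [glue, hx]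
    · have := hD.smul hg1
      rw [one_smul] at this
      refine this.congr' ?_
      filter_upwards [nhdsWithin_le_nhds h.left_compl] with x hx
      have hx : x ∉ S₀ := hx
      simp [glue, hx, h.right_eq h0]

theorem memLp (h : WellCutoff J D S₀ S₁ B) {w v : ℝ → ℂ}
    (hw : MemLp w 2 (volume.restrict unitInt)) (hw1 : ∀ᵐ x ∂volume.restrict unitInt, ‖w x‖ = 1)
    (hv : MemLp v 2 (volume.restrict unitInt)) {p q : ℂ} (hp : ‖p‖ = 1) (hq : ‖q‖ = 1) :
    MemLp (fun x => D x • glue S₀ S₁ p q w x) 2 (volume.restrict unitInt) ∧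
    MemLp (fun x => deriv D x • glue S₀ S₁ p q w x + D x • glue S₀ S₁ 0 0 v x) 2
      (volume.restrict unitInt) := by
  have hW : MemLp (glue S₀ S₁ p q w) 2 (volume.restrict unitInt) := by
    refine (MemLp.of_bound (aestronglyMeasurable_glue h.measurableSet_left h.measurableSet_right
      p q hw.1) 1 ?_)
    filter_upwards [hw1] with x hx using (norm_glue_one hp hq hx).le
  have hV : MemLp (glue S₀ S₁ 0 0 v) 2 (volume.restrict unitInt) :=
    hv.of_le (aestronglyMeasurable_glue h.measurableSet_left h.measurableSet_right 0 0 hv.1)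
      (.of_forall fun x => norm_glue_zero_le _ _ _ x)
  exact ⟨MemLp.smul_of_bound h.contDiff.continuous hW,
    (MemLp.smul_of_bound (h.contDiff.continuous_deriv (by simp)) hW).add
      (MemLp.smul_of_bound h.contDiff.continuous hV)⟩

end WellCutoff

/-- The radial term `d' W` is parallel to `d W` and has no twist: the steep slope of the cutoff
never enters the twist energy. -/
theorem twist_smul_add (d d' : ℝ) (W V : ℂ) :
    twist (d • W) (d' • W + d • V) = d ^ 2 * twist W V := by
  simp only [twist, Complex.add_re, Complex.add_im, Complex.real_smul, Complex.mul_re,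
    Complex.mul_im, Complex.ofReal_re, Complex.ofReal_im]
  ring

theorem sq_add_le_of_pos {θ : ℝ} (hθ : 0 < θ) (a b : ℝ) :
    (a + b) ^ 2 ≤ (1 + θ) * a ^ 2 + (1 + θ⁻¹) * b ^ 2 := by
  have h : 0 ≤ θ⁻¹ * (θ * a - b) ^ 2 := by positivity
  have e : θ⁻¹ * (θ * a - b) ^ 2 = θ * a ^ 2 - 2 * a * b + θ⁻¹ * b ^ 2 := by
    field_simp
    ring
  nlinarith

/-- Young's inequality separates the slope of the cutoff, kept with factor `1 + θ`, from the
derivative of `W` and the modulation, whose contribution is small like `ε M²`. -/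
theorem modulated_energy_le {ε θ M N d d' : ℝ} (hε : 0 < ε) (hθ : 0 < θ) (hN : 0 ≤ N)
    (hNM : N ≤ M) (hd : d ∈ Icc (0 : ℝ) 1) {W V : ℂ} (hW : ‖W‖ = 1) :
    ε / 2 * ‖d' • W + d • V + 2 * Real.pi * Complex.I * N * (d • W)‖ ^ 2
      + 1 / (4 * ε) * (‖d • W‖ ^ 2 - 1) ^ 2 ≤
    (1 + θ) * wellDensity ε d d' + (1 + θ⁻¹) * ε * (‖V‖ ^ 2 + 4 * Real.pi ^ 2 * M ^ 2) := by
  have hπ := Real.pi_pos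
  have n1 : ‖d' • W + d • V + 2 * Real.pi * Complex.I * N * (d • W)‖ ≤
      |d'| + (‖V‖ + 2 * Real.pi * M) := by
    rw [add_assoc]
    refine (norm_add_le _ _).trans ?_
    rw [norm_smul, hW, mul_one, Real.norm_eq_abs]
    gcongr
    refine (norm_add_le _ _).trans ?_
    gcongr
    · rw [norm_smul, Real.norm_eq_abs, abs_of_nonneg hd.1]
      exact mul_le_of_le_one_left (norm_nonneg _) hd.2
    · simp only [norm_mul, norm_smul, hW, Complex.norm_I, Complex.norm_real, Real.norm_eq_abs,
        abs_of_nonneg hd.1, abs_of_pos hπ, abs_of_nonneg hN, mul_one, Complex.norm_ofNat]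
      calc 2 * Real.pi * N * d ≤ 2 * Real.pi * M * 1 :=
            mul_le_mul (by gcongr) hd.2 hd.1 (mul_nonneg (by positivity) (hN.trans hNM))
        _ = _ := mul_one _
  have n2 : ‖d • W‖ = d := by rw [norm_smul, hW, mul_one, Real.norm_eq_abs, abs_of_nonneg hd.1]
  have h1 := pow_le_pow_left₀ (norm_nonneg _) n1 2
  have h2 := sq_add_le_of_pos hθ |d'| (‖V‖ + 2 * Real.pi * M)
  have h3 : (‖V‖ + 2 * Real.pi * M) ^ 2 ≤ 2 * (‖V‖ ^ 2 + 4 * Real.pi ^ 2 * M ^ 2) := by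
    nlinarith [sq_nonneg (‖V‖ - 2 * Real.pi * M)]
  rw [sq_abs] at h2
  rw [n2, wellDensity]
  have h4 : 0 ≤ 1 / (4 * ε) * (d ^ 2 - 1) ^ 2 := by positivity
  calc _ ≤ ε / 2 * ((1 + θ) * d' ^ 2 + (1 + θ⁻¹) * (2 * (‖V‖ ^ 2 + 4 * Real.pi ^ 2 * M ^ 2)))
        + 1 / (4 * ε) * (d ^ 2 - 1) ^ 2 := by
          gcongr
          refine (h1.trans h2).trans ?_
          gcongr
    _ ≤ _ := by nlinarith

/-- A crude bound without cancellation between `N` and `M`; it is needed only inside the wells, a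
set of measure of order `ε`. -/
theorem twist_defect_le {L M N d : ℝ} (hL : 0 ≤ L) (hN : 0 ≤ N) (hNM : N ≤ M)
    (hd : d ∈ Icc (0 : ℝ) 1) {W V : ℂ} (hW : ‖W‖ = 1) (d' : ℝ) :
    L / 2 * (twist (d • W) (d' • W + d • V) + ‖d • W‖ ^ 2 * (2 * Real.pi * N) - 2 * Real.pi * M) ^ 2
      ≤ L * ‖V‖ ^ 2 + 16 * L * Real.pi ^ 2 * M ^ 2 := by
  have hπ := Real.pi_pos
  have n2 : ‖d • W‖ = d := by rw [norm_smul, hW, mul_one, Real.norm_eq_abs, abs_of_nonneg hd.1]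
  have ht := abs_twist_le W V
  rw [hW, one_mul] at ht
  have hd2 : d ^ 2 ≤ 1 := pow_le_one₀ hd.1 hd.2
  have hpN : 0 ≤ 2 * Real.pi * N := by positivity
  have hpM : 2 * Real.pi * N ≤ 2 * Real.pi * M := by gcongr
  have h1 : |d ^ 2 * twist W V + d ^ 2 * (2 * Real.pi * N) - 2 * Real.pi * M| ≤
      ‖V‖ + 4 * Real.pi * M := by
    have h2 : |d ^ 2 * twist W V| ≤ ‖V‖ := by
      rw [abs_mul, abs_of_nonneg (sq_nonneg d)]
      exact (mul_le_of_le_one_left (abs_nonneg _) hd2).trans ht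
    have h3 : d ^ 2 * (2 * Real.pi * N) ≤ 2 * Real.pi * N := mul_le_of_le_one_left hpN hd2
    have h4 : 0 ≤ d ^ 2 * (2 * Real.pi * N) := by positivity
    rw [abs_le] at h2 ⊢
    constructor <;> linarith [h2.1, h2.2]
  rw [twist_smul_add, n2, ← sq_abs]
  have h2 := pow_le_pow_left₀ (abs_nonneg _) h1 2
  have h3 : (‖V‖ + 4 * Real.pi * M) ^ 2 ≤ 2 * (‖V‖ ^ 2 + 16 * Real.pi ^ 2 * M ^ 2) := by
    nlinarith [sq_nonneg (‖V‖ - 4 * Real.pi * M)]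
  calc _ ≤ L / 2 * (2 * (‖V‖ ^ 2 + 16 * Real.pi ^ 2 * M ^ 2)) := by
        gcongr
        exact h2.trans h3
    _ = _ := by ring

theorem norm_exp_I_mul (α : ℝ) : ‖Complex.exp (Complex.I * α)‖ = 1 := by
  rw [mul_comm]
  exact Complex.norm_exp_ofReal_mul_I α

theorem demodEnergy_toLp {L α β ε : ℝ} {q q' : ℝ → ℂ} (hq : MemLp q 2 (volume.restrict unitInt))
    (hq' : IsL2WeakDeriv unitInt q q') (h0 : HasTraceZero q 1)
    (h1 : HasTraceOne q (Complex.exp (Complex.I * α))) :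
    demodEnergy L α β ε (hq.toLp q) = ∫⁻ x in unitInt, ENNReal.ofReal
      (ε / 2 * ‖q' x + 2 * Real.pi * Complex.I * (pitchFloor β ε : ℝ) * q x‖ ^ 2
        + 1 / (4 * ε) * (‖q x‖ ^ 2 - 1) ^ 2
        + L / 2 * (twist (q x) (q' x) + ‖q x‖ ^ 2 * (2 * Real.pi * (pitchFloor β ε : ℝ))
          - 2 * Real.pi * ε ^ (-β)) ^ 2) := by
  have e := hq.coeFn_toLp
  have fin : volume unitInt ≠ ⊤ := by simp [volume_unitInt]
  have hu : IsL2WeakDeriv unitInt (hq.toLp q) q' := ⟨hq'.1, hq'.2.congr e.symm (ae_eq_refl _)⟩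
  have hul := Lp.memLp (hq.toLp q)
  have adm : Admissible α (hq.toLp q) := by
    refine ⟨⟨hul, q', hu⟩, ?_, ?_⟩
    · obtain ⟨g, hg, hg0⟩ := h0
      exact ⟨g, hg.trans e.symm, hg0⟩
    · obtain ⟨g, hg, hg1⟩ := h1
      exact ⟨g, hg.trans e.symm, hg1⟩
  rw [demodEnergy, if_pos adm]
  refine lintegral_congr_ae ?_
  have d1 := weakDeriv_ae_eq isOpen_unitInt fin hu
  have d2 := weakDeriv_ae_eq isOpen_unitInt fin (hu.mul_carrier hul (pitchFloor β ε))
  filter_upwards [e, d1, d2] with x he hd1 hd2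
  rw [demodDensity, modulate_eq, hd2, hd1, he, norm_mul, norm_carrier, mul_one]
  norm_cast

/-- The competitor is `D` times the glued function. It differs from `w` only on `B`, by at most 2 in
modulus, and the energy bound separates the wells, the bulk twist, the modulation error and the
twist inside the wells. -/
theorem WellCutoff.exists_competitor {L α β ε θ : ℝ} (hL : 0 ≤ L) (hε : 0 < ε) (hθ : 0 < θ)
    {J : Finset ℝ} {D : ℝ → ℝ} {S₀ S₁ B : Set ℝ} (h : WellCutoff J D S₀ S₁ B) {w : L2Space}
    (hJ : IsJumpSet α w J) {v : ℝ → ℂ} (hv : IsL2WeakDeriv (unitInt \ (J : Set ℝ)) w v) :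
    ∃ u : L2Space, edist u w ≤ 2 * volume B ^ (1 / 2 : ℝ) ∧
      demodEnergy L α β ε u ≤
        ENNReal.ofReal (1 + θ) * (∫⁻ x, ENNReal.ofReal (wellDensity ε (D x) (deriv D x))) +
        ((∫⁻ x in unitInt, ENNReal.ofReal (L / 2 * (twist (w x) (v x)
          - 2 * Real.pi * (ε ^ (-β) - ⌊ε ^ (-β)⌋)) ^ 2)) +
        (ENNReal.ofReal ((1 + θ⁻¹) * ε *
            ((∫ x in unitInt, ‖v x‖ ^ 2) + 4 * Real.pi ^ 2 * (ε ^ (-β)) ^ 2)) +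
          ((∫⁻ x in B, ENNReal.ofReal (L * ‖v x‖ ^ 2) ∂volume.restrict unitInt) +
            ENNReal.ofReal (16 * L * Real.pi ^ 2 * (ε ^ (-β)) ^ 2) * volume B))) := by
  have fin : volume unitInt ≠ ⊤ := by simp [volume_unitInt]
  set ζ := Complex.exp (Complex.I * α) with hζ
  have hζ1 : ‖ζ‖ = 1 := norm_exp_I_mul α
  have hw := Lp.memLp w
  have hv2 : MemLp v 2 (volume.restrict unitInt) := by
    have := hv.1
    rwa [restrict_unitInt_diff J.finite_toSet] at this
  have hw1 : ∀ᵐ x ∂volume.restrict unitInt, ‖w x‖ = 1 := by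
    have := hJ.memH1.2
    rwa [restrict_unitInt_diff J.finite_toSet] at this
  obtain ⟨hq, hq'⟩ := h.memLp hw hw1 hv2 norm_one hζ1
  have hqd := h.isWeakDeriv (integrableOn_of_memLp_two fin hw) (integrableOn_of_memLp_two fin hv2)
    hv.2 1 ζ
  have t0 := h.hasTraceZero (w := w) (fun h0 => by
    by_contra h1; exact h0 (hJ.zero_mem_iff.2 h1)) ζ
  have t1 := h.hasTraceOne (w := w) (q := ζ) (fun h0 => by
    by_contra h1; exact h0 (hJ.one_mem_iff.2 h1)) 1
  refine ⟨hq.toLp _, ?_, ?_⟩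
  · rw [Lp.edist_def]
    calc _ ≤ eLpNorm (B.indicator fun _ => (2 : ℝ)) 2 (volume.restrict unitInt) := by
          refine eLpNorm_mono_ae ?_
          filter_upwards [hq.coeFn_toLp, hw1, ae_restrict_mem measurableSet_unitInt]
            with x hx hx1 hxu
          rw [Pi.sub_apply, hx]
          by_cases hB : x ∈ B
          · rw [indicator_of_mem hB]
            refine (norm_sub_le _ _).trans ?_
            rw [norm_smul, norm_glue_one norm_one hζ1 hx1, hx1, Real.norm_eq_abs,
              abs_of_nonneg (h.mem_Icc x).1, Real.norm_ofNat]
            linarith [(h.mem_Icc x).2]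
          · obtain ⟨h1, -, h2, h3⟩ := h.off x hxu hB
            simp [glue, h1, h2, h3, hB]
      _ = 2 * (volume.restrict unitInt) B ^ (1 / 2 : ℝ) := by
          rw [eLpNorm_indicator_const h.measurableSet two_ne_zero ENNReal.ofNat_ne_top,
            Real.enorm_of_nonneg zero_le_two]
          simp
      _ ≤ _ := by
          gcongr
          exact Measure.restrict_le_self
  · rw [demodEnergy_toLp hq ⟨hq', hqd⟩ t0 t1]
    set M := ε ^ (-β) with hM
    have hM0 : 0 ≤ M := (Real.rpow_pos_of_pos hε _).le
    have hN : (0 : ℝ) ≤ (pitchFloor β ε : ℝ) := by exact_mod_cast Int.floor_nonneg.2 hM0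
    have hNM : (pitchFloor β ε : ℝ) ≤ M := Int.floor_le _
    have key : ∀ᵐ x ∂volume.restrict unitInt, ENNReal.ofReal
        (ε / 2 * ‖deriv D x • glue S₀ S₁ 1 ζ w x + D x • glue S₀ S₁ 0 0 v x
            + 2 * Real.pi * Complex.I * (pitchFloor β ε : ℝ) * (D x • glue S₀ S₁ 1 ζ w x)‖ ^ 2
          + 1 / (4 * ε) * (‖D x • glue S₀ S₁ 1 ζ w x‖ ^ 2 - 1) ^ 2
          + L / 2 * (twist (D x • glue S₀ S₁ 1 ζ w x)
              (deriv D x • glue S₀ S₁ 1 ζ w x + D x • glue S₀ S₁ 0 0 v x)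
            + ‖D x • glue S₀ S₁ 1 ζ w x‖ ^ 2 * (2 * Real.pi * (pitchFloor β ε : ℝ))
            - 2 * Real.pi * M) ^ 2) ≤
        ENNReal.ofReal ((1 + θ) * wellDensity ε (D x) (deriv D x)) +
        (ENNReal.ofReal (L / 2 * (twist (w x) (v x) - 2 * Real.pi * (M - ⌊M⌋)) ^ 2) +
        (ENNReal.ofReal ((1 + θ⁻¹) * ε * (‖v x‖ ^ 2 + 4 * Real.pi ^ 2 * M ^ 2)) +
          B.indicator (fun x => ENNReal.ofReal (L * ‖v x‖ ^ 2)
            + ENNReal.ofReal (16 * L * Real.pi ^ 2 * M ^ 2)) x)) := by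
      filter_upwards [hw1, ae_restrict_mem measurableSet_unitInt] with x hx1 hxu
      have hW := norm_glue_one (S₀ := S₀) (S₁ := S₁) norm_one hζ1 hx1
      have hV := norm_glue_zero_le S₀ S₁ v x
      have hwd := wellDensity_nonneg hε (D x) (deriv D x)
      have b1 := modulated_energy_le (d' := deriv D x) (V := glue S₀ S₁ 0 0 v x) hε hθ hN hNM
        (h.mem_Icc x) hW
      have b1' : (1 + θ⁻¹) * ε * (‖glue S₀ S₁ 0 0 v x‖ ^ 2 + 4 * Real.pi ^ 2 * M ^ 2) ≤
          (1 + θ⁻¹) * ε * (‖v x‖ ^ 2 + 4 * Real.pi ^ 2 * M ^ 2) := by gcongr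
      have p1 : 0 ≤ (1 + θ) * wellDensity ε (D x) (deriv D x) := by positivity
      have p2 : 0 ≤ (1 + θ⁻¹) * ε * (‖v x‖ ^ 2 + 4 * Real.pi ^ 2 * M ^ 2) := by positivity
      by_cases hB : x ∈ B
      -- Inside the wells the twist is charged to the indicator term; the nonnegative bulk term is
      -- then simply added.
      · have b2 := twist_defect_le hL hN hNM (h.mem_Icc x) hW (V := glue S₀ S₁ 0 0 v x) (deriv D x)
        have b2' : L * ‖glue S₀ S₁ 0 0 v x‖ ^ 2 ≤ L * ‖v x‖ ^ 2 := by gcongr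
        have p3 : 0 ≤ L * ‖v x‖ ^ 2 := by positivity
        have p4 : 0 ≤ 16 * L * Real.pi ^ 2 * M ^ 2 := by positivity
        rw [indicator_of_mem hB, ← ENNReal.ofReal_add p3 p4]
        calc _ ≤ ENNReal.ofReal ((1 + θ) * wellDensity ε (D x) (deriv D x) +
              ((1 + θ⁻¹) * ε * (‖v x‖ ^ 2 + 4 * Real.pi ^ 2 * M ^ 2) +
              (L * ‖v x‖ ^ 2 + 16 * L * Real.pi ^ 2 * M ^ 2))) :=
              ENNReal.ofReal_le_ofReal (by linarith)
          _ = _ := by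
              rw [ENNReal.ofReal_add p1 (add_nonneg p2 (add_nonneg p3 p4)),
                ENNReal.ofReal_add p2 (add_nonneg p3 p4)]
          _ ≤ _ := by
              exact add_le_add le_rfl le_add_self
      · obtain ⟨h1, h1', h2, h3⟩ := h.off x hxu hB
        rw [indicator_of_notMem hB, add_zero]
        have gw : glue S₀ S₁ 1 ζ w x = w x := by simp [glue, h2, h3]
        have gv : glue S₀ S₁ 0 0 v x = v x := by simp [glue, h2, h3]
        rw [twist_smul_add]
        rw [gw, gv] at b1 ⊢
        -- Off the wells the modulus is exactly one, so the two large terms cancel down to the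
        -- fractional part.
        have e : D x ^ 2 * twist (w x) (v x) + ‖D x • w x‖ ^ 2 * (2 * Real.pi * (pitchFloor β ε : ℝ))
            - 2 * Real.pi * M = twist (w x) (v x) - 2 * Real.pi * (M - ⌊M⌋) := by
          rw [norm_smul, h1, hx1, pitchFloor]
          simp only [norm_one, hM]
          ring
        rw [e]
        have p3 : 0 ≤ L / 2 * (twist (w x) (v x) - 2 * Real.pi * (M - ⌊M⌋)) ^ 2 := by positivity
        rw [← ENNReal.ofReal_add p3 p2, ← ENNReal.ofReal_add p1 (add_nonneg p3 p2)]
        exact ENNReal.ofReal_le_ofReal (by linarith)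
    refine (lintegral_mono_ae key).trans ?_
    have mD : Measurable fun x => ENNReal.ofReal (wellDensity ε (D x) (deriv D x)) := by
      have c1 := h.contDiff.continuous
      have c2 : Continuous (deriv D) := h.contDiff.continuous_deriv (by simp)
      unfold wellDensity
      fun_prop
    have mv : AEMeasurable v (volume.restrict unitInt) := hv2.1.aemeasurable
    have mw : AEMeasurable w (volume.restrict unitInt) := hw.1.aemeasurable
    have mt : AEMeasurable (fun x => ENNReal.ofReal
        (L / 2 * (twist (w x) (v x) - 2 * Real.pi * (M - ⌊M⌋)) ^ 2)) (volume.restrict unitInt) := by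
      unfold twist
      have := Complex.measurable_re.comp_aemeasurable mw
      have := Complex.measurable_im.comp_aemeasurable mw
      have := Complex.measurable_re.comp_aemeasurable mv
      have := Complex.measurable_im.comp_aemeasurable mv
      fun_prop
    have hθ1 : 0 ≤ 1 + θ := by positivity
    have i1 : Integrable (fun x => ‖v x‖ ^ 2) (volume.restrict unitInt) := hv2.norm.integrable_sq
    simp only [ENNReal.ofReal_mul hθ1]
    rw [lintegral_add_left' (mD.const_mul _).aemeasurable, lintegral_add_left' mt,
      lintegral_add_left' (by fun_prop), lintegral_const_mul _ mD,
      lintegral_indicator h.measurableSet, lintegral_add_right _ measurable_const,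
      lintegral_const]
    refine add_le_add (mul_le_mul_right (lintegral_mono' Measure.restrict_le_self le_rfl) _)
      (add_le_add le_rfl (add_le_add (le_of_eq ?_) (add_le_add le_rfl (mul_le_mul_right ?_ _))))
    · have i2 : Integrable (fun x => ‖v x‖ ^ 2 + 4 * Real.pi ^ 2 * M ^ 2) (volume.restrict unitInt) :=
        i1.add (integrable_const _)
      rw [← ofReal_integral_eq_lintegral_ofReal (i2.const_mul _) (.of_forall fun x =>
        (by positivity : 0 ≤ (1 + θ⁻¹) * ε * (‖v x‖ ^ 2 + 4 * Real.pi ^ 2 * M ^ 2))),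
        integral_const_mul, integral_add i1 (integrable_const _)]
      simp
    · rw [Measure.restrict_apply_univ]
      exact Measure.restrict_apply_le _ _

/-! ### The recovery sequence and the conclusion -/

theorem memLp_twist_of_norm_eq_one {w v : ℝ → ℂ} {μ : Measure ℝ} (hw : AEStronglyMeasurable w μ)
    (hw1 : ∀ᵐ x ∂μ, ‖w x‖ = 1) (hv : MemLp v 2 μ) : MemLp (fun x => twist (w x) (v x)) 2 μ := by
  refine hv.of_le ?_ ?_
  · have mv := hv.1.aemeasurable
    have mw := hw.aemeasurable
    have := Complex.measurable_re.comp_aemeasurable mw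
    have := Complex.measurable_im.comp_aemeasurable mw
    have := Complex.measurable_re.comp_aemeasurable mv
    have := Complex.measurable_im.comp_aemeasurable mv
    refine AEMeasurable.aestronglyMeasurable ?_
    unfold twist
    fun_prop
  · filter_upwards [hw1] with x hx
    have := abs_twist_le (w x) (v x)
    rwa [hx, one_mul] at this

/-- Young's inequality again, to replace the actual fractional part `a` by its limit `A`. -/
theorem lintegral_twist_shift_le {L θ A a : ℝ} (hL : 0 ≤ L) (hθ : 0 < θ) {t : ℝ → ℝ}
    (ht : MemLp t 2 (volume.restrict unitInt)) :
    ∫⁻ x in unitInt, ENNReal.ofReal (L / 2 * (t x - 2 * Real.pi * a) ^ 2) ≤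
      ENNReal.ofReal ((1 + θ) * (L / 2 * ∫ x in unitInt, (t x - 2 * Real.pi * A) ^ 2)
        + (1 + θ⁻¹) * (L / 2 * (2 * Real.pi * (a - A)) ^ 2)) := by
  have m : ∀ s : ℝ, MemLp (fun x => t x - s) 2 (volume.restrict unitInt) :=
    fun s => ht.sub (memLp_const s)
  rw [lintegral_ofReal_sq (m _) (by positivity)]
  refine ENNReal.ofReal_le_ofReal ?_
  have h1 : ∫ x in unitInt, (t x - 2 * Real.pi * a) ^ 2 ≤ ∫ x in unitInt,
      ((1 + θ) * (t x - 2 * Real.pi * A) ^ 2 + (1 + θ⁻¹) * (2 * Real.pi * (a - A)) ^ 2) := by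
    refine integral_mono (m _).integrable_sq
      (((m _).integrable_sq.const_mul _).add (integrable_const _)) fun x => ?_
    have := sq_add_le_of_pos hθ (t x - 2 * Real.pi * A) (-(2 * Real.pi * (a - A)))
    rw [neg_sq] at this
    refine le_trans (le_of_eq ?_) this
    dsimp only
    ring
  rw [integral_add ((m _).integrable_sq.const_mul _) (integrable_const _), integral_const_mul,
    integral_const, probReal_univ, one_smul] at h1
  calc _ ≤ L / 2 * _ := mul_le_mul_of_nonneg_left h1 (by positivity)
    _ = _ := by ring

theorem jumpTwistValue_eq {L A : ℝ} (hL : 0 ≤ L) {w : ℝ → ℂ} {J : Finset ℝ}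
    (ht : MemLp (fun x => twist (w x) (weakDeriv (unitInt \ (J : Set ℝ)) w x)) 2
      (volume.restrict unitInt)) :
    jumpTwistValue L A w J = ENNReal.ofReal
      (L / 2 * (∫ x in unitInt, (twist (w x) (weakDeriv (unitInt \ (J : Set ℝ)) w x)
        - 2 * Real.pi * A) ^ 2) + J.card * (2 * √2 / 3)) := by
  have hi : 0 ≤ ∫ x in unitInt, (twist (w x) (weakDeriv (unitInt \ (J : Set ℝ)) w x)
        - 2 * Real.pi * A) ^ 2 := integral_nonneg fun x => sq_nonneg _
  have m : MemLp (fun x => twist (w x) (weakDeriv (unitInt \ (J : Set ℝ)) w x) - 2 * Real.pi * A) 2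
    (volume.restrict unitInt) := ht.sub (memLp_const _)
  rw [jumpTwistValue, lintegral_ofReal_sq m (by positivity),
    ENNReal.ofReal_add (by positivity) (by positivity), mul_comm (J.card : ℝ),
    ENNReal.ofReal_mul (p := 2 * √2 / 3) (by positivity), ENNReal.ofReal_natCast]

/-- The product is `ε^{1-2β}`; this is the use of `β < 1/2` in the upper bound. -/
theorem tendsto_mul_rpow_sq {β : ℝ} (hβ : β < 1 / 2) {ε : ℕ → ℝ} (hεpos : ∀ l, 0 < ε l)
    (hε : Tendsto ε atTop (𝓝 0)) : Tendsto (fun l => ε l * (ε l ^ (-β)) ^ 2) atTop (𝓝 0) := by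
  have h : Tendsto (fun l => ε l ^ (1 - 2 * β)) atTop (𝓝 (0 ^ (1 - 2 * β))) :=
    (Real.continuousAt_rpow_const _ _ (.inr (by linarith))).tendsto.comp hε
  rw [Real.zero_rpow (by linarith)] at h
  refine h.congr fun l => ?_
  rw [← Real.rpow_natCast, ← Real.rpow_mul (hεpos l).le]
  nth_rw 2 [← Real.rpow_one (ε l)]
  rw [← Real.rpow_add (hεpos l)]
  congr 1
  push_cast
  ring

theorem eventually_exists_near {L α β A : ℝ} (hL : 0 ≤ L) (hβ : β < 1 / 2) {ε : ℕ → ℝ}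
    (hεpos : ∀ l, 0 < ε l) (hε : Tendsto ε atTop (𝓝 0))
    (hlim : Tendsto (fun l => (ε l) ^ (-β) - (⌊(ε l) ^ (-β)⌋ : ℝ)) atTop (𝓝 A))
    {w : L2Space} {J : Finset ℝ} (hJ : IsJumpSet α w J) {η : ℝ} (hη : 0 < η) :
    ∀ᶠ l in atTop, ∃ u : L2Space, edist u w ≤ ENNReal.ofReal η ∧
      demodEnergy L α β (ε l) u ≤ jumpTwistValue L A w J + ENNReal.ofReal η := by
  obtain ⟨v₀, hv₀⟩ := hJ.memH1.1.2
  have hv := weakDeriv_spec hv₀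
  set v := weakDeriv (unitInt \ (J : Set ℝ)) w with hvdef
  have hres := restrict_unitInt_diff J.finite_toSet
  have hw1 : ∀ᵐ x ∂volume.restrict unitInt, ‖w x‖ = 1 := by
    have := hJ.memH1.2
    rwa [hres] at this
  have hv2 : MemLp v 2 (volume.restrict unitInt) := by
    have := hv.1
    rwa [hres] at this
  have ht := memLp_twist_of_norm_eq_one (Lp.memLp w).1 hw1 hv2
  rw [jumpTwistValue_eq hL ht, ← hvdef]
  set a := L / 2 * ∫ x in unitInt, (twist (w x) (v x) - 2 * Real.pi * A) ^ 2 with ha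
  have ha0 : 0 ≤ a := mul_nonneg (by positivity) (integral_nonneg fun x => sq_nonneg _)
  set G := ∫ x in unitInt, ‖v x‖ ^ 2 with hG
  have hG0 : 0 ≤ G := integral_nonneg fun x => sq_nonneg _
  -- One parameter serves as the Young constant and as the tolerance of the profile. It uses up
  -- `η/2`; the twist of `v` in the wells and the vanishing remainder get `η/4` each.
  obtain ⟨θ, hθs, hθ⟩ : ∃ θ, (1 + θ) * (J.card * (2 * √2 / 3 + θ)) + (1 + θ) * a <
      a + J.card * (2 * √2 / 3) + η / 2 ∧ 0 < θ := by
    have hc : Tendsto (fun θ : ℝ => (1 + θ) * (J.card * (2 * √2 / 3 + θ)) + (1 + θ) * a) (𝓝[>] 0)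
        (𝓝 ((1 + 0) * (J.card * (2 * √2 / 3 + 0)) + (1 + 0) * a)) :=
      (Continuous.tendsto (by fun_prop) 0).mono_left nhdsWithin_le_nhds
    exact ((hc.eventually (gt_mem_nhds (by linarith))).and self_mem_nhdsWithin).exists
  obtain ⟨K, hK⟩ := exists_wellCutoff hJ.subset hθ
  have hε0 : Tendsto ε atTop (𝓝[>] 0) :=
    tendsto_nhdsWithin_iff.2 ⟨hε, .of_forall hεpos⟩
  have hfin : ∫⁻ x in unitInt, ENNReal.ofReal (L * ‖v x‖ ^ 2) ≠ ⊤ := by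
    rw [lintegral_ofReal_sq hv2.norm hL]
    exact ENNReal.ofReal_ne_top
  -- Absolute continuity of the integral: `v` is fixed while the wells shrink.
  obtain ⟨ρ, hρ, hρB⟩ := exists_pos_setLIntegral_lt_of_measure_lt hfin
    (ENNReal.ofReal_pos.2 (show 0 < η / 4 by positivity)).ne'
  have hKε : Tendsto (fun l => ENNReal.ofReal (K * ε l)) atTop (𝓝 0) := by
    have := ENNReal.tendsto_ofReal (hε.const_mul K)
    rwa [mul_zero, ENNReal.ofReal_zero] at this
  have hdist : Tendsto (fun l => 2 * ENNReal.ofReal (K * ε l) ^ (1 / 2 : ℝ)) atTop (𝓝 0) := by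
    have h1 := (ENNReal.continuous_rpow_const (y := 1 / 2)).tendsto 0 |>.comp hKε
    have h2 := ENNReal.Tendsto.const_mul h1 (.inr ENNReal.ofNat_ne_top : _ ∨ (2 : ℝ≥0∞) ≠ ⊤)
    simpa using h2
  have hrem : Tendsto (fun l => (1 + θ⁻¹) * (L / 2 * (2 * Real.pi *
      ((ε l ^ (-β) - (⌊ε l ^ (-β)⌋ : ℝ)) - A)) ^ 2)
      + (1 + θ⁻¹) * ε l * (G + 4 * Real.pi ^ 2 * (ε l ^ (-β)) ^ 2)
      + 16 * L * Real.pi ^ 2 * (ε l ^ (-β)) ^ 2 * |K * ε l|) atTop (𝓝 0) := by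
    have h1 := tendsto_mul_rpow_sq hβ hεpos hε
    have h2 := (((((hlim.sub_const A).const_mul (2 * Real.pi)).pow 2).const_mul
      (L / 2)).const_mul (1 + θ⁻¹))
    have h3 := (((hε.mul_const G).add (h1.const_mul (4 * Real.pi ^ 2))).const_mul (1 + θ⁻¹))
    have h4 := h1.const_mul (16 * L * Real.pi ^ 2 * |K|)
    have h5 := (h2.add h3).add h4
    rw [show (1 + θ⁻¹) * (L / 2 * (2 * Real.pi * (A - A)) ^ 2)
      + (1 + θ⁻¹) * (0 * G + 4 * Real.pi ^ 2 * 0) + 16 * L * Real.pi ^ 2 * |K| * 0 = 0 by ring]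
      at h5
    refine h5.congr fun l => ?_
    rw [abs_mul, abs_of_pos (hεpos l)]
    ring
  filter_upwards [hε0.eventually hK, hKε.eventually (gt_mem_nhds hρ),
    hdist.eventually (gt_mem_nhds (ENNReal.ofReal_pos.2 hη)),
    hrem.eventually (gt_mem_nhds (show 0 < η / 4 by positivity))] with l hcut hl1 hl2 hl3
  obtain ⟨D, S₀, S₁, B, hD, hB, hDE⟩ := hcut
  obtain ⟨u, hu1, hu2⟩ := hD.exists_competitor (β := β) hL (hεpos l) hθ hJ hv
  refine ⟨u, hu1.trans (le_trans ?_ hl2.le), hu2.trans ?_⟩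
  · gcongr
  set M := ε l ^ (-β) with hM
  have e1 : ENNReal.ofReal (1 + θ) *
      (∫⁻ x, ENNReal.ofReal (wellDensity (ε l) (D x) (deriv D x))) ≤
      ENNReal.ofReal ((1 + θ) * (J.card * (2 * √2 / 3 + θ))) := by
    rw [ENNReal.ofReal_mul (by positivity), ENNReal.ofReal_mul (Nat.cast_nonneg _),
      ENNReal.ofReal_natCast]
    exact mul_le_mul_right hDE _
  have e2 := lintegral_twist_shift_le (A := A) (a := M - ⌊M⌋) hL hθ ht
  have e3 : ∫⁻ x in B, ENNReal.ofReal (L * ‖v x‖ ^ 2) ∂volume.restrict unitInt ≤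
      ENNReal.ofReal (η / 4) :=
    (hρB B (((Measure.restrict_apply_le _ _).trans hB).trans_lt hl1)).le
  have e4 : ENNReal.ofReal (16 * L * Real.pi ^ 2 * M ^ 2) * volume B ≤
      ENNReal.ofReal (16 * L * Real.pi ^ 2 * M ^ 2 * |K * ε l|) := by
    rw [ENNReal.ofReal_mul (p := 16 * L * Real.pi ^ 2 * M ^ 2) (by positivity)]
    exact mul_le_mul_right (hB.trans (ENNReal.ofReal_le_ofReal (le_abs_self _))) _
  have hεl := hεpos l
  refine (add_le_add e1 (add_le_add e2 (add_le_add le_rfl (add_le_add e3 e4)))).trans ?_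
  rw [← ENNReal.ofReal_add (by positivity) (by positivity),
    ← ENNReal.ofReal_add (by positivity) (by positivity),
    ← ENNReal.ofReal_add (by positivity) (by positivity),
    ← ENNReal.ofReal_add (by positivity) (by positivity),
    ← ENNReal.ofReal_add (by positivity) hη.le]
  refine ENNReal.ofReal_le_ofReal ?_
  rw [← ha]
  linarith

/-- A diagonal argument without explicit indices: for each `l` take a near-minimiser of the larger
of the distance to `x` and the energy excess over `E`. The infimum tends to zero by assumption, and
so do both quantities. -/
theorem exists_recovery_sequence {X : Type*} [PseudoEMetricSpace X] {F : ℕ → X → ℝ≥0∞} {x : X}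
    {E : ℝ≥0∞} (h : ∀ η : ℝ, 0 < η → ∀ᶠ l in atTop, ∃ u : X, edist u x ≤ ENNReal.ofReal η ∧
      F l u ≤ E + ENNReal.ofReal η) :
    ∃ u : ℕ → X, Tendsto u atTop (𝓝 x) ∧ limsup (fun l => F l (u l)) atTop ≤ E := by
  set Q : ℕ → X → ℝ≥0∞ := fun l u => max (edist u x) (F l u - E) with hQ
  -- The infimum need not be attained; the slack `1/(l + 1)` is harmless in the limit.
  have hinf : ∀ l, ∃ u, Q l u ≤ (⨅ u, Q l u) + ENNReal.ofReal (1 / (l + 1)) := by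
    intro l
    by_cases ht : (⨅ u, Q l u) = ⊤
    · exact ⟨x, by rw [ht, top_add]; exact le_top⟩
    · obtain ⟨u, hu⟩ := iInf_lt_iff.1 (ENNReal.lt_add_right ht
        (ENNReal.ofReal_pos.2 (show (0 : ℝ) < 1 / (l + 1) by positivity)).ne')
      exact ⟨u, hu.le⟩
  choose u hu using hinf
  have hQ0 : ∀ η : ℝ, 0 < η → ∀ᶠ l in atTop, Q l (u l) ≤ ENNReal.ofReal η := by
    intro η hη
    filter_upwards [h (η / 2) (half_pos hη),
      tendsto_one_div_add_atTop_nhds_zero_nat.eventually (gt_mem_nhds (half_pos hη))] with l h1 h2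
    obtain ⟨y, hy1, hy2⟩ := h1
    refine (hu l).trans ?_
    rw [← add_halves η, ENNReal.ofReal_add (half_pos hη).le (half_pos hη).le]
    refine add_le_add ((iInf_le _ y).trans (max_le hy1 (tsub_le_iff_left.2 hy2)))
      (ENNReal.ofReal_le_ofReal h2.le)
  refine ⟨u, ?_, ?_⟩
  · rw [EMetric.tendsto_nhds]
    intro r hr
    obtain ⟨s, -, hs0, hsr⟩ := ENNReal.lt_iff_exists_real_btwn.1 hr
    rw [ENNReal.ofReal_pos] at hs0
    filter_upwards [hQ0 s hs0] with l hl
    exact ((le_max_left _ _).trans hl).trans_lt hsr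
  · refine ENNReal.le_of_forall_pos_le_add fun η hη _ => ?_
    refine limsup_le_of_le (by isBoundedDefault) ?_
    filter_upwards [hQ0 η hη] with l hl
    have := (le_max_right _ _).trans hl
    rw [ENNReal.ofReal_coe_nnreal] at this
    exact tsub_le_iff_left.1 this

theorem theorem5p3 (L α β A : ℝ) (hL : 0 < L) (hα : α ∈ Set.Ico 0 (2 * Real.pi))
    (hβ0 : 0 < β) (hβ : β < 1 / 2) (hA : A ∈ Set.Icc (0 : ℝ) 1)
    (ε : ℕ → ℝ) (hεpos : ∀ l, 0 < ε l) (hε : Tendsto ε atTop (𝓝 0))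
    (hlim : Tendsto (fun l => (ε l) ^ (-β) - (⌊(ε l) ^ (-β)⌋ : ℝ)) atTop (𝓝 A)) :
    GammaConverges (fun l => demodEnergy L α β (ε l)) (limitEnergy L α A) := by
  have lower := fun (w : L2Space) (u : ℕ → L2Space) (hu : Tendsto u atTop (𝓝 w)) =>
    limitEnergy_le_liminf (α := α) hL hβ hA hεpos hε hlim hu
  refine ⟨lower, fun w => ?_⟩
  obtain ⟨u, hu, hlimsup⟩ : ∃ u : ℕ → L2Space, Tendsto u atTop (𝓝 w) ∧
      limsup (fun l => demodEnergy L α β (ε l) (u l)) atTop ≤ limitEnergy L α A w := by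
    by_cases h : ∃ J : Finset ℝ, IsJumpSet α w J
    · have e : limitEnergy L α A w = jumpTwistValue L A w h.choose := dif_pos h
      rw [e]
      exact exists_recovery_sequence fun η hη =>
        eventually_exists_near hL.le hβ hεpos hε hlim h.choose_spec hη
    · have e : limitEnergy L α A w = ⊤ := dif_neg h
      exact ⟨fun _ => w, tendsto_const_nhds, by rw [e]; exact le_top⟩
  -- The lower bound along this same sequence turns the limsup estimate into convergence.
  exact ⟨u, hu, tendsto_of_le_liminf_of_limsup_le (lower w u hu) hlimsup⟩
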